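/- Let $K$ be a field of characteristic $0$ and let $H$ be a $K$-Hopf algebra with an ad-invariant integral $\lambda\in H^*$: $h_{(1)}\lambda(h_{(2)})=\lambda(h)1_H=\lambda(h_{(1)})h_{(2)}$, $\lambda(1)=1$, and $\lambda(h_{(1)}xS(h_{(2)}))=\varepsilon(h)\lambda(x)=\lambda(S(h_{(1)})xh_{(2)})$ for all $h,x\in H$. For coalgebras $C,D$ in ${}_H^H\mathcal{YD}$ let $C\otimes D$ have the braided coalgebra structure $\Delta(x\otimes y)=x^{(1)}\otimes x^{(2)}_{\langle-1\rangle}y^{(1)}\otimes x^{(2)}_{\langle0\rangle}\otimes y^{(2)}$; $*$ denotes convolution. Let $(R,m,u,\Delta,\varepsilon)$ be a connected pre-bialgebra in ${}_H^H\mathcal{YD}$: a coalgebra in ${}_H^H\mathcal{YD}$ whose coradical is $K1_R$, where $u:K\to R$ is a coalgebra map in ${}_H^H\mathcal{YD}$, and $m:R\otimes R\to R$ is an $H$-linear coalgebra map with unit $1_R=u(1)$ (neither associativity nor $H$-colinearity of $m$ is required). Let $\xi:R\otimes R\to H$ be a cocycle for $R$, i.e. for $z\in R\otimes R$, $r,s,t\in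 R$, $h\in H$: - $\xi(hz)=h_{(1)}\xi(z)S(h_{(2)})$; - $\Delta_H\xi(z)=\xi(z^{(1)})z^{(2)}_{\langle-1\rangle}\otimes\xi(z^{(2)}_{\langle0\rangle})$ and $\varepsilon_H\xi=\varepsilon\otimes\varepsilon$; - $m(z^{(1)})_{\langle-1\rangle}\xi(z^{(2)})\otimes m(z^{(1)})_{\langle0\rangle}=\xi(z^{(1)})z^{(2)}_{\langle-1\rangle}\otimes m(z^{(2)}_{\langle0\rangle})$; - $m(r\otimes m(s\otimes t))=m(m(z^{(1)})\otimes\xi(z^{(2)})t)$ with $z=r\otimes s$; - $\xi(r\otimes m(w^{(1)}))\,\xi(w^{(2)})=\xi\big(m(z^{(1)})\otimes\xi(z^{(2)})_{(1)}t\big)\,\xi(z^{(2)})_{(2)}$ with $w=s\otimes t$, $z=r\otimes s$; - $\xi(r\otimes1_R)=\xi(1_R\otimes r)=\varepsilon(r)1_H$. Let $A:=R\#_\xi H$ be $R\otimes H$ with the smash coproduct $\Delta_A(r\#h)=r^{(1)}\#r^{(2)}_{\langle-1\rangle}h_{(1)}\otimes r^{(2)}_{\langle0\rangle}\#h_{(2)}$,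 $\varepsilon_A=\varepsilon\otimes\varepsilon_H$, unit $1_R\#1_H$ and product $(r\#h)(s\#l)=m(z^{(1)})\#\xi(z^{(2)})h_{(2)}l$, where $z=r\otimes h_{(1)}s$. Let $v:=G(\xi)=(\lambda\xi)^{-1}$ be the convolution inverse, $\mho^2(v)(r\#h\otimes s\#l):=v(r\otimes hs)\varepsilon(l)$ and $v_A:=\mho^2(v)$. For a convolution invertible $w:A\otimes A\to K$ let $$\partial^2_A(w)=(\varepsilon\otimes w)*w(A\otimes m_A)*w^{-1}(m_A\otimes A)*(w^{-1}\otimes\varepsilon),$$ let $\partial^2_R(v):R^{\otimes3}\to K$ be $\partial_R^2(v)(r\otimes s\otimes t)=\partial^2_A(\mho^2(v))(r\#1\otimes s\#1\otimes t\#1)$, and for $\alpha:R^{\otimes 3}\to K$ let $\mho^3(\alpha)(r\#h\otimes s\#l\otimes t\#k)=\alpha(r\otimes h_{(1)}s\otimes h_{(2)}lt)\varepsilon(k)$. Then $A$ is a bialgebra, $\lambda\xi$ is convolution invertible (so $v$ exists), $v_A$ is a gauge transformation of $A$ (it is unital and convolution invertible), and $R^v:=(R,\,m^v:=v*m*v^{-1},\,u,\Delta,\varepsilon,\,\partial^2_R(v))$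 is a dual quasi-bialgebra in ${}_H^H\mathcal{YD}$. The twist $A^{v_A}$ of $A$ (regarded as a dual quasi-bialgebra with trivial reassociator) by $v_A$, which has the coalgebra structure and unit of $A$, multiplication $v_A*m_A*v_A^{-1}$ and reassociator $\partial_A^2(v_A)$, is a dual quasi-bialgebra, and $$A^{v_A}=R^v\#H,$$ where $R^v\#H$ is the bosonization of $R^v$ by $H$: the smash coproduct coalgebra $R\otimes H$ with unit $1_R\#1_H$, multiplication $(r\#h)(s\#l)=m^v(r\otimes h_{(1)}s)\#h_{(2)}l$ and reassociator $\mho^3(\partial_R^2(v))$. That is, the coalgebra structures, units, multiplications and reassociators of both sides coincide. -/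

import Mathlib

open TensorProduct

noncomputable section

section Coalgebras

/-- The underlying data of a `K`-coalgebra: comultiplication and counit, no axioms. -/
@[ext]
structure CoalgData (K C : Type*) [Field K] [AddCommGroup C] [Module K C] where
  comul : C →ₗ[K] C ⊗[K] C
  counit : C →ₗ[K] K

variable {K : Type*} [Field K]
variable {C : Type*} [AddCommGroup C] [Module K C]
variable {D : Type*} [AddCommGroup D] [Module K D]
variable {M : Type*} [AddCommGroup M] [Module K M]

/-- `x ⊗ y ↦ f x * g y` for two functionals. -/
def funcTensor (f : C →ₗ[K] K) (g : D →ₗ[K] K) : C ⊗[K] D →ₗ[K] K :=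
  LinearMap.mul' K K ∘ₗ TensorProduct.map f g

/-- The axioms of a coassociative counital coalgebra. -/
structure CoalgData.IsCoalgebra (X : CoalgData K C) : Prop where
  coassoc : (TensorProduct.assoc K C C C).toLinearMap ∘ₗ X.comul.rTensor C ∘ₗ X.comul =
    X.comul.lTensor C ∘ₗ X.comul
  counit_left : (TensorProduct.lid K C).toLinearMap ∘ₗ X.counit.rTensor C ∘ₗ X.comul =
    LinearMap.id
  counit_right : (TensorProduct.rid K C).toLinearMap ∘ₗ X.counit.lTensor C ∘ₗ X.comul =
    LinearMap.id

/-- `f` is compatible with comultiplications and counits. -/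
structure IsCoalgHom (X : CoalgData K C) (Y : CoalgData K D) (f : C →ₗ[K] D) : Prop where
  comul : Y.comul ∘ₗ f = TensorProduct.map f f ∘ₗ X.comul
  counit : Y.counit ∘ₗ f = X.counit

/-- The ordinary tensor product of coalgebras over `K` (built with the flip). -/
def CoalgData.tensor (X : CoalgData K C) (Y : CoalgData K D) : CoalgData K (C ⊗[K] D) where
  comul := (TensorProduct.tensorTensorTensorComm K C C D D).toLinearMap ∘ₗ
    TensorProduct.map X.comul Y.comul
  counit := funcTensor X.counit Y.counit

/-- The convolution product `f * g`, `x ↦ f(x₁) g(x₂)`, of a functional `f` and a linear map `g`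
with values in a vector space. -/
def CoalgData.convL (X : CoalgData K C) (f : C →ₗ[K] K) (g : C →ₗ[K] M) : C →ₗ[K] M :=
  (TensorProduct.lid K M).toLinearMap ∘ₗ TensorProduct.map f g ∘ₗ X.comul

/-- The convolution product `g * f`, `x ↦ g(x₁) f(x₂)`, of a linear map `g` with values in a
vector space and a functional `f`. -/
def CoalgData.convR (X : CoalgData K C) (g : C →ₗ[K] M) (f : C →ₗ[K] K) : C →ₗ[K] M :=
  (TensorProduct.rid K M).toLinearMap ∘ₗ TensorProduct.map g f ∘ₗ X.comul

/-- `f'` is a two-sided convolution inverse of the functional `f`. -/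
def CoalgData.IsConvInverse (X : CoalgData K C) (f f' : C →ₗ[K] K) : Prop :=
  X.convL f f' = X.counit ∧ X.convL f' f = X.counit

/-- `f ∈ Reg(C, K)`. -/
def CoalgData.IsConvInvertible (X : CoalgData K C) (f : C →ₗ[K] K) : Prop :=
  ∃ f', X.IsConvInverse f f'

open Classical in
/-- The convolution inverse of `f`, and `0` if there is none. -/
def CoalgData.convInv (X : CoalgData K C) (f : C →ₗ[K] K) : C →ₗ[K] K :=
  if h : X.IsConvInvertible f then h.choose else 0

/-- `f ↦ w * f * w⁻¹`. -/
def CoalgData.convConj (X : CoalgData K C) (w : C →ₗ[K] K) (f : C →ₗ[K] M) : C →ₗ[K] M :=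
  X.convL w (X.convR f (X.convInv w))

/-- `W` is a subcoalgebra: `Δ(W) ⊆ W ⊗ W`. -/
def CoalgData.IsSubcoalgebra (X : CoalgData K C) (W : Submodule K C) : Prop :=
  ∀ x ∈ W, X.comul x ∈ LinearMap.range (TensorProduct.map W.subtype W.subtype)

/-- `W` is a simple subcoalgebra. -/
def CoalgData.IsSimpleSubcoalgebra (X : CoalgData K C) (W : Submodule K C) : Prop :=
  X.IsSubcoalgebra W ∧ W ≠ ⊥ ∧
    ∀ W' : Submodule K C, X.IsSubcoalgebra W' → W' ≤ W → W' = ⊥ ∨ W' = W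

/-- The coradical: the sum of all simple subcoalgebras. -/
def CoalgData.coradical (X : CoalgData K C) : Submodule K C :=
  sSup {W | X.IsSimpleSubcoalgebra W}

end Coalgebras

section DualQuasiBialgebras

/-- The underlying data of a coalgebra with multiplication and unit (no axioms). -/
@[ext]
structure MulCoalgData (K D : Type*) [Field K] [AddCommGroup D] [Module K D]
    extends CoalgData K D where
  mul : D ⊗[K] D →ₗ[K] D
  one : D

/-- The underlying data of a dual quasi-bialgebra (no axioms). -/
@[ext]
structure DQBData (K D : Type*) [Field K] [AddCommGroup D] [Module K D]
    extends MulCoalgData K D where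
  reassoc : D ⊗[K] D ⊗[K] D →ₗ[K] K

variable {K : Type*} [Field K]
variable {D : Type*} [AddCommGroup D] [Module K D]

/-- The laws shared by dual quasi-bialgebras in vector spaces and in Yetter-Drinfeld modules:
unit law, unital reassociator, associativity up to the reassociator `α`, and the 3-cocycle law.
All convolution products are taken with respect to the given coalgebra structures `X₃`, `X₄` on
`D ⊗ D ⊗ D` and `D ⊗ D ⊗ D ⊗ D`. -/
structure ReassocLaws (ε : D →ₗ[K] K) (X₃ : CoalgData K (D ⊗[K] D ⊗[K] D))
    (X₄ : CoalgData K (D ⊗[K] D ⊗[K] D ⊗[K] D)) (m : D ⊗[K] D →ₗ[K] D) (e : D)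
    (α : D ⊗[K] D ⊗[K] D →ₗ[K] K) : Prop where
  one_mul : ∀ x, m (e ⊗ₜ x) = x
  mul_one : ∀ x, m (x ⊗ₜ e) = x
  invertible : X₃.IsConvInvertible α
  /-- `α(D ⊗ D ⊗ m) * α(m ⊗ D ⊗ D) = (ε ⊗ α) * α(D ⊗ m ⊗ D) * (α ⊗ ε)` -/
  cocycle :
    X₄.convL (α ∘ₗ m.lTensor (D ⊗[K] D) ∘ₗ (TensorProduct.assoc K (D ⊗[K] D) D D).toLinearMap)
        (α ∘ₗ (m.rTensor D).rTensor D) =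
      X₄.convL
        (funcTensor ε α ∘ₗ (TensorProduct.assoc K D (D ⊗[K] D) D).toLinearMap ∘ₗ
          (TensorProduct.assoc K D D D).toLinearMap.rTensor D)
        (X₄.convL
          (α ∘ₗ (m.lTensor D ∘ₗ (TensorProduct.assoc K D D D).toLinearMap).rTensor D)
          (funcTensor α ε))
  unital_left : ∀ x y, α (e ⊗ₜ x ⊗ₜ y) = ε x * ε y
  unital_mid : ∀ x y, α (x ⊗ₜ e ⊗ₜ y) = ε x * ε y
  unital_right : ∀ x y, α (x ⊗ₜ y ⊗ₜ e) = ε x * ε y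
  /-- `m(D ⊗ m) * α = α * m(m ⊗ D)` -/
  quasi_assoc :
    X₃.convR (m ∘ₗ m.lTensor D ∘ₗ (TensorProduct.assoc K D D D).toLinearMap) α =
      X₃.convL α (m ∘ₗ m.rTensor D)

/-- A coalgebra with multiplication and unit: `m` and `u` are coalgebra maps and the unit law
holds. -/
structure MulCoalgData.IsUnitalMulCoalgebra (E : MulCoalgData K D) : Prop where
  isCoalgebra : E.IsCoalgebra
  mul_hom : IsCoalgHom (E.tensor E.toCoalgData) E.toCoalgData E.mul
  comul_one : E.comul E.one = E.one ⊗ₜ E.one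
  counit_one : E.counit E.one = 1
  one_mul : ∀ x, E.mul (E.one ⊗ₜ x) = x
  mul_one : ∀ x, E.mul (x ⊗ₜ E.one) = x

/-- A `K`-bialgebra. -/
structure MulCoalgData.IsBialgebra (E : MulCoalgData K D) : Prop
    extends E.IsUnitalMulCoalgebra where
  mul_assoc : E.mul ∘ₗ E.mul.rTensor D =
    E.mul ∘ₗ E.mul.lTensor D ∘ₗ (TensorProduct.assoc K D D D).toLinearMap

/-- A dual quasi-bialgebra over `K`. -/
structure DQBData.IsDualQuasiBialgebra (E : DQBData K D) : Prop
    extends E.IsUnitalMulCoalgebra where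
  laws : ReassocLaws E.counit ((E.tensor E.toCoalgData).tensor E.toCoalgData)
    (((E.tensor E.toCoalgData).tensor E.toCoalgData).tensor E.toCoalgData) E.mul E.one E.reassoc

/-- Equip `E` with the trivial reassociator `ε ⊗ ε ⊗ ε`. -/
def MulCoalgData.withTrivialReassoc (E : MulCoalgData K D) : DQBData K D where
  toMulCoalgData := E
  reassoc := ((E.tensor E.toCoalgData).tensor E.toCoalgData).counit

/-- A gauge transformation: a unital convolution invertible map `w : D ⊗ D → K`. -/
structure MulCoalgData.IsGaugeTransformation (E : MulCoalgData K D)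
    (w : D ⊗[K] D →ₗ[K] K) : Prop where
  invertible : (E.tensor E.toCoalgData).IsConvInvertible w
  unital_left : ∀ x, w (E.one ⊗ₜ x) = E.counit x
  unital_right : ∀ x, w (x ⊗ₜ E.one) = E.counit x

/-- `∂²(w) = (ε ⊗ w) * w(D ⊗ m) * w⁻¹(m ⊗ D) * (w⁻¹ ⊗ ε)`. -/
def MulCoalgData.coboundary₂ (E : MulCoalgData K D) (w : D ⊗[K] D →ₗ[K] K) :
    D ⊗[K] D ⊗[K] D →ₗ[K] K :=
  let X₂ := E.tensor E.toCoalgData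
  let X₃ := X₂.tensor E.toCoalgData
  X₃.convL (funcTensor E.counit w ∘ₗ (TensorProduct.assoc K D D D).toLinearMap)
    (X₃.convL (w ∘ₗ E.mul.lTensor D ∘ₗ (TensorProduct.assoc K D D D).toLinearMap)
      (X₃.convL (X₂.convInv w ∘ₗ E.mul.rTensor D)
        (funcTensor (X₂.convInv w) E.counit)))

/-- The twist `D^w`: multiplication `w * m * w⁻¹` and reassociator
`(ε ⊗ w) * w(D ⊗ m) * α * w⁻¹(m ⊗ D) * (w⁻¹ ⊗ ε)`; the unit and the coalgebra are unchanged. -/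
def DQBData.twist (E : DQBData K D) (w : D ⊗[K] D →ₗ[K] K) : DQBData K D :=
  let X₂ := E.tensor E.toCoalgData
  let X₃ := X₂.tensor E.toCoalgData
  { toCoalgData := E.toCoalgData
    mul := X₂.convConj w E.mul
    one := E.one
    reassoc :=
      X₃.convL (funcTensor E.counit w ∘ₗ (TensorProduct.assoc K D D D).toLinearMap)
        (X₃.convL (w ∘ₗ E.mul.lTensor D ∘ₗ (TensorProduct.assoc K D D D).toLinearMap)
          (X₃.convL E.reassoc
            (X₃.convL (X₂.convInv w ∘ₗ E.mul.rTensor D)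
              (funcTensor (X₂.convInv w) E.counit)))) }

end DualQuasiBialgebras

section HopfAlgebra

variable (K H : Type*) [Field K] [Ring H] [HopfAlgebra K H]

/-- `h ↦ (x ↦ h₁ x S(h₂))`. -/
def adLeft : H →ₗ[K] Module.End K H :=
  LinearMap.mul' K (Module.End K H) ∘ₗ
    TensorProduct.map (LinearMap.mul K H) ((LinearMap.mul K H).flip ∘ₗ HopfAlgebra.antipode K) ∘ₗ
    Coalgebra.comul

/-- `h ↦ (x ↦ S(h₁) x h₂)`. -/
def adRight : H →ₗ[K] Module.End K H :=
  LinearMap.mul' K (Module.End K H) ∘ₗ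
    TensorProduct.map (LinearMap.mul K H ∘ₗ HopfAlgebra.antipode K) (LinearMap.mul K H).flip ∘ₗ
    Coalgebra.comul

variable {K H}

/-- `lam` is an ad-invariant integral: a left and right integral in `H*` with `lam 1 = 1` that is
linear for the left and right adjoint actions. -/
structure IsAdInvariantIntegral (lam : H →ₗ[K] K) : Prop where
  /-- `h₁ λ(h₂) = λ(h) 1` -/
  left_integral : ∀ h : H,
    TensorProduct.rid K H (lam.lTensor H (Coalgebra.comul (R := K) h)) = lam h • (1 : H)
  /-- `λ(h₁) h₂ = λ(h) 1` -/
  right_integral : ∀ h : H,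
    TensorProduct.lid K H (lam.rTensor H (Coalgebra.comul (R := K) h)) = lam h • (1 : H)
  map_one : lam 1 = 1
  ad_left : ∀ h x : H, lam (adLeft K H h x) = Coalgebra.counit (R := K) h * lam x
  ad_right : ∀ h x : H, lam (adRight K H h x) = Coalgebra.counit (R := K) h * lam x

variable (K H) in
/-- The coalgebra underlying `H`. -/
def hopfCoalg : CoalgData K H where
  comul := Coalgebra.comul
  counit := Coalgebra.counit

end HopfAlgebra

section YetterDrinfeld

/-- The data of an `H`-action (through an algebra map, so the module axioms hold) and of a map
`V → H ⊗ V`. -/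
structure YDData (K H V : Type*) [Field K] [Ring H] [HopfAlgebra K H]
    [AddCommGroup V] [Module K V] where
  act : H →ₐ[K] Module.End K V
  coact : V →ₗ[K] H ⊗[K] V

/-- The data of a coalgebra in left-left Yetter-Drinfeld modules (no axioms). -/
structure YDCoalgData (K H V : Type*) [Field K] [Ring H] [HopfAlgebra K H]
    [AddCommGroup V] [Module K V] extends YDData K H V, CoalgData K V

variable {K H V W : Type*} [Field K] [Ring H] [HopfAlgebra K H]
  [AddCommGroup V] [Module K V] [AddCommGroup W] [Module K W]

/-- The action as a linear map `H ⊗ V → V`. -/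
def YDData.actT (X : YDData K H V) : H ⊗[K] V →ₗ[K] V :=
  TensorProduct.lift X.act.toLinearMap

/-- `h ↦ (g ⊗ v ↦ h₁ g S(h₃) ⊗ h₂ v)`: the convolution product of the left multiplication, the
action on `V` and the right multiplication by the antipode, as maps `H → End(H ⊗ V)`. -/
def YDData.ydAct (X : YDData K H V) : H →ₗ[K] Module.End K (H ⊗[K] V) :=
  LinearMap.mul' K (Module.End K (H ⊗[K] V)) ∘ₗ
    TensorProduct.map (LinearMap.rTensorHom V ∘ₗ LinearMap.mul K H)
      (LinearMap.mul' K (Module.End K (H ⊗[K] V)) ∘ₗ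
        TensorProduct.map (LinearMap.lTensorHom H ∘ₗ X.act.toLinearMap)
          (LinearMap.rTensorHom V ∘ₗ (LinearMap.mul K H).flip ∘ₗ HopfAlgebra.antipode K) ∘ₗ
        Coalgebra.comul) ∘ₗ
    Coalgebra.comul

/-- The axioms of a left-left Yetter-Drinfeld module. -/
structure YDData.IsYDModule (X : YDData K H V) : Prop where
  coact_coassoc : (TensorProduct.assoc K H H V).toLinearMap ∘ₗ
      (Coalgebra.comul (R := K) (A := H)).rTensor V ∘ₗ X.coact = X.coact.lTensor H ∘ₗ X.coact
  coact_counit : (TensorProduct.lid K V).toLinearMap ∘ₗ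
      (Coalgebra.counit (R := K) (A := H)).rTensor V ∘ₗ X.coact = LinearMap.id
  /-- `ρ(h v) = h₁ v₋₁ S(h₃) ⊗ h₂ v₀` -/
  coact_act : ∀ (h : H) (v : V), X.coact (X.act h v) = X.ydAct h (X.coact v)

/-- `f` is `H`-linear. -/
def IsHLinear (X : YDData K H V) (Y : YDData K H W) (f : V →ₗ[K] W) : Prop :=
  ∀ (h : H) (v : V), f (X.act h v) = Y.act h (f v)

/-- `f` is `H`-linear and `H`-colinear, i.e. a morphism of Yetter-Drinfeld modules. -/
structure IsYDHom (X : YDData K H V) (Y : YDData K H W) (f : V →ₗ[K] W) : Prop where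
  linear : IsHLinear X Y f
  colinear : Y.coact ∘ₗ f = f.lTensor H ∘ₗ X.coact

/-- The tensor product of Yetter-Drinfeld modules: `h(v ⊗ w) = h₁ v ⊗ h₂ w` and
`ρ(v ⊗ w) = v₋₁ w₋₁ ⊗ (v₀ ⊗ w₀)`. -/
def YDData.tensor (X : YDData K H V) (Y : YDData K H W) : YDData K H (V ⊗[K] W) where
  act := (Module.endTensorEndAlgHom (R := K) (S := K) (A := K) (M := V) (N := W)).comp
    ((Algebra.TensorProduct.map X.act Y.act).comp (Bialgebra.comulAlgHom K H))
  coact := (LinearMap.mul' K H).rTensor (V ⊗[K] W) ∘ₗ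
    (TensorProduct.tensorTensorTensorComm K H V H W).toLinearMap ∘ₗ
    TensorProduct.map X.coact Y.coact

/-- For a map `ρ : V → H ⊗ V` and a map `μ : H ⊗ W → W`, the map `V ⊗ W → W ⊗ V`,
`v ⊗ w ↦ v₋₁ w ⊗ v₀`. -/
def crossing (ρ : V →ₗ[K] H ⊗[K] V) (μ : H ⊗[K] W →ₗ[K] W) : V ⊗[K] W →ₗ[K] W ⊗[K] V :=
  μ.rTensor V ∘ₗ (TensorProduct.assoc K H W V).symm.toLinearMap ∘ₗ
    (TensorProduct.comm K V W).toLinearMap.lTensor H ∘ₗ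
    (TensorProduct.assoc K H V W).toLinearMap ∘ₗ ρ.rTensor W

/-- The coalgebra on `V ⊗ W` for a left `H`-comodule coalgebra `V` and a left `H`-module
coalgebra `W`: `Δ(v ⊗ w) = v⁽¹⁾ ⊗ (v⁽²⁾)₋₁ w⁽¹⁾ ⊗ (v⁽²⁾)₀ ⊗ w⁽²⁾`. -/
def CoalgData.cross (X : CoalgData K V) (ρ : V →ₗ[K] H ⊗[K] V) (Y : CoalgData K W)
    (μ : H ⊗[K] W →ₗ[K] W) : CoalgData K (V ⊗[K] W) where
  comul := (TensorProduct.assoc K V W (V ⊗[K] W)).symm.toLinearMap ∘ₗ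
    ((TensorProduct.assoc K W V W).toLinearMap ∘ₗ (crossing ρ μ).rTensor W ∘ₗ
      (TensorProduct.assoc K V W W).symm.toLinearMap).lTensor V ∘ₗ
    (TensorProduct.assoc K V V (W ⊗[K] W)).toLinearMap ∘ₗ
    TensorProduct.map X.comul Y.comul
  counit := funcTensor X.counit Y.counit

/-- The tensor product of coalgebras in Yetter-Drinfeld modules (built with the braiding). -/
def YDCoalgData.tensor (X : YDCoalgData K H V) (Y : YDCoalgData K H W) :
    YDCoalgData K H (V ⊗[K] W) where
  toYDData := X.toYDData.tensor Y.toYDData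
  toCoalgData := X.toCoalgData.cross X.coact Y.toCoalgData Y.actT

variable (K H) in
/-- The unit object `K`, with `h k = ε(h) k`, `ρ(k) = 1 ⊗ k` and its coalgebra structure. -/
def YDCoalgData.unitObject : YDCoalgData K H K where
  act := (Algebra.ofId K (Module.End K K)).comp (Bialgebra.counitAlgHom K H)
  coact := TensorProduct.mk K H K 1
  comul := TensorProduct.mk K K K 1
  counit := LinearMap.id

/-- A coalgebra in left-left Yetter-Drinfeld modules. -/
structure YDCoalgData.IsYDCoalgebra (X : YDCoalgData K H V) : Prop where
  isYDModule : X.IsYDModule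
  isCoalgebra : X.IsCoalgebra
  comul_hom : IsYDHom X.toYDData (X.tensor X).toYDData X.comul
  counit_hom : IsYDHom X.toYDData (unitObject K H).toYDData X.counit

/-- The data of a coalgebra in Yetter-Drinfeld modules with a multiplication and a unit element
(no axioms). -/
structure YDMulCoalgData (K H V : Type*) [Field K] [Ring H] [HopfAlgebra K H]
    [AddCommGroup V] [Module K V] extends YDCoalgData K H V where
  mul : V ⊗[K] V →ₗ[K] V
  one : V

/-- The unit map `K → V`. -/
def YDMulCoalgData.unitMap (X : YDMulCoalgData K H V) : K →ₗ[K] V :=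
  LinearMap.toSpanSingleton K V X.one

/-- The coalgebra in Yetter-Drinfeld modules on `V ⊗ V`. -/
abbrev YDMulCoalgData.sq (X : YDMulCoalgData K H V) : YDCoalgData K H (V ⊗[K] V) :=
  X.toYDCoalgData.tensor X.toYDCoalgData

/-- The coalgebra in Yetter-Drinfeld modules on `V ⊗ V ⊗ V`. -/
abbrev YDMulCoalgData.cube (X : YDMulCoalgData K H V) : YDCoalgData K H (V ⊗[K] V ⊗[K] V) :=
  X.sq.tensor X.toYDCoalgData

/-- A pre-bialgebra in Yetter-Drinfeld modules: the multiplication is an `H`-linear coalgebra map,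
but neither associativity nor `H`-colinearity is required. -/
structure YDMulCoalgData.IsPreBialgebra (X : YDMulCoalgData K H V) : Prop where
  isYDCoalgebra : X.IsYDCoalgebra
  unit_hom : IsYDHom (YDCoalgData.unitObject K H).toYDData X.toYDData X.unitMap
  unit_coalgHom : IsCoalgHom (YDCoalgData.unitObject K H).toCoalgData X.toCoalgData X.unitMap
  mul_linear : IsHLinear X.sq.toYDData X.toYDData X.mul
  mul_coalgHom : IsCoalgHom X.sq.toCoalgData X.toCoalgData X.mul
  one_mul : ∀ x, X.mul (X.one ⊗ₜ x) = x
  mul_one : ∀ x, X.mul (x ⊗ₜ X.one) = x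

/-- The coradical is `K 1`. -/
def YDMulCoalgData.IsConnected (X : YDMulCoalgData K H V) : Prop :=
  X.coradical = Submodule.span K {X.one}

/-- `(m ⊗ ξ) Δ_{V ⊗ V} : V ⊗ V → V ⊗ H`. -/
def YDMulCoalgData.mulCocycle (X : YDMulCoalgData K H V) (ξ : V ⊗[K] V →ₗ[K] H) :
    V ⊗[K] V →ₗ[K] V ⊗[K] H :=
  TensorProduct.map X.mul ξ ∘ₗ X.sq.comul

/-- `ξ : V ⊗ V → H` is a cocycle for the pre-bialgebra `V`. In `mul_coact` and `cocycle`, the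
crossing `V ⊗ H → H ⊗ V` is `r ⊗ h ↦ r₋₁ h ⊗ r₀` and the crossing `H ⊗ V → V ⊗ H` is
`h ⊗ r ↦ h₁ r ⊗ h₂`. -/
structure YDMulCoalgData.IsCocycle (X : YDMulCoalgData K H V) (ξ : V ⊗[K] V →ₗ[K] H) : Prop where
  /-- `ξ` is `H`-linear for the left adjoint action on `H` -/
  linear : ∀ (h : H) (z : V ⊗[K] V), ξ (X.sq.act h z) = adLeft K H h (ξ z)
  /-- `Δ_H ξ = (m_H ⊗ ξ)(ξ ⊗ ρ)Δ` -/
  comul : Coalgebra.comul ∘ₗ ξ =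
    TensorProduct.map (LinearMap.mul' K H) ξ ∘ₗ
      (TensorProduct.assoc K H H (V ⊗[K] V)).symm.toLinearMap ∘ₗ
      TensorProduct.map ξ X.sq.coact ∘ₗ X.sq.comul
  counit : Coalgebra.counit ∘ₗ ξ = X.sq.counit
  /-- `c_{V,H}(m ⊗ ξ)Δ = (m_H ⊗ m)(ξ ⊗ ρ)Δ` -/
  mul_coact : crossing X.coact (LinearMap.mul' K H) ∘ₗ X.mulCocycle ξ =
    TensorProduct.map (LinearMap.mul' K H) X.mul ∘ₗ
      (TensorProduct.assoc K H H (V ⊗[K] V)).symm.toLinearMap ∘ₗ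
      TensorProduct.map ξ X.sq.coact ∘ₗ X.sq.comul
  /-- `m(V ⊗ m) = m(m ⊗ V)Φ(ξ)`, with `Φ(ξ)(z ⊗ t) = z⁽¹⁾ ⊗ ξ(z⁽²⁾) t` -/
  mul_assoc : X.mul ∘ₗ X.mul.lTensor V ∘ₗ (TensorProduct.assoc K V V V).toLinearMap =
    X.mul ∘ₗ X.mul.rTensor V ∘ₗ
      (X.actT.lTensor (V ⊗[K] V) ∘ₗ (TensorProduct.assoc K (V ⊗[K] V) H V).toLinearMap ∘ₗ
        (ξ.lTensor (V ⊗[K] V) ∘ₗ X.sq.comul).rTensor V)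
  /-- `m_H(ξ ⊗ H)[V ⊗ (m ⊗ ξ)Δ] = m_H(ξ ⊗ H)(V ⊗ c_{H,V})[(m ⊗ ξ)Δ ⊗ V]` -/
  cocycle : LinearMap.mul' K H ∘ₗ ξ.rTensor H ∘ₗ
      (TensorProduct.assoc K V V H).symm.toLinearMap ∘ₗ (X.mulCocycle ξ).lTensor V ∘ₗ
      (TensorProduct.assoc K V V V).toLinearMap =
    LinearMap.mul' K H ∘ₗ ξ.rTensor H ∘ₗ
      (TensorProduct.assoc K V V H).symm.toLinearMap ∘ₗ
      (crossing Coalgebra.comul X.actT).lTensor V ∘ₗ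
      (TensorProduct.assoc K V H V).toLinearMap ∘ₗ (X.mulCocycle ξ).rTensor V
  unital_left : ∀ x, ξ (X.one ⊗ₜ x) = X.counit x • (1 : H)
  unital_right : ∀ x, ξ (x ⊗ₜ X.one) = X.counit x • (1 : H)

/-- The data of a dual quasi-bialgebra in Yetter-Drinfeld modules (no axioms). -/
structure YDDQBData (K H V : Type*) [Field K] [Ring H] [HopfAlgebra K H]
    [AddCommGroup V] [Module K V] extends YDMulCoalgData K H V where
  reassoc : V ⊗[K] V ⊗[K] V →ₗ[K] K

/-- A dual quasi-bialgebra in the braided monoidal category of Yetter-Drinfeld modules. -/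
structure YDDQBData.IsDualQuasiBialgebra (Q : YDDQBData K H V) : Prop where
  isYDCoalgebra : Q.IsYDCoalgebra
  unit_hom : IsYDHom (YDCoalgData.unitObject K H).toYDData Q.toYDData Q.unitMap
  unit_coalgHom : IsCoalgHom (YDCoalgData.unitObject K H).toCoalgData Q.toCoalgData Q.unitMap
  mul_hom : IsYDHom Q.sq.toYDData Q.toYDData Q.mul
  mul_coalgHom : IsCoalgHom Q.sq.toCoalgData Q.toCoalgData Q.mul
  reassoc_hom : IsYDHom Q.cube.toYDData (YDCoalgData.unitObject K H).toYDData Q.reassoc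
  laws : ReassocLaws Q.counit Q.cube.toCoalgData (Q.cube.tensor Q.toYDCoalgData).toCoalgData
    Q.mul Q.one Q.reassoc

end YetterDrinfeld

section Bosonization

variable {K H V Y : Type*} [Field K] [Ring H] [HopfAlgebra K H]
  [AddCommGroup V] [Module K V] [AddCommGroup Y] [Module K Y]

/-- For `μ : H ⊗ (V ⊗ H) → V ⊗ H`, the map
`(y ⊗ h) ⊗ (s ⊗ l) ↦ y ⊗ μ(h ⊗ (s ⊗ l))`, read in `(Y ⊗ V) ⊗ H`. -/
def slide (μ : H ⊗[K] (V ⊗[K] H) →ₗ[K] V ⊗[K] H) :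
    (Y ⊗[K] H) ⊗[K] (V ⊗[K] H) →ₗ[K] (Y ⊗[K] V) ⊗[K] H :=
  (TensorProduct.assoc K Y V H).symm.toLinearMap ∘ₗ μ.lTensor Y ∘ₗ
    (TensorProduct.assoc K Y H (V ⊗[K] H)).toLinearMap

/-- `h ⊗ (s ⊗ l) ↦ h s ⊗ l`. -/
def YDData.actFirst (X : YDData K H V) : H ⊗[K] (V ⊗[K] H) →ₗ[K] V ⊗[K] H :=
  X.actT.rTensor H ∘ₗ (TensorProduct.assoc K H V H).symm.toLinearMap

/-- `h ⊗ (s ⊗ l) ↦ h₁ s ⊗ h₂ l`. -/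
def YDData.actDiag (X : YDData K H V) : H ⊗[K] (V ⊗[K] H) →ₗ[K] V ⊗[K] H :=
  TensorProduct.map X.actT (LinearMap.mul' K H) ∘ₗ
    (TensorProduct.tensorTensorTensorComm K H H V H).toLinearMap ∘ₗ
    (Coalgebra.comul (R := K) (A := H)).rTensor (V ⊗[K] H)

/-- `℧²(v)(r#h ⊗ s#l) = v(r ⊗ h s) ε(l)`. -/
def YDData.mho₂ (X : YDData K H V) (v : V ⊗[K] V →ₗ[K] K) :
    (V ⊗[K] H) ⊗[K] (V ⊗[K] H) →ₗ[K] K :=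
  funcTensor v Coalgebra.counit ∘ₗ slide X.actFirst

/-- `℧³(α)(r#h ⊗ s#l ⊗ t#k) = α(r ⊗ h₁ s ⊗ h₂ l t) ε(k)`. -/
def YDData.mho₃ (X : YDData K H V) (α : V ⊗[K] V ⊗[K] V →ₗ[K] K) :
    (V ⊗[K] H) ⊗[K] (V ⊗[K] H) ⊗[K] (V ⊗[K] H) →ₗ[K] K :=
  funcTensor α Coalgebra.counit ∘ₗ slide X.actFirst ∘ₗ (slide X.actDiag).rTensor (V ⊗[K] H)

/-- `Ω³(γ)(r ⊗ s ⊗ t) = γ(r#1 ⊗ s#1 ⊗ t#1)`. -/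
def omega₃ (γ : (V ⊗[K] H) ⊗[K] (V ⊗[K] H) ⊗[K] (V ⊗[K] H) →ₗ[K] K) :
    V ⊗[K] V ⊗[K] V →ₗ[K] K :=
  let i : V →ₗ[K] V ⊗[K] H := (TensorProduct.mk K V H).flip 1
  γ ∘ₗ TensorProduct.map (TensorProduct.map i i) i

/-- The smash coproduct coalgebra on `V ⊗ H`:
`Δ(r#h) = r⁽¹⁾#(r⁽²⁾)₋₁h₁ ⊗ (r⁽²⁾)₀#h₂`, `ε(r#h) = ε(r)ε(h)`. -/
def YDCoalgData.smashCoproduct (X : YDCoalgData K H V) : CoalgData K (V ⊗[K] H) :=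
  X.toCoalgData.cross X.coact (hopfCoalg K H) (LinearMap.mul' K H)

/-- `V #_ξ H`: the smash coproduct with unit `1#1` and multiplication
`(r#h)(s#l) = m(z⁽¹⁾)#ξ(z⁽²⁾) h₂ l` where `z = r ⊗ h₁ s`. -/
def YDMulCoalgData.smash (X : YDMulCoalgData K H V) (ξ : V ⊗[K] V →ₗ[K] H) :
    MulCoalgData K (V ⊗[K] H) where
  toCoalgData := X.smashCoproduct
  mul := (LinearMap.mul' K H).lTensor V ∘ₗ (TensorProduct.assoc K V H H).toLinearMap ∘ₗ
    (X.mulCocycle ξ).rTensor H ∘ₗ slide X.actDiag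
  one := X.one ⊗ₜ 1

/-- The bosonization `Q # H`: the smash coproduct with unit `1#1`, multiplication
`(r#h)(s#l) = m(r ⊗ h₁ s)#h₂ l` and reassociator `℧³(α)`. -/
def YDDQBData.bosonization (Q : YDDQBData K H V) : DQBData K (V ⊗[K] H) where
  toCoalgData := Q.smashCoproduct
  mul := Q.mul.rTensor H ∘ₗ slide Q.actDiag
  one := Q.one ⊗ₜ 1
  reassoc := Q.mho₃ Q.reassoc

/-- `∂²_R = Ω³ ∘ ∂²_A ∘ ℧²` where `A = R #_ξ H`. -/
def YDMulCoalgData.coboundary₂ (X : YDMulCoalgData K H V) (ξ : V ⊗[K] V →ₗ[K] H)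
    (w : V ⊗[K] V →ₗ[K] K) : V ⊗[K] V ⊗[K] V →ₗ[K] K :=
  omega₃ ((X.smash ξ).coboundary₂ (X.mho₂ w))

/-- `G(ξ) = (λ ξ)⁻¹`, the inverse in the convolution algebra of the braided coalgebra `V ⊗ V`. -/
def YDMulCoalgData.gaugeOf (X : YDMulCoalgData K H V) (lam : H →ₗ[K] K)
    (ξ : V ⊗[K] V →ₗ[K] H) : V ⊗[K] V →ₗ[K] K :=
  X.sq.convInv (lam ∘ₗ ξ)

/-- `R^w = (R, w * m * w⁻¹, u, Δ, ε, ∂²_R(w))`. -/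
def YDMulCoalgData.twist (X : YDMulCoalgData K H V) (ξ : V ⊗[K] V →ₗ[K] H)
    (w : V ⊗[K] V →ₗ[K] K) : YDDQBData K H V where
  toYDCoalgData := X.toYDCoalgData
  mul := X.sq.convConj w X.mul
  one := X.one
  reassoc := X.coboundary₂ ξ w

end Bosonization

end

/-! Why the theorem holds. Everything passes between `R` and `A` along coalgebra maps. The map
`slide`, `(y#h) ⊗ (s#l) ↦ (y ⊗ h₁s)#h₂l`, is a surjective coalgebra map from the ordinary tensor
product of two smash coproducts onto the smash coproduct of the braided tensor product
(`slide_diagAct_isCoalgHom`). Iterating it and then applying `r#h ↦ ε(h)r` gives surjective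
coalgebra maps `slideFst`, `slideFst₃`, `slideFst₄` from the tensor powers of `A` onto the braided
tensor powers of `R`. Both `℧²` and `℧³` are pullbacks along these maps. Hence they respect
convolution, and identities over `R` may be checked after pullback to `A`.

The product of `A` is a coalgebra map, and a coalgebra map into a smash coproduct is determined by
its components in `R` and `H` (`smash_hom_ext`). Associativity therefore splits into the two cocycle
axioms that relate `m` and `ξ` (`smash_isBialgebra`).

The functional `λξ` is invertible because `R` is connected. Translation of `R ⊗ R` by `ε - λξ`
lowers a filtration that starts at zero and exhausts the first tensor factor, so it is locally
nilpotent (`exists_mem_hitFilt`, `sq_isConvInvertible`).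

For any bialgebra and any gauge transformation, the twist is a dual quasi-bialgebra. After pullback
to a common tensor power, each law becomes a cancellation among units of a convolution monoid
(`twist_quasi_assoc`, `pullCob_pentagon`).

The integral property, combined with the formula for `Δξ`, gives `ξ(z⁽¹⁾) z⁽²⁾₋₁ λξ(z⁽²⁾₀) = λξ(z)
1` (`sw_integral`). So convolving the product of `A` with `λξ` on the right removes the cocycle, and
the twisted product is `(m^v ⊗ H) ∘ slide` (`mulTwist_eq`). Ad-invariance makes `λξ`, and hence `v`,
invariant under `H`. The four factors of the coboundary then come from `R ⊗ R ⊗ R`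
(`smash_coboundary₂`). These two facts give `A^{v_A} = R^v # H`.

Finally the laws of `R^v` descend from those of `A^{v_A}`. Colinearity, which `m` itself need not
have, descends too: that of `m^v` from the twisted product being a coalgebra map, that of the
reassociator from the counit applied to quasi-associativity. -/

noncomputable section

set_option linter.unusedSectionVars false
set_option linter.unusedSimpArgs false

/-! ### Sweedler calculus for elements of tensor products. -/

section Sweedler

variable {K : Type*} [Field K]
variable {V W M N U Z : Type*} [AddCommMonoid V] [Module K V] [AddCommMonoid W] [Module K W]
  [AddCommMonoid M] [Module K M] [AddCommMonoid N] [Module K N] [AddCommMonoid U] [Module K U]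
  [AddCommMonoid Z] [Module K Z]

/-- Linearity of an unbundled function, set up for `fun_prop`. -/
@[fun_prop]
structure Lin (K : Type*) [Field K] {V W : Type*} [AddCommMonoid V] [Module K V]
    [AddCommMonoid W] [Module K W] (f : V → W) : Prop where
  add : ∀ x y, f (x + y) = f x + f y
  smul : ∀ (c : K) x, f (c • x) = c • f x

/-- A chosen finite family of pure tensors with sum `t`. -/
def tensorRep (t : V ⊗[K] W) : Finset (V × W) := (TensorProduct.exists_finset t).choose

theorem tensorRep_sum (t : V ⊗[K] W) : t = ∑ p ∈ tensorRep t, p.1 ⊗ₜ[K] p.2 :=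
  (TensorProduct.exists_finset t).choose_spec

/-- Sweedler sums: `sw t F = ∑ F a b` where `t = ∑ a ⊗ b`. -/
def sw (t : V ⊗[K] W) (F : V → W → M) : M := ∑ p ∈ tensorRep t, F p.1 p.2

/-- For a bilinear summand the sum does not depend on the representative chosen in `tensorRep`.
Every rule below that changes the tensor `t` rests on this, which is why such rules carry `Lin` side
conditions. -/
theorem sw_eq_lift (B : V →ₗ[K] W →ₗ[K] M) (t : V ⊗[K] W) :
    sw t (fun a b => B a b) = TensorProduct.lift B t := by
  conv_rhs => rw [tensorRep_sum t]
  simp [sw]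

theorem exists_bilin {F : V → W → M} (h₁ : ∀ b, Lin K (fun a => F a b))
    (h₂ : ∀ a, Lin K (fun b => F a b)) : ∃ B : V →ₗ[K] W →ₗ[K] M, F = fun a b => B a b :=
  ⟨LinearMap.mk₂ K F (fun a a' b => (h₁ b).add a a') (fun c a b => (h₁ b).smul c a)
    (fun a b b' => (h₂ a).add b b') (fun c a b => (h₂ a).smul c b), rfl⟩

theorem sw_tmul {F : V → W → M} (h₁ : ∀ b, Lin K (fun a => F a b))
    (h₂ : ∀ a, Lin K (fun b => F a b)) (a : V) (b : W) : sw (a ⊗ₜ[K] b) F = F a b := by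
  obtain ⟨B, rfl⟩ := exists_bilin h₁ h₂
  rw [sw_eq_lift]; simp

theorem sw_add {F : V → W → M} (h₁ : ∀ b, Lin K (fun a => F a b))
    (h₂ : ∀ a, Lin K (fun b => F a b)) (t t' : V ⊗[K] W) : sw (t + t') F = sw t F + sw t' F := by
  obtain ⟨B, rfl⟩ := exists_bilin h₁ h₂
  simp [sw_eq_lift]

theorem sw_zero {F : V → W → M} (h₁ : ∀ b, Lin K (fun a => F a b))
    (h₂ : ∀ a, Lin K (fun b => F a b)) : sw (0 : V ⊗[K] W) F = 0 := by
  obtain ⟨B, rfl⟩ := exists_bilin h₁ h₂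
  simp [sw_eq_lift]

theorem sw_fun_zero (t : V ⊗[K] W) : sw t (fun _ _ => (0 : M)) = 0 := by simp [sw]

theorem sw_fun_add (t : V ⊗[K] W) (F G : V → W → M) :
    sw t (fun a b => F a b + G a b) = sw t F + sw t G := by simp [sw, Finset.sum_add_distrib]

theorem sw_smul {F : V → W → M} (h₁ : ∀ b, Lin K (fun a => F a b))
    (h₂ : ∀ a, Lin K (fun b => F a b)) (c : K) (t : V ⊗[K] W) : sw (c • t) F = c • sw t F := by
  obtain ⟨B, rfl⟩ := exists_bilin h₁ h₂
  simp [sw_eq_lift]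

theorem sw_sw {F : V → W → M} {G : U → Z → V ⊗[K] W} (h₁ : ∀ b, Lin K (fun a => F a b))
    (h₂ : ∀ a, Lin K (fun b => F a b)) (t : U ⊗[K] Z) :
    sw (sw t G) F = sw t (fun a b => sw (G a b) F) := by
  obtain ⟨B, rfl⟩ := exists_bilin h₁ h₂
  simp only [sw_eq_lift]
  simp [sw]

/-- Exchanging finite sums needs no linearity. Instances with prescribed tensors serve as rewrite
rules that bring nested Sweedler sums into a fixed order. -/
theorem sw_comm (t : V ⊗[K] W) (t' : U ⊗[K] Z) (F : V → W → U → Z → M) :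
    sw t (fun a b => sw t' (fun c d => F a b c d)) =
      sw t' (fun c d => sw t (fun a b => F a b c d)) :=
  Finset.sum_comm

theorem map_sw (φ : M →ₗ[K] N) (t : V ⊗[K] W) (F : V → W → M) :
    φ (sw t F) = sw t (fun a b => φ (F a b)) := by simp [sw]

theorem algHom_sw_apply {H : Type*} [Semiring H] [Algebra K H] (φ : H →ₐ[K] Module.End K N)
    (t : V ⊗[K] W) (F : V → W → H) (y : N) :
    φ (sw t F) y = sw t (fun a b => φ (F a b) y) := by simp [sw]

theorem sw_tmul_right (t : V ⊗[K] W) (F : V → W → M) (y : N) :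
    (sw t F) ⊗ₜ[K] y = sw t (fun a b => F a b ⊗ₜ[K] y) := by simp [sw, TensorProduct.sum_tmul]

theorem tmul_sw (t : V ⊗[K] W) (F : V → W → M) (y : N) :
    y ⊗ₜ[K] (sw t F) = sw t (fun a b => y ⊗ₜ[K] F a b) := by simp [sw, TensorProduct.tmul_sum]

theorem sw_mul {A : Type*} [Semiring A] [Algebra K A] (t : V ⊗[K] W) (F : V → W → A) (y : A) :
    (sw t F) * y = sw t (fun a b => F a b * y) := by simp [sw, Finset.sum_mul]

theorem mul_sw {A : Type*} [Semiring A] [Algebra K A] (t : V ⊗[K] W) (F : V → W → A) (y : A) :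
    y * (sw t F) = sw t (fun a b => y * F a b) := by simp [sw, Finset.mul_sum]

theorem smul_sw (c : K) (t : V ⊗[K] W) (F : V → W → M) :
    c • (sw t F) = sw t (fun a b => c • F a b) := by simp [sw, Finset.smul_sum]

theorem sw_smul_right (t : V ⊗[K] W) (F : V → W → K) (y : M) :
    (sw t F) • y = sw t (fun a b => F a b • y) := by simp [sw, Finset.sum_smul]

theorem sw_congr {t : V ⊗[K] W} {F G : V → W → M} (h : ∀ a b, F a b = G a b) : sw t F = sw t G := by
  congr; ext; exact h _ _

theorem sw_self (t : V ⊗[K] W) : sw t (fun a b => a ⊗ₜ[K] b) = t := (tensorRep_sum t).symm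

/-! Linear functions. -/

@[fun_prop] theorem Lin.id : Lin K (fun x : V => x) := ⟨fun _ _ => rfl, fun _ _ => rfl⟩

@[fun_prop] theorem Lin.comp {f : W → M} {g : V → W} (hf : Lin K f) (hg : Lin K g) :
    Lin K (fun x => f (g x)) :=
  ⟨fun x y => by rw [hg.add, hf.add], fun c x => by rw [hg.smul, hf.smul]⟩

@[fun_prop] theorem Lin.linearMap (φ : W →ₗ[K] M) {f : V → W} (hf : Lin K f) :
    Lin K (fun x => φ (f x)) :=
  ⟨fun x y => by rw [hf.add, map_add], fun c x => by rw [hf.smul, map_smul]⟩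

@[fun_prop] theorem Lin.linearEquiv (φ : W ≃ₗ[K] M) {f : V → W} (hf : Lin K f) :
    Lin K (fun x => φ (f x)) :=
  ⟨fun x y => by rw [hf.add, map_add], fun c x => by rw [hf.smul, map_smul]⟩

@[fun_prop] theorem Lin.linearMap_apply {φ : V → W →ₗ[K] M} (hφ : Lin K φ) (y : W) :
    Lin K (fun x => φ x y) :=
  ⟨fun x x' => by rw [hφ.add]; rfl, fun c x => by rw [hφ.smul]; rfl⟩

@[fun_prop] theorem Lin.algHom {A B : Type*} [Semiring A] [Algebra K A] [Semiring B] [Algebra K B]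
    (φ : A →ₐ[K] B) {f : V → A} (hf : Lin K f) :
    Lin K (fun x => φ (f x)) :=
  ⟨fun x y => by rw [hf.add, map_add], fun c x => by rw [hf.smul, map_smul]⟩

@[fun_prop] theorem Lin.tmul_right {f : V → W} (hf : Lin K f) (y : M) :
    Lin K (fun x => f x ⊗ₜ[K] y) :=
  ⟨fun x x' => by rw [hf.add, TensorProduct.add_tmul],
    fun c x => by rw [hf.smul, TensorProduct.smul_tmul']⟩

@[fun_prop] theorem Lin.tmul_left {f : V → W} (hf : Lin K f) (y : M) :
    Lin K (fun x => y ⊗ₜ[K] f x) :=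
  ⟨fun x x' => by rw [hf.add, TensorProduct.tmul_add],
    fun c x => by rw [hf.smul, TensorProduct.tmul_smul]⟩

@[fun_prop] theorem Lin.mul_right {A : Type*} [Semiring A] [Algebra K A] {f : V → A}
    (hf : Lin K f) (y : A) : Lin K (fun x => f x * y) :=
  ⟨fun x x' => by rw [hf.add, add_mul], fun c x => by rw [hf.smul, smul_mul_assoc]⟩

@[fun_prop] theorem Lin.mul_left {A : Type*} [Semiring A] [Algebra K A] {f : V → A}
    (hf : Lin K f) (y : A) : Lin K (fun x => y * f x) :=
  ⟨fun x x' => by rw [hf.add, mul_add], fun c x => by rw [hf.smul, mul_smul_comm]⟩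

@[fun_prop] theorem Lin.smul_right {f : V → K} (hf : Lin K f) (y : M) : Lin K (fun x => f x • y) :=
  ⟨fun x x' => by rw [hf.add, add_smul], fun c x => by rw [hf.smul, smul_assoc]⟩

@[fun_prop] theorem Lin.smul_left {f : V → M} (hf : Lin K f) (c : K) : Lin K (fun x => c • f x) :=
  ⟨fun x x' => by rw [hf.add, smul_add], fun c' x => by rw [hf.smul, smul_comm]⟩

@[fun_prop] theorem Lin.sw_arg {f : V → U ⊗[K] Z} (hf : Lin K f) {F : U → Z → M}
    (h₁ : ∀ b, Lin K (fun a => F a b)) (h₂ : ∀ a, Lin K (fun b => F a b)) :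
    Lin K (fun x => sw (f x) F) :=
  ⟨fun x x' => by rw [hf.add, sw_add h₁ h₂], fun c x => by rw [hf.smul, sw_smul h₁ h₂]⟩

@[fun_prop] theorem Lin.sw_fun (t : U ⊗[K] Z) {F : V → U → Z → M}
    (h : ∀ a b, Lin K (fun x => F x a b)) : Lin K (fun x => sw t (F x)) :=
  ⟨fun x x' => by simp [sw, (h _ _).add, Finset.sum_add_distrib],
    fun c x => by simp [sw, (h _ _).smul, Finset.smul_sum]⟩

/-! Evaluation of the structural maps. -/

theorem map_eq_sw (f : V →ₗ[K] M) (g : W →ₗ[K] N) (t : V ⊗[K] W) :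
    TensorProduct.map f g t = sw t (fun a b => f a ⊗ₜ[K] g b) := by
  conv_lhs => rw [← sw_self t, map_sw]
  rfl

theorem rTensor_eq_sw (f : V →ₗ[K] M) (t : V ⊗[K] W) :
    f.rTensor W t = sw t (fun a b => f a ⊗ₜ[K] b) := map_eq_sw f LinearMap.id t

theorem lTensor_eq_sw (f : W →ₗ[K] M) (t : V ⊗[K] W) :
    f.lTensor V t = sw t (fun a b => a ⊗ₜ[K] f b) := map_eq_sw LinearMap.id f t

theorem comm_eq_sw (t : V ⊗[K] W) :
    TensorProduct.comm K V W t = sw t (fun a b => b ⊗ₜ[K] a) := by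
  conv_lhs => rw [← sw_self t, ← LinearEquiv.coe_coe, map_sw]
  rfl

theorem lid_eq_sw (t : K ⊗[K] W) : TensorProduct.lid K W t = sw t (fun a b => a • b) := by
  conv_lhs => rw [← sw_self t, ← LinearEquiv.coe_coe, map_sw]
  simp

theorem rid_eq_sw (t : W ⊗[K] K) : TensorProduct.rid K W t = sw t (fun a b => b • a) := by
  conv_lhs => rw [← sw_self t, ← LinearEquiv.coe_coe, map_sw]
  simp

theorem mul'_eq_sw {A : Type*} [Semiring A] [Algebra K A] (t : A ⊗[K] A) :
    LinearMap.mul' K A t = sw t (fun a b => a * b) := by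
  conv_lhs => rw [← sw_self t, map_sw]
  simp

theorem funcTensor_eq_sw {V W : Type*} [AddCommGroup V] [Module K V] [AddCommGroup W] [Module K W]
    (f : V →ₗ[K] K) (g : W →ₗ[K] K) (t : V ⊗[K] W) :
    funcTensor f g t = sw t (fun a b => f a • g b) := by
  conv_lhs => rw [← sw_self t, map_sw]
  rfl

theorem assoc_eq_sw (t : (V ⊗[K] W) ⊗[K] M) :
    TensorProduct.assoc K V W M t =
      sw t (fun x c => sw x (fun a b => a ⊗ₜ[K] (b ⊗ₜ[K] c))) := by
  conv_lhs => rw [← sw_self t, ← LinearEquiv.coe_coe, map_sw]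
  refine sw_congr fun x c => ?_
  conv_lhs => rw [← sw_self x, sw_tmul_right, map_sw]
  rfl

theorem assoc_symm_eq_sw (t : V ⊗[K] (W ⊗[K] M)) :
    (TensorProduct.assoc K V W M).symm t =
      sw t (fun a x => sw x (fun b c => (a ⊗ₜ[K] b) ⊗ₜ[K] c)) := by
  conv_lhs => rw [← sw_self t, ← LinearEquiv.coe_coe, map_sw]
  refine sw_congr fun a x => ?_
  conv_lhs => rw [← sw_self x, tmul_sw, map_sw]
  rfl

theorem tensorTensorTensorComm_eq_sw (t : (V ⊗[K] W) ⊗[K] (M ⊗[K] N)) :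
    TensorProduct.tensorTensorTensorComm K V W M N t =
      sw t (fun x y => sw x fun a b => sw y fun c d => (a ⊗ₜ[K] c) ⊗ₜ[K] (b ⊗ₜ[K] d)) := by
  conv_lhs => rw [← sw_self t, ← LinearEquiv.coe_coe, map_sw]
  refine sw_congr fun x y => ?_
  conv_lhs => rw [← sw_self x, sw_tmul_right, map_sw]
  refine sw_congr fun a b => ?_
  conv_lhs => rw [← sw_self y, tmul_sw, map_sw]
  rfl

end Sweedler

/-! ### Crossed coproducts of a comodule coalgebra and a module coalgebra. -/

section CrossedCoalgebras

variable {K : Type*} [Field K]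
variable {C D M V W H : Type*} [AddCommGroup C] [Module K C] [AddCommGroup D] [Module K D]
  [AddCommMonoid M] [Module K M] [AddCommGroup V] [Module K V] [AddCommGroup W] [Module K W]
  [Ring H] [HopfAlgebra K H]

namespace CoalgData.IsCoalgebra

variable {X : CoalgData K C}

theorem sw_coassoc (hX : X.IsCoalgebra) {F : C → C → C → M} (h₁ : ∀ b c, Lin K fun a => F a b c)
    (h₂ : ∀ a c, Lin K fun b => F a b c) (h₃ : ∀ a b, Lin K fun c => F a b c) (x : C) :
    sw (X.comul x) (fun a b => sw (X.comul a) fun c d => F c d b) =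
      sw (X.comul x) (fun a b => sw (X.comul b) fun c d => F a c d) := by
  have h := congrArg (fun t => sw t fun a s => sw s fun b c => F a b c)
    (LinearMap.congr_fun hX.coassoc x)
  simpa (disch := fun_prop) only [LinearMap.comp_apply, LinearEquiv.coe_coe, rTensor_eq_sw,
    lTensor_eq_sw, assoc_eq_sw, sw_sw, sw_tmul] using h

theorem sw_counit_left (hX : X.IsCoalgebra) {F : C → M} (hF : Lin K F) (x : C) :
    sw (X.comul x) (fun a b => X.counit a • F b) = F x := by
  have h := congrArg F (LinearMap.congr_fun hX.counit_left x)
  let φ : C →ₗ[K] M := ⟨⟨F, hF.add⟩, hF.smul⟩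
  change φ _ = φ _ at h
  change sw (X.comul x) (fun a b => X.counit a • φ b) = φ x
  simpa (disch := fun_prop) only [LinearMap.comp_apply, LinearEquiv.coe_coe, rTensor_eq_sw,
    lid_eq_sw, sw_sw, sw_tmul, map_sw, map_smul, LinearMap.id_apply] using h

theorem sw_counit_right (hX : X.IsCoalgebra) {F : C → M} (hF : Lin K F) (x : C) :
    sw (X.comul x) (fun a b => X.counit b • F a) = F x := by
  have h := congrArg F (LinearMap.congr_fun hX.counit_right x)
  let φ : C →ₗ[K] M := ⟨⟨F, hF.add⟩, hF.smul⟩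
  change φ _ = φ _ at h
  change sw (X.comul x) (fun a b => X.counit b • φ a) = φ x
  simpa (disch := fun_prop) only [LinearMap.comp_apply, LinearEquiv.coe_coe, lTensor_eq_sw,
    rid_eq_sw, sw_sw, sw_tmul, map_sw, map_smul, LinearMap.id_apply] using h

end CoalgData.IsCoalgebra

variable (K H) in
theorem hopfCoalg_isCoalgebra : (hopfCoalg K H).IsCoalgebra where
  coassoc := Coalgebra.coassoc
  counit_left := by
    ext h
    simp [hopfCoalg]
  counit_right := by
    ext h
    simp [hopfCoalg]

/-- `W` is a left `H`-module coalgebra with action `μ`. -/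
structure IsModuleCoalgebra (Y : CoalgData K W) (μ : H ⊗[K] W →ₗ[K] W) : Prop where
  isCoalgebra : Y.IsCoalgebra
  one_act : ∀ w, μ (1 ⊗ₜ w) = w
  mul_act : ∀ g h w, μ ((g * h) ⊗ₜ w) = μ (g ⊗ₜ μ (h ⊗ₜ w))
  comul_act : ∀ h w, Y.comul (μ (h ⊗ₜ w)) = sw (Coalgebra.comul (R := K) h) fun h₁ h₂ =>
    sw (Y.comul w) fun w₁ w₂ => μ (h₁ ⊗ₜ w₁) ⊗ₜ μ (h₂ ⊗ₜ w₂)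
  counit_act : ∀ h w, Y.counit (μ (h ⊗ₜ w)) = Coalgebra.counit (R := K) h • Y.counit w

/-- `V` is a left `H`-comodule coalgebra with coaction `ρ`. -/
structure IsComoduleCoalgebra (X : CoalgData K V) (ρ : V →ₗ[K] H ⊗[K] V) : Prop where
  isCoalgebra : X.IsCoalgebra
  coassoc : ∀ v, sw (ρ v) (fun h a => sw (Coalgebra.comul (R := K) h) fun h₁ h₂ => h₁ ⊗ₜ[K] (h₂ ⊗ₜ[K] a)) =
    sw (ρ v) (fun h a => sw (ρ a) fun g b => h ⊗ₜ[K] (g ⊗ₜ[K] b))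
  counit : ∀ v, sw (ρ v) (fun h a => Coalgebra.counit (R := K) h • a) = v
  comul_colinear : ∀ v, sw (ρ v) (fun h a => h ⊗ₜ[K] X.comul a) =
    sw (X.comul v) fun a b => sw (ρ a) fun g c => sw (ρ b) fun h d => (g * h) ⊗ₜ[K] (c ⊗ₜ[K] d)
  counit_colinear : ∀ v, sw (ρ v) (fun h a => X.counit a • h) = X.counit v • 1

namespace IsComoduleCoalgebra

variable {X : CoalgData K V} {ρ : V →ₗ[K] H ⊗[K] V}

theorem sw_coassoc (hX : IsComoduleCoalgebra X ρ) {F : H → H → V → M}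
    (h₁ : ∀ b c, Lin K fun a => F a b c)
    (h₂ : ∀ a c, Lin K fun b => F a b c) (h₃ : ∀ a b, Lin K fun c => F a b c) (v : V) :
    sw (ρ v) (fun h a => sw (ρ a) fun g b => F h g b) =
      sw (ρ v) (fun h a => sw (Coalgebra.comul (R := K) h) fun h₁ h₂ => F h₁ h₂ a) := by
  have h := congrArg (fun t => sw t fun a s => sw s fun b c => F a b c) (hX.coassoc v).symm
  simpa (disch := fun_prop) only [sw_sw, sw_tmul] using h

theorem sw_counit (hX : IsComoduleCoalgebra X ρ) {F : V → M} (hF : Lin K F) (v : V) :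
    sw (ρ v) (fun h a => Coalgebra.counit (R := K) h • F a) = F v := by
  have h := congrArg F (hX.counit v)
  let φ : V →ₗ[K] M := ⟨⟨F, hF.add⟩, hF.smul⟩
  change φ _ = φ _ at h
  simp only [map_sw, map_smul] at h
  exact h

theorem sw_comul (hX : IsComoduleCoalgebra X ρ) {F : H → V → V → M}
    (h₁ : ∀ b c, Lin K fun a => F a b c)
    (h₂ : ∀ a c, Lin K fun b => F a b c) (h₃ : ∀ a b, Lin K fun c => F a b c) (v : V) :
    sw (ρ v) (fun h a => sw (X.comul a) fun b c => F h b c) =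
      sw (X.comul v) fun a b => sw (ρ a) fun g c => sw (ρ b) fun h d => F (g * h) c d := by
  have h := congrArg (fun t => sw t fun a s => sw s fun b c => F a b c) (hX.comul_colinear v)
  simpa (disch := fun_prop) only [sw_sw, sw_tmul] using h

theorem sw_counit_right (hX : IsComoduleCoalgebra X ρ) {F : H → M} (hF : Lin K F) (v : V) :
    sw (ρ v) (fun h a => X.counit a • F h) = X.counit v • F 1 := by
  have h := congrArg F (hX.counit_colinear v)
  let φ : H →ₗ[K] M := ⟨⟨F, hF.add⟩, hF.smul⟩
  change φ _ = φ _ at h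
  simp only [map_sw, map_smul] at h
  exact h

end IsComoduleCoalgebra

theorem crossing_tmul (ρ : V →ₗ[K] H ⊗[K] V) (μ : H ⊗[K] W →ₗ[K] W) (v : V) (w : W) :
    crossing ρ μ (v ⊗ₜ w) = sw (ρ v) fun h a => μ (h ⊗ₜ w) ⊗ₜ a := by
  simp (disch := fun_prop) only [crossing, LinearMap.comp_apply, LinearEquiv.coe_coe,
    rTensor_eq_sw, lTensor_eq_sw, assoc_eq_sw, assoc_symm_eq_sw, comm_eq_sw, sw_sw, sw_tmul]

theorem cross_comul_tmul (X : CoalgData K V) (ρ : V →ₗ[K] H ⊗[K] V) (Y : CoalgData K W)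
    (μ : H ⊗[K] W →ₗ[K] W) (v : V) (w : W) :
    (X.cross ρ Y μ).comul (v ⊗ₜ w) = sw (X.comul v) fun v₁ v₂ => sw (Y.comul w) fun w₁ w₂ =>
      sw (ρ v₂) fun h a => (v₁ ⊗ₜ μ (h ⊗ₜ w₁)) ⊗ₜ (a ⊗ₜ w₂) := by
  simp (disch := fun_prop) only [CoalgData.cross, LinearMap.comp_apply, LinearEquiv.coe_coe,
    map_eq_sw, rTensor_eq_sw, lTensor_eq_sw, assoc_eq_sw, assoc_symm_eq_sw, sw_sw, sw_tmul,
    crossing_tmul, tmul_sw, sw_tmul_right]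

theorem cross_counit_tmul (X : CoalgData K V) (ρ : V →ₗ[K] H ⊗[K] V) (Y : CoalgData K W)
    (μ : H ⊗[K] W →ₗ[K] W) (v : V) (w : W) :
    (X.cross ρ Y μ).counit (v ⊗ₜ w) = X.counit v • Y.counit w := rfl

/-! Sweedler rules for the Hopf algebra `H`. -/

theorem hopf_sw_coassoc {F : H → H → H → M} (h₁ : ∀ b c, Lin K fun a => F a b c)
    (h₂ : ∀ a c, Lin K fun b => F a b c) (h₃ : ∀ a b, Lin K fun c => F a b c) (x : H) :
    sw (Coalgebra.comul (R := K) x) (fun a b => sw (Coalgebra.comul (R := K) a) fun c d => F c d b) =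
      sw (Coalgebra.comul (R := K) x) (fun a b => sw (Coalgebra.comul (R := K) b) fun c d => F a c d) :=
  (hopfCoalg_isCoalgebra K H).sw_coassoc h₁ h₂ h₃ x

theorem hopf_sw_counit_left {F : H → M} (hF : Lin K F) (x : H) :
    sw (Coalgebra.comul (R := K) x) (fun a b => Coalgebra.counit (R := K) a • F b) = F x :=
  (hopfCoalg_isCoalgebra K H).sw_counit_left hF x

theorem hopf_sw_counit_right {F : H → M} (hF : Lin K F) (x : H) :
    sw (Coalgebra.comul (R := K) x) (fun a b => Coalgebra.counit (R := K) b • F a) = F x :=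
  (hopfCoalg_isCoalgebra K H).sw_counit_right hF x

theorem hopf_comul_mul (g h : H) : Coalgebra.comul (R := K) (g * h) =
    sw (Coalgebra.comul (R := K) g) fun a b => sw (Coalgebra.comul (R := K) h) fun c d =>
      (a * c) ⊗ₜ[K] (b * d) := by
  rw [Bialgebra.comul_mul]
  conv_lhs => rw [← sw_self (Coalgebra.comul (R := K) g), ← sw_self (Coalgebra.comul (R := K) h)]
  simp only [sw_mul, mul_sw, Algebra.TensorProduct.tmul_mul_tmul]
  rw [sw_comm]

theorem hopf_comul_one : Coalgebra.comul (R := K) (1 : H) = 1 ⊗ₜ 1 := Bialgebra.comul_one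

/-- The left factor needs only a coaction and the right factor only an action. So this covers both
braided tensor products and smash coproducts, where `H` acts on itself by multiplication. -/
theorem cross_isCoalgebra {X : CoalgData K V} {ρ : V →ₗ[K] H ⊗[K] V} {Y : CoalgData K W}
    {μ : H ⊗[K] W →ₗ[K] W} (hX : IsComoduleCoalgebra X ρ) (hY : IsModuleCoalgebra Y μ) :
    (X.cross ρ Y μ).IsCoalgebra where
  coassoc := by
    refine TensorProduct.ext' fun v w => ?_
    simp (disch := fun_prop) only [LinearMap.comp_apply, LinearEquiv.coe_coe,
      rTensor_eq_sw, lTensor_eq_sw, assoc_eq_sw, sw_sw, sw_tmul,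
      cross_comul_tmul, tmul_sw, sw_tmul_right, hY.comul_act, ← hY.mul_act,
      sw_comm (Y.comul _) (X.comul _), sw_comm (ρ _) (X.comul _), sw_comm (ρ _) (Y.comul _),
      sw_comm (Coalgebra.comul _) (X.comul _), sw_comm (Coalgebra.comul _) (Y.comul _),
      sw_comm (Coalgebra.comul _) (ρ _),
      hX.isCoalgebra.sw_coassoc, hY.isCoalgebra.sw_coassoc, hX.sw_comul, hX.sw_coassoc]
    refine sw_congr fun a b => sw_congr fun c d => sw_congr fun e f => sw_congr fun g h => ?_
    rw [sw_comm]
  counit_left := by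
    refine TensorProduct.ext' fun v w => ?_
    simp (disch := fun_prop) only [LinearMap.comp_apply, LinearEquiv.coe_coe,
      rTensor_eq_sw, lid_eq_sw, sw_sw, sw_tmul,
      cross_comul_tmul, cross_counit_tmul, hY.counit_act, smul_eq_mul, mul_smul, LinearMap.id_apply,
      ← smul_sw, hX.sw_counit, smul_comm _ (Y.counit _), hY.isCoalgebra.sw_counit_left,
      hX.isCoalgebra.sw_counit_left]
  counit_right := by
    refine TensorProduct.ext' fun v w => ?_
    simp (disch := fun_prop) only [LinearMap.comp_apply, LinearEquiv.coe_coe,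
      lTensor_eq_sw, rid_eq_sw, sw_sw, sw_tmul,
      cross_comul_tmul, cross_counit_tmul, smul_eq_mul, mul_smul, LinearMap.id_apply,
      ← smul_sw, hX.sw_counit_right, hY.one_act, smul_comm _ (Y.counit _),
      hY.isCoalgebra.sw_counit_right, hX.isCoalgebra.sw_counit_right]

end CrossedCoalgebras

/-! ### Diagonal action and coaction on braided tensor products. -/

section BraidedCoalgebras

variable {K : Type*} [Field K]
variable {C D M V W U H : Type*} [AddCommGroup C] [Module K C] [AddCommGroup D] [Module K D]
  [AddCommMonoid M] [Module K M] [AddCommGroup V] [Module K V] [AddCommGroup W] [Module K W]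
  [AddCommGroup U] [Module K U] [Ring H] [HopfAlgebra K H]

/-- The diagonal action `h (v ⊗ w) = h₁ v ⊗ h₂ w`. -/
def diagAct (μ : H ⊗[K] V →ₗ[K] V) (ν : H ⊗[K] W →ₗ[K] W) :
    H ⊗[K] (V ⊗[K] W) →ₗ[K] V ⊗[K] W :=
  TensorProduct.map μ ν ∘ₗ (TensorProduct.tensorTensorTensorComm K H H V W).toLinearMap ∘ₗ
    (Coalgebra.comul (R := K) (A := H)).rTensor (V ⊗[K] W)

/-- The diagonal coaction `v ⊗ w ↦ v₋₁ w₋₁ ⊗ (v₀ ⊗ w₀)`. -/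
def diagCoact (ρ : V →ₗ[K] H ⊗[K] V) (σ : W →ₗ[K] H ⊗[K] W) :
    V ⊗[K] W →ₗ[K] H ⊗[K] (V ⊗[K] W) :=
  (LinearMap.mul' K H).rTensor (V ⊗[K] W) ∘ₗ
    (TensorProduct.tensorTensorTensorComm K H V H W).toLinearMap ∘ₗ TensorProduct.map ρ σ

theorem diagAct_tmul (μ : H ⊗[K] V →ₗ[K] V) (ν : H ⊗[K] W →ₗ[K] W) (h : H) (v : V) (w : W) :
    diagAct μ ν (h ⊗ₜ (v ⊗ₜ w)) = sw (Coalgebra.comul (R := K) h) fun h₁ h₂ =>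
      μ (h₁ ⊗ₜ v) ⊗ₜ ν (h₂ ⊗ₜ w) := by
  simp (disch := fun_prop) only [diagAct, LinearMap.comp_apply, LinearEquiv.coe_coe,
    rTensor_eq_sw, map_eq_sw, tensorTensorTensorComm_eq_sw, sw_sw, sw_tmul]

theorem diagCoact_tmul (ρ : V →ₗ[K] H ⊗[K] V) (σ : W →ₗ[K] H ⊗[K] W) (v : V) (w : W) :
    diagCoact ρ σ (v ⊗ₜ w) = sw (ρ v) fun g a => sw (σ w) fun h b => (g * h) ⊗ₜ (a ⊗ₜ b) := by
  simp (disch := fun_prop) only [diagCoact, LinearMap.comp_apply, LinearEquiv.coe_coe,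
    rTensor_eq_sw, map_eq_sw, tensorTensorTensorComm_eq_sw, sw_sw, sw_tmul, mul'_eq_sw]

/-- A coalgebra with an action and a coaction of `H` making it a coalgebra in Yetter-Drinfeld
modules; the Yetter-Drinfeld condition is stated without the antipode. -/
structure IsBraidedCoalgebra (X : CoalgData K V) (μ : H ⊗[K] V →ₗ[K] V)
    (ρ : V →ₗ[K] H ⊗[K] V) : Prop where
  mod : IsModuleCoalgebra X μ
  comod : IsComoduleCoalgebra X ρ
  yetterDrinfeld : ∀ h v,
    sw (Coalgebra.comul (R := K) h) (fun h₁ h₂ =>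
      sw (ρ (μ (h₁ ⊗ₜ v))) fun k a => (k * h₂) ⊗ₜ[K] a) =
    sw (Coalgebra.comul (R := K) h) (fun h₁ h₂ =>
      sw (ρ v) fun k a => (h₁ * k) ⊗ₜ[K] μ (h₂ ⊗ₜ a))

theorem IsBraidedCoalgebra.sw_yetterDrinfeld {X : CoalgData K V} {μ : H ⊗[K] V →ₗ[K] V}
    {ρ : V →ₗ[K] H ⊗[K] V} (hX : IsBraidedCoalgebra X μ ρ) (F : H → V → M)
    (h₁ : ∀ b, Lin K fun a => F a b) (h₂ : ∀ a, Lin K fun b => F a b) (h : H) (v : V) :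
    sw (Coalgebra.comul (R := K) h) (fun h₁ h₂ =>
      sw (ρ (μ (h₁ ⊗ₜ v))) fun k a => F (k * h₂) a) =
    sw (Coalgebra.comul (R := K) h) (fun h₁ h₂ =>
      sw (ρ v) fun k a => F (h₁ * k) (μ (h₂ ⊗ₜ a))) := by
  have h := congrArg (fun t => sw t F) (hX.yetterDrinfeld h v)
  simpa (disch := fun_prop) only [sw_sw, sw_tmul] using h

theorem cross_isModuleCoalgebra {X : CoalgData K V} {μ : H ⊗[K] V →ₗ[K] V}
    {ρ : V →ₗ[K] H ⊗[K] V} (hX : IsBraidedCoalgebra X μ ρ) {Y : CoalgData K W}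
    {ν : H ⊗[K] W →ₗ[K] W} (hY : IsModuleCoalgebra Y ν) :
    IsModuleCoalgebra (X.cross ρ Y ν) (diagAct μ ν) where
  isCoalgebra := cross_isCoalgebra hX.comod hY
  one_act z := by
    induction z with
    | zero => simp
    | add x y hx hy => rw [TensorProduct.tmul_add, map_add, hx, hy]
    | tmul v w =>
      simp (disch := fun_prop) only [diagAct_tmul, hopf_comul_one, sw_tmul, hX.mod.one_act,
        hY.one_act]
  mul_act g h z := by
    induction z with
    | zero => simp
    | add x y hx hy => simp only [TensorProduct.tmul_add, map_add, hx, hy]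
    | tmul v w =>
      simp (disch := fun_prop) only [diagAct_tmul, hopf_comul_mul, sw_tmul, sw_sw, hX.mod.mul_act,
        hY.mul_act, tmul_sw, map_sw]
      rw [sw_comm]
  comul_act h z := by
    induction z with
    | zero => simp (disch := fun_prop) only [TensorProduct.tmul_zero, map_zero, sw_zero, sw_fun_zero]
    | add x y hx hy =>
      simp (disch := fun_prop) only [TensorProduct.tmul_add, map_add, hx, hy, sw_add, sw_fun_add]
    | tmul v w =>
      simp (disch := fun_prop) only [diagAct_tmul, sw_tmul, sw_sw, map_sw, tmul_sw, sw_tmul_right,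
        cross_comul_tmul, hX.mod.comul_act, hY.comul_act, ← hY.mul_act,
        sw_comm (Coalgebra.comul _) (X.comul _), sw_comm (Coalgebra.comul _) (Y.comul _),
        sw_comm (ρ _) (Y.comul _), sw_comm (ρ _) (Coalgebra.comul _)]
      refine sw_congr fun v₁ v₂ => sw_congr fun w₁ w₂ => ?_
      conv_rhs => enter [2, h₁, h₂]; rw [sw_comm]
      simp (disch := fun_prop) only [hopf_sw_coassoc]
      refine sw_congr fun a r => ?_
      simp (disch := fun_prop) only [← hopf_sw_coassoc]
      -- Of the legs of `h`, only the middle part `s` is shared between `v₂` and `w₁`. This is where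
      -- the action has to pass the coaction of `v₂`.
      exact sw_congr fun s d => hX.sw_yetterDrinfeld
        (fun k x => (μ (a ⊗ₜ v₁) ⊗ₜ[K] ν (k ⊗ₜ w₁)) ⊗ₜ[K] (x ⊗ₜ[K] ν (d ⊗ₜ w₂)))
        (by fun_prop) (by fun_prop) s v₂
  counit_act h z := by
    induction z with
    | zero => simp
    | add x y hx hy => simp only [TensorProduct.tmul_add, map_add, hx, hy, smul_add]
    | tmul v w =>
      simp (disch := fun_prop) only [diagAct_tmul, map_sw, cross_counit_tmul, hX.mod.counit_act,
        hY.counit_act, smul_assoc, smul_comm (X.counit v), hopf_sw_counit_left]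

/-- Colinearity of the comultiplication is the one axiom that needs the Yetter-Drinfeld condition on
`W`. It moves the coaction of `w₁` past the element of `H` by which the crossing acts on `w₁`. -/
theorem cross_isComoduleCoalgebra {X : CoalgData K V}
    {ρ : V →ₗ[K] H ⊗[K] V} (hX : IsComoduleCoalgebra X ρ) {Y : CoalgData K W}
    {ν : H ⊗[K] W →ₗ[K] W} {σ : W →ₗ[K] H ⊗[K] W} (hY : IsBraidedCoalgebra Y ν σ) :
    IsComoduleCoalgebra (X.cross ρ Y ν) (diagCoact ρ σ) where
  isCoalgebra := cross_isCoalgebra hX hY.mod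
  coassoc z := by
    induction z with
    | zero => simp (disch := fun_prop) only [map_zero, sw_zero]
    | add x y hx hy =>
      simp (disch := fun_prop) only [map_add, sw_add, hx, hy]
    | tmul v w =>
      simp (disch := fun_prop) only [diagCoact_tmul, hopf_comul_mul, sw_tmul, sw_sw,
        sw_comm (σ _) (ρ _), hX.sw_coassoc, hY.comod.sw_coassoc, sw_comm (Coalgebra.comul _) (σ _)]
  counit z := by
    induction z with
    | zero => simp (disch := fun_prop) only [map_zero, sw_zero]
    | add x y hx hy =>
      simp (disch := fun_prop) only [map_add, sw_add, hx, hy]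
    | tmul v w =>
      simp (disch := fun_prop) only [diagCoact_tmul, Bialgebra.counit_mul, sw_tmul, sw_sw, mul_smul,
        ← smul_sw, hY.comod.sw_counit, hX.sw_counit]
  comul_colinear z := by
    induction z with
    | zero => simp (disch := fun_prop) only [map_zero, sw_zero]
    | add x y hx hy =>
      simp (disch := fun_prop) only [map_add, sw_add, hx, hy]
    | tmul v w =>
      simp (disch := fun_prop) only [diagCoact_tmul, sw_tmul, sw_sw, cross_comul_tmul, tmul_sw,
        sw_comm (ρ _) (X.comul _), sw_comm (σ _) (Y.comul _), sw_comm (σ _) (X.comul _),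
        sw_comm (ρ _) (Y.comul _), hX.sw_comul, hX.sw_coassoc, hY.comod.sw_comul,
        sw_comm (Coalgebra.comul _) (σ (LinearMap.id _)), sw_comm (σ _) (ρ _),
        sw_comm (Y.comul _) (X.comul _)]
      refine sw_congr fun v₁ v₂ => sw_congr fun w₁ w₂ => ?_
      rw [sw_comm (ρ v₂) (ρ v₁)]
      refine sw_congr fun g a => ?_
      simp (disch := fun_prop) only [hX.sw_coassoc, sw_comm _ (σ w₂)]
      refine sw_congr fun k c => sw_congr fun h b => ?_
      have := hY.sw_yetterDrinfeld
        (fun l x => (g * (l * k)) ⊗ₜ[K] ((a ⊗ₜ[K] x) ⊗ₜ[K] (b ⊗ₜ[K] c))) (by fun_prop) (by fun_prop)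
        h w₁
      simpa only [mul_assoc] using this.symm
  counit_colinear z := by
    induction z with
    | zero => simp (disch := fun_prop) only [map_zero, sw_zero, zero_smul]
    | add x y hx hy =>
      simp (disch := fun_prop) only [map_add, sw_add, hx, hy, add_smul]
    | tmul v w =>
      simp (disch := fun_prop) only [diagCoact_tmul, sw_tmul, sw_sw, cross_counit_tmul, smul_assoc,
        ← smul_sw, hY.comod.sw_counit_right, smul_comm _ (Y.counit w), hX.sw_counit_right, mul_one]

end BraidedCoalgebras

/-! ### Braided tensor products, smash coproducts and the map `slide`. -/

section SmashCoproducts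

variable {K : Type*} [Field K]
variable {C D M V W U H : Type*} [AddCommGroup C] [Module K C] [AddCommGroup D] [Module K D]
  [AddCommMonoid M] [Module K M] [AddCommGroup V] [Module K V] [AddCommGroup W] [Module K W]
  [AddCommGroup U] [Module K U] [Ring H] [HopfAlgebra K H]

theorem cross_isBraidedCoalgebra {X : CoalgData K V} {μ : H ⊗[K] V →ₗ[K] V}
    {ρ : V →ₗ[K] H ⊗[K] V} (hX : IsBraidedCoalgebra X μ ρ) {Y : CoalgData K W}
    {ν : H ⊗[K] W →ₗ[K] W} {σ : W →ₗ[K] H ⊗[K] W} (hY : IsBraidedCoalgebra Y ν σ) :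
    IsBraidedCoalgebra (X.cross ρ Y ν) (diagAct μ ν) (diagCoact ρ σ) where
  mod := cross_isModuleCoalgebra hX hY.mod
  comod := cross_isComoduleCoalgebra hX.comod hY
  yetterDrinfeld h z := by
    induction z with
    | zero => simp (disch := fun_prop) only [TensorProduct.tmul_zero, map_zero, sw_zero, sw_fun_zero]
    | add x y hx hy =>
      simp (disch := fun_prop) only [TensorProduct.tmul_add, map_add, sw_add, sw_fun_add, hx, hy]
    | tmul v w =>
      simp (disch := fun_prop) only [diagAct_tmul, diagCoact_tmul, sw_tmul, sw_sw, map_sw, tmul_sw,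
        sw_tmul_right, sw_comm (ρ _) (Coalgebra.comul _), sw_comm (σ _) (Coalgebra.comul _),
        hopf_sw_coassoc]
      -- Here `h` is spread over three legs. The condition for `W` is applied to the last two, then
      -- the condition for `V` to the first two after regrouping by coassociativity.
      trans sw (Coalgebra.comul (R := K) h) fun a r => sw (ρ (μ (a ⊗ₜ v))) fun k x =>
        sw (Coalgebra.comul (R := K) r) fun b c => sw (σ w) fun l y =>
          (k * (b * l)) ⊗ₜ[K] (x ⊗ₜ[K] ν (c ⊗ₜ y))
      · refine sw_congr fun a r => ?_
        simp only [sw_comm _ (ρ _)]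
        refine sw_congr fun k x => ?_
        have := hY.sw_yetterDrinfeld (fun l y => (k * l) ⊗ₜ[K] (x ⊗ₜ[K] y)) (by fun_prop)
          (by fun_prop) r w
        simpa only [mul_assoc] using this
      trans sw (σ w) fun l y => sw (Coalgebra.comul (R := K) h) fun s c =>
        sw (Coalgebra.comul (R := K) s) fun a b => sw (ρ (μ (a ⊗ₜ v))) fun k x =>
          (k * b * l) ⊗ₜ[K] (x ⊗ₜ[K] ν (c ⊗ₜ y))
      · simp (disch := fun_prop) only [sw_comm (ρ _) (Coalgebra.comul _), sw_comm _ (σ w),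
          hopf_sw_coassoc, mul_assoc]
      trans sw (σ w) fun l y => sw (Coalgebra.comul (R := K) h) fun s c =>
        sw (Coalgebra.comul (R := K) s) fun a b => sw (ρ v) fun k x =>
          (a * k * l) ⊗ₜ[K] (μ (b ⊗ₜ x) ⊗ₜ[K] ν (c ⊗ₜ y))
      · exact sw_congr fun l y => sw_congr fun s c => hX.sw_yetterDrinfeld
          (fun k x => (k * l) ⊗ₜ[K] (x ⊗ₜ[K] ν (c ⊗ₜ y))) (by fun_prop) (by fun_prop) s v
      · simp (disch := fun_prop) only [sw_comm (ρ _) (Coalgebra.comul _), sw_comm _ (σ w),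
          hopf_sw_coassoc, mul_assoc]

theorem hopfCoalg_comul (h : H) : (hopfCoalg K H).comul h = Coalgebra.comul (R := K) h := rfl

theorem hopfCoalg_counit (h : H) : (hopfCoalg K H).counit h = Coalgebra.counit (R := K) h := rfl

theorem hopf_isModuleCoalgebra : IsModuleCoalgebra (hopfCoalg K H) (LinearMap.mul' K H) where
  isCoalgebra := hopfCoalg_isCoalgebra K H
  one_act := by simp
  mul_act := by simp [mul_assoc]
  comul_act h w := hopf_comul_mul h w
  counit_act h w := Bialgebra.counit_mul h w

theorem tensor_comul_tmul (X : CoalgData K C) (Y : CoalgData K D) (x : C) (y : D) :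
    (X.tensor Y).comul (x ⊗ₜ y) = sw (X.comul x) fun x₁ x₂ => sw (Y.comul y) fun y₁ y₂ =>
      (x₁ ⊗ₜ y₁) ⊗ₜ (x₂ ⊗ₜ y₂) := by
  simp (disch := fun_prop) only [CoalgData.tensor, LinearMap.comp_apply, LinearEquiv.coe_coe,
    map_eq_sw, tensorTensorTensorComm_eq_sw, sw_sw, sw_tmul]

theorem tensor_counit_tmul (X : CoalgData K C) (Y : CoalgData K D) (x : C) (y : D) :
    (X.tensor Y).counit (x ⊗ₜ y) = X.counit x • Y.counit y := rfl

theorem slide_tmul (μ : H ⊗[K] (V ⊗[K] H) →ₗ[K] V ⊗[K] H) (y : U) (h : H) (z : V ⊗[K] H) :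
    slide μ ((y ⊗ₜ h) ⊗ₜ z) = sw (μ (h ⊗ₜ z)) fun v l => (y ⊗ₜ v) ⊗ₜ l := by
  simp (disch := fun_prop) only [slide, LinearMap.comp_apply, LinearEquiv.coe_coe,
    lTensor_eq_sw, assoc_eq_sw, assoc_symm_eq_sw, sw_sw, sw_tmul]

/-- The bridge between ordinary tensor powers of smash coproducts and braided tensor powers of their
bases. On the left `h` is comultiplied before acting; on the right it acts first and the coaction of
the result appears. The Yetter-Drinfeld condition on `V` equates the two. -/
theorem slide_diagAct_isCoalgHom {Y : CoalgData K U} {τ : U →ₗ[K] H ⊗[K] U}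
    (hY : IsComoduleCoalgebra Y τ) {X : CoalgData K V} {μ : H ⊗[K] V →ₗ[K] V}
    {ρ : V →ₗ[K] H ⊗[K] V} (hX : IsBraidedCoalgebra X μ ρ) :
    IsCoalgHom ((Y.cross τ (hopfCoalg K H) (LinearMap.mul' K H)).tensor
        (X.cross ρ (hopfCoalg K H) (LinearMap.mul' K H)))
      ((Y.cross τ X μ).cross (diagCoact τ ρ) (hopfCoalg K H) (LinearMap.mul' K H))
      (slide (diagAct μ (LinearMap.mul' K H))) where
  comul := by
    refine TensorProduct.ext_fourfold' fun y h v l => ?_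
    simp (disch := fun_prop) only [LinearMap.comp_apply, slide_tmul, diagAct_tmul, sw_sw, sw_tmul,
      map_sw, cross_comul_tmul, tensor_comul_tmul, map_eq_sw, tmul_sw, sw_tmul_right,
      diagCoact_tmul, LinearMap.mul'_apply, hopfCoalg_comul, hopf_comul_mul, hX.mod.comul_act,
      ← hX.mod.mul_act, sw_comm (Y.comul y) (X.comul v),
      sw_comm (Coalgebra.comul _) (X.comul v),
      sw_comm (Coalgebra.comul _) (Y.comul y),
      sw_comm (τ _) (X.comul v)]
    refine sw_congr fun v₁ v₂ => sw_congr fun y₁ y₂ => ?_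
    simp (disch := fun_prop) only [sw_comm _ (Coalgebra.comul l)]
    refine sw_congr fun l₁ l₂ => ?_
    simp (disch := fun_prop) only [hY.sw_coassoc,
      sw_comm (Coalgebra.comul _) (τ _), sw_comm (ρ _) (τ _), sw_comm (ρ _) (Coalgebra.comul _)]
    refine sw_congr fun g y₀ => ?_
    simp only [sw_comm _ (Coalgebra.comul g)]
    refine sw_congr fun g₁ g₂ => ?_
    conv_rhs => enter [2, h₁, h₂]; rw [sw_comm]
    simp (disch := fun_prop) only [hopf_sw_coassoc]
    refine sw_congr fun a r => ?_
    simp (disch := fun_prop) only [← hopf_sw_coassoc]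
    refine sw_congr fun s d => ?_
    have := hX.sw_yetterDrinfeld (fun k x => (y₁ ⊗ₜ[K] μ ((g₁ * a) ⊗ₜ[K] v₁)) ⊗ₜ[K]
      (g₂ * (k * l₁)) ⊗ₜ[K] ((y₀ ⊗ₜ[K] x) ⊗ₜ[K] (d * l₂))) (by fun_prop) (by fun_prop) s v₂
    simpa only [mul_assoc] using this
  counit := by
    refine TensorProduct.ext_fourfold' fun y h v l => ?_
    simp (disch := fun_prop) only [LinearMap.comp_apply, slide_tmul, diagAct_tmul, sw_sw, sw_tmul,
      map_sw, cross_counit_tmul, tensor_counit_tmul, LinearMap.mul'_apply, hopfCoalg_counit,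
      Bialgebra.counit_mul, hX.mod.counit_act, smul_eq_mul]
    trans sw (Coalgebra.comul (R := K) h) fun a b => Coalgebra.counit (R := K) a •
      (Y.counit y * X.counit v * Coalgebra.counit (R := K) b * Coalgebra.counit (R := K) l)
    · exact sw_congr fun a b => by simp only [smul_eq_mul]; ring
    · rw [hopf_sw_counit_left (by fun_prop)]
      ring

end SmashCoproducts

/-! ### Coalgebra maps, convolution products and convolution inverses. -/

section Convolution

variable {K : Type*} [Field K]
variable {C D M N B : Type*} [AddCommGroup C] [Module K C] [AddCommGroup D] [Module K D]
  [AddCommGroup M] [Module K M] [AddCommGroup N] [Module K N] [AddCommGroup B] [Module K B]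
variable {X : CoalgData K C} {Y : CoalgData K D} {Z : CoalgData K B}

theorem IsCoalgHom.comul_apply {f : C →ₗ[K] D} (hf : IsCoalgHom X Y f) (x : C) :
    Y.comul (f x) = sw (X.comul x) fun a b => f a ⊗ₜ f b := by
  rw [← map_eq_sw]
  exact LinearMap.congr_fun hf.comul x

theorem IsCoalgHom.counit_apply {f : C →ₗ[K] D} (hf : IsCoalgHom X Y f) (x : C) :
    Y.counit (f x) = X.counit x := LinearMap.congr_fun hf.counit x

theorem IsCoalgHom.of_apply {f : C →ₗ[K] D}
    (h₁ : ∀ x, Y.comul (f x) = sw (X.comul x) fun a b => f a ⊗ₜ f b)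
    (h₂ : ∀ x, Y.counit (f x) = X.counit x) : IsCoalgHom X Y f where
  comul := by
    ext x
    rw [LinearMap.comp_apply, h₁, LinearMap.comp_apply, map_eq_sw]
  counit := by
    ext x
    exact h₂ x

theorem IsCoalgHom.id : IsCoalgHom X X LinearMap.id where
  comul := by simp
  counit := rfl

theorem IsCoalgHom.comp {g : D →ₗ[K] B} {f : C →ₗ[K] D} (hg : IsCoalgHom Y Z g)
    (hf : IsCoalgHom X Y f) : IsCoalgHom X Z (g ∘ₗ f) where
  comul := by
    rw [← LinearMap.comp_assoc, hg.comul, LinearMap.comp_assoc, hf.comul, ← LinearMap.comp_assoc,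
      ← TensorProduct.map_comp]
  counit := by rw [← LinearMap.comp_assoc, hg.counit, hf.counit]

theorem tensor_isCoalgebra (hX : X.IsCoalgebra) (hY : Y.IsCoalgebra) :
    (X.tensor Y).IsCoalgebra where
  coassoc := by
    refine TensorProduct.ext' fun x y => ?_
    simp (disch := fun_prop) only [LinearMap.comp_apply, LinearEquiv.coe_coe,
      rTensor_eq_sw, lTensor_eq_sw, assoc_eq_sw, sw_sw, sw_tmul,
      tensor_comul_tmul, tmul_sw, sw_tmul_right, sw_comm (Y.comul _) (X.comul _),
      hX.sw_coassoc, hY.sw_coassoc]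
  counit_left := by
    refine TensorProduct.ext' fun x y => ?_
    simp (disch := fun_prop) only [LinearMap.comp_apply, LinearEquiv.coe_coe,
      rTensor_eq_sw, lid_eq_sw, sw_sw, sw_tmul, tensor_comul_tmul, tensor_counit_tmul,
      smul_assoc, ← smul_sw, hX.sw_counit_left, hY.sw_counit_left, LinearMap.id_apply]
  counit_right := by
    refine TensorProduct.ext' fun x y => ?_
    simp (disch := fun_prop) only [LinearMap.comp_apply, LinearEquiv.coe_coe,
      lTensor_eq_sw, rid_eq_sw, sw_sw, sw_tmul, tensor_comul_tmul, tensor_counit_tmul,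
      smul_assoc, ← smul_sw, hX.sw_counit_right, hY.sw_counit_right, LinearMap.id_apply]

theorem IsCoalgHom.tensor {C' D' : Type*} [AddCommGroup C'] [Module K C'] [AddCommGroup D']
    [Module K D'] {X' : CoalgData K C'} {Y' : CoalgData K D'} {f : C →ₗ[K] C'} {g : D →ₗ[K] D'}
    (hf : IsCoalgHom X X' f) (hg : IsCoalgHom Y Y' g) :
    IsCoalgHom (X.tensor Y) (X'.tensor Y') (TensorProduct.map f g) where
  comul := by
    refine TensorProduct.ext' fun x y => ?_
    simp (disch := fun_prop) only [LinearMap.comp_apply, map_eq_sw, sw_sw, sw_tmul,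
      tensor_comul_tmul, tmul_sw, sw_tmul_right, hf.comul_apply, hg.comul_apply]
  counit := by
    refine TensorProduct.ext' fun x y => ?_
    simp (disch := fun_prop) only [LinearMap.comp_apply, TensorProduct.map_tmul, tensor_counit_tmul,
      hf.counit_apply, hg.counit_apply]

theorem IsCoalgHom.rTensor {f : C →ₗ[K] D} (hf : IsCoalgHom X Y f) (Z : CoalgData K B) :
    IsCoalgHom (X.tensor Z) (Y.tensor Z) (f.rTensor B) := hf.tensor .id

theorem IsCoalgHom.lTensor {f : C →ₗ[K] D} (hf : IsCoalgHom X Y f) (Z : CoalgData K B) :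
    IsCoalgHom (Z.tensor X) (Z.tensor Y) (f.lTensor B) := IsCoalgHom.id.tensor hf

theorem IsCoalgHom.assoc : IsCoalgHom ((X.tensor Y).tensor Z) (X.tensor (Y.tensor Z))
    (TensorProduct.assoc K C D B).toLinearMap where
  comul := by
    refine TensorProduct.ext_threefold fun x y z => ?_
    simp (disch := fun_prop) only [LinearMap.comp_apply, LinearEquiv.coe_coe, map_eq_sw, sw_sw,
      sw_tmul, tensor_comul_tmul, tmul_sw, sw_tmul_right, TensorProduct.assoc_tmul]
  counit := by
    refine TensorProduct.ext_threefold fun x y z => ?_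
    simp only [LinearMap.comp_apply, LinearEquiv.coe_coe, TensorProduct.assoc_tmul,
      tensor_counit_tmul, smul_eq_mul, mul_assoc]

/-- `x ⊗ y ↦ ε(x) y`. -/
def CoalgData.dropLeft (X : CoalgData K C) (D : Type*) [AddCommGroup D] [Module K D] :
    C ⊗[K] D →ₗ[K] D := (TensorProduct.lid K D).toLinearMap ∘ₗ X.counit.rTensor D

/-- `x ⊗ y ↦ ε(y) x`. -/
def CoalgData.dropRight (Y : CoalgData K D) (C : Type*) [AddCommGroup C] [Module K C] :
    C ⊗[K] D →ₗ[K] C := (TensorProduct.rid K C).toLinearMap ∘ₗ Y.counit.lTensor C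

theorem dropLeft_tmul (X : CoalgData K C) (x : C) (y : D) :
    X.dropLeft D (x ⊗ₜ y) = X.counit x • y := by
  simp [CoalgData.dropLeft]

theorem dropRight_tmul (Y : CoalgData K D) (x : C) (y : D) :
    Y.dropRight C (x ⊗ₜ y) = Y.counit y • x := by
  simp [CoalgData.dropRight]

theorem IsCoalgHom.dropLeft (hX : X.IsCoalgebra) (Y : CoalgData K D) :
    IsCoalgHom (X.tensor Y) Y (X.dropLeft D) where
  comul := by
    refine TensorProduct.ext' fun x y => ?_
    simp (disch := fun_prop) only [LinearMap.comp_apply, map_eq_sw, sw_sw, sw_tmul,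
      tensor_comul_tmul, dropLeft_tmul, ← TensorProduct.smul_tmul', TensorProduct.tmul_smul,
      sw_comm (X.comul _), hX.sw_counit_right, ← smul_sw, sw_self, map_smul]
  counit := by
    refine TensorProduct.ext' fun x y => ?_
    simp only [LinearMap.comp_apply, dropLeft_tmul, tensor_counit_tmul, map_smul]

theorem IsCoalgHom.dropRight (hY : Y.IsCoalgebra) (X : CoalgData K C) :
    IsCoalgHom (X.tensor Y) X (Y.dropRight C) where
  comul := by
    refine TensorProduct.ext' fun x y => ?_
    simp (disch := fun_prop) only [LinearMap.comp_apply, map_eq_sw, sw_sw, sw_tmul,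
      tensor_comul_tmul, dropRight_tmul, ← TensorProduct.smul_tmul', TensorProduct.tmul_smul,
      hY.sw_counit_right, ← smul_sw, sw_self, map_smul]
  counit := by
    refine TensorProduct.ext' fun x y => ?_
    simp only [LinearMap.comp_apply, dropRight_tmul, tensor_counit_tmul, map_smul, smul_eq_mul,
      mul_comm]

/-! Convolution products. -/

theorem convL_apply (f : C →ₗ[K] K) (g : C →ₗ[K] M) (x : C) :
    X.convL f g x = sw (X.comul x) fun a b => f a • g b := by
  simp (disch := fun_prop) only [CoalgData.convL, LinearMap.comp_apply, LinearEquiv.coe_coe,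
    map_eq_sw, lid_eq_sw, sw_sw, sw_tmul]

theorem convR_apply (g : C →ₗ[K] M) (f : C →ₗ[K] K) (x : C) :
    X.convR g f x = sw (X.comul x) fun a b => f b • g a := by
  simp (disch := fun_prop) only [CoalgData.convR, LinearMap.comp_apply, LinearEquiv.coe_coe,
    map_eq_sw, rid_eq_sw, sw_sw, sw_tmul]

theorem convR_eq_convL (g f : C →ₗ[K] K) : X.convR g f = X.convL g f := by
  ext x
  simp only [convL_apply, convR_apply, smul_eq_mul, mul_comm]

theorem comp_convL (ψ : M →ₗ[K] N) (f : C →ₗ[K] K) (g : C →ₗ[K] M) :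
    ψ ∘ₗ X.convL f g = X.convL f (ψ ∘ₗ g) := by
  ext x
  simp only [LinearMap.comp_apply, convL_apply, map_sw, map_smul]

theorem comp_convR (ψ : M →ₗ[K] N) (g : C →ₗ[K] M) (f : C →ₗ[K] K) :
    ψ ∘ₗ X.convR g f = X.convR (ψ ∘ₗ g) f := by
  ext x
  simp only [LinearMap.comp_apply, convR_apply, map_sw, map_smul]

theorem IsCoalgHom.convL_comp {φ : C →ₗ[K] D} (hφ : IsCoalgHom X Y φ) (f : D →ₗ[K] K)
    (g : D →ₗ[K] M) : Y.convL f g ∘ₗ φ = X.convL (f ∘ₗ φ) (g ∘ₗ φ) := by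
  ext x
  simp (disch := fun_prop) only [LinearMap.comp_apply, convL_apply, hφ.comul_apply, sw_sw, sw_tmul]

theorem IsCoalgHom.convR_comp {φ : C →ₗ[K] D} (hφ : IsCoalgHom X Y φ) (g : D →ₗ[K] M)
    (f : D →ₗ[K] K) : Y.convR g f ∘ₗ φ = X.convR (g ∘ₗ φ) (f ∘ₗ φ) := by
  ext x
  simp (disch := fun_prop) only [LinearMap.comp_apply, convR_apply, hφ.comul_apply, sw_sw, sw_tmul]

namespace CoalgData.IsCoalgebra

theorem convL_convL (hX : X.IsCoalgebra) (f f' : C →ₗ[K] K) (g : C →ₗ[K] M) :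
    X.convL f (X.convL f' g) = X.convL (X.convL f f') g := by
  ext x
  simp (disch := fun_prop) only [convL_apply, sw_smul_right, smul_sw, hX.sw_coassoc, smul_assoc]

theorem convR_convR (hX : X.IsCoalgebra) (g : C →ₗ[K] M) (f f' : C →ₗ[K] K) :
    X.convR (X.convR g f) f' = X.convR g (X.convL f f') := by
  ext x
  simp (disch := fun_prop) only [convL_apply, convR_apply, sw_smul_right, smul_sw, hX.sw_coassoc,
    smul_assoc, smul_comm (f' _)]

theorem convL_convR (hX : X.IsCoalgebra) (f : C →ₗ[K] K) (g : C →ₗ[K] M) (f' : C →ₗ[K] K) :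
    X.convL f (X.convR g f') = X.convR (X.convL f g) f' := by
  ext x
  simp (disch := fun_prop) only [convL_apply, convR_apply, sw_smul_right, smul_sw, hX.sw_coassoc,
    smul_comm (f' _)]

theorem counit_convL (hX : X.IsCoalgebra) (g : C →ₗ[K] M) : X.convL X.counit g = g := by
  ext x
  rw [convL_apply, hX.sw_counit_left (by fun_prop)]

theorem convR_counit (hX : X.IsCoalgebra) (g : C →ₗ[K] M) : X.convR g X.counit = g := by
  ext x
  rw [convR_apply, hX.sw_counit_right (by fun_prop)]

end CoalgData.IsCoalgebra

/-- The convolution monoid of functionals on a coalgebra. -/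
structure ConvDual (X : CoalgData K C) (hX : X.IsCoalgebra) where
  /-- the underlying functional -/
  val : C →ₗ[K] K

instance (hX : X.IsCoalgebra) : Monoid (ConvDual X hX) where
  mul f g := ⟨X.convL f.val g.val⟩
  one := ⟨X.counit⟩
  mul_assoc f g h := congrArg ConvDual.mk (hX.convL_convL f.val g.val h.val).symm
  one_mul f := congrArg ConvDual.mk (hX.counit_convL f.val)
  mul_one f := congrArg ConvDual.mk
    ((convR_eq_convL f.val X.counit).symm.trans (hX.convR_counit f.val))

/-- An invertible functional as a unit of the convolution monoid. -/
def CoalgData.IsConvInverse.unit {f f' : C →ₗ[K] K} (h : X.IsConvInverse f f')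
    (hX : X.IsCoalgebra) : (ConvDual X hX)ˣ where
  val := ⟨f⟩
  inv := ⟨f'⟩
  val_inv := congrArg ConvDual.mk h.1
  inv_val := congrArg ConvDual.mk h.2

theorem CoalgData.IsConvInverse.unique {f f₁ f₂ : C →ₗ[K] K} (hX : X.IsCoalgebra)
    (h₁ : X.IsConvInverse f f₁) (h₂ : X.IsConvInverse f f₂) : f₁ = f₂ := by
  have : h₁.unit hX = h₂.unit hX := Units.ext rfl
  exact congrArg (fun u : (ConvDual X hX)ˣ => u.inv.val) this

theorem CoalgData.IsConvInverse.symm {f f' : C →ₗ[K] K} (h : X.IsConvInverse f f') :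
    X.IsConvInverse f' f := ⟨h.2, h.1⟩

theorem CoalgData.IsConvInverse.mul {f f' g g' : C →ₗ[K] K} (hX : X.IsCoalgebra)
    (h : X.IsConvInverse f f') (hg : X.IsConvInverse g g') :
    X.IsConvInverse (X.convL f g) (X.convL g' f') := by
  have h₁ := (h.unit hX * hg.unit hX).val_inv
  have h₂ := (h.unit hX * hg.unit hX).inv_val
  exact ⟨congrArg ConvDual.val h₁, congrArg ConvDual.val h₂⟩

theorem CoalgData.IsConvInvertible.isConvInverse {f : C →ₗ[K] K} (h : X.IsConvInvertible f) :
    X.IsConvInverse f (X.convInv f) := by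
  rw [CoalgData.convInv, dif_pos h]
  exact h.choose_spec

theorem CoalgData.IsConvInverse.convInv_eq {f f' : C →ₗ[K] K} (hX : X.IsCoalgebra)
    (h : X.IsConvInverse f f') : X.convInv f = f' :=
  (CoalgData.IsConvInvertible.isConvInverse ⟨f', h⟩).unique hX h

theorem CoalgData.IsConvInverse.comp {f f' : D →ₗ[K] K} (h : Y.IsConvInverse f f')
    {φ : C →ₗ[K] D} (hφ : IsCoalgHom X Y φ) : X.IsConvInverse (f ∘ₗ φ) (f' ∘ₗ φ) :=
  ⟨by rw [← hφ.convL_comp, h.1, hφ.counit], by rw [← hφ.convL_comp, h.2, hφ.counit]⟩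

end Convolution

/-! ### Convolution on tensor factors and conjugation of coalgebra maps. -/

section Twisting

variable {K : Type*} [Field K]
variable {C D M : Type*} [AddCommGroup C] [Module K C] [AddCommGroup D] [Module K D]
  [AddCommGroup M] [Module K M]
variable {X : CoalgData K C} {Y : CoalgData K D}

theorem IsCoalgHom.mk_left {e : C} (h₁ : X.comul e = e ⊗ₜ e) (h₂ : X.counit e = 1)
    (Y : CoalgData K D) : IsCoalgHom Y (X.tensor Y) (TensorProduct.mk K C D e) :=
  .of_apply (fun y => by
    simp (disch := fun_prop) only [TensorProduct.mk_apply, tensor_comul_tmul, h₁, sw_tmul])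
    (fun y => by simp only [TensorProduct.mk_apply, tensor_counit_tmul, h₂, one_smul])

theorem IsCoalgHom.mk_right {e : D} (h₁ : Y.comul e = e ⊗ₜ e) (h₂ : Y.counit e = 1)
    (X : CoalgData K C) : IsCoalgHom X (X.tensor Y) ((TensorProduct.mk K C D).flip e) :=
  .of_apply (fun x => by
    simp (disch := fun_prop) only [LinearMap.flip_apply, TensorProduct.mk_apply, tensor_comul_tmul,
      h₁, sw_tmul])
    (fun y => by simp only [LinearMap.flip_apply, TensorProduct.mk_apply, tensor_counit_tmul, h₂,
      smul_eq_mul, mul_one])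

theorem funcTensor_counit_left (w : D →ₗ[K] K) : funcTensor X.counit w = w ∘ₗ X.dropLeft D :=
  TensorProduct.ext' fun x y => by
    rw [LinearMap.comp_apply, dropLeft_tmul, map_smul]; rfl

theorem funcTensor_counit_right (w : C →ₗ[K] K) : funcTensor w Y.counit = w ∘ₗ Y.dropRight C :=
  TensorProduct.ext' fun x y => by
    rw [LinearMap.comp_apply, dropRight_tmul, map_smul, smul_eq_mul, mul_comm]; rfl

theorem convL_lTensor (hX : X.IsCoalgebra) (f : D →ₗ[K] K) (g : D →ₗ[K] M) :
    (Y.convL f g).lTensor C = (X.tensor Y).convL (f ∘ₗ X.dropLeft D) (g.lTensor C) := by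
  refine TensorProduct.ext' fun x y => ?_
  simp (disch := fun_prop) only [LinearMap.lTensor_tmul, convL_apply, tensor_comul_tmul,
    LinearMap.comp_apply, dropLeft_tmul, map_smul, smul_assoc, sw_sw, sw_tmul, ← smul_sw,
    hX.sw_counit_left, tmul_sw, TensorProduct.tmul_smul]

theorem convR_lTensor (hX : X.IsCoalgebra) (g : D →ₗ[K] M) (f : D →ₗ[K] K) :
    (Y.convR g f).lTensor C = (X.tensor Y).convR (g.lTensor C) (f ∘ₗ X.dropLeft D) := by
  refine TensorProduct.ext' fun x y => ?_
  simp (disch := fun_prop) only [LinearMap.lTensor_tmul, convR_apply, tensor_comul_tmul,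
    LinearMap.comp_apply, dropLeft_tmul, map_smul, smul_assoc, sw_sw, sw_tmul, ← smul_sw,
    hX.sw_counit_right, tmul_sw, TensorProduct.tmul_smul]

theorem convL_rTensor (hY : Y.IsCoalgebra) (f : C →ₗ[K] K) (g : C →ₗ[K] M) :
    (X.convL f g).rTensor D = (X.tensor Y).convL (f ∘ₗ Y.dropRight C) (g.rTensor D) := by
  refine TensorProduct.ext' fun x y => ?_
  simp (disch := fun_prop) only [LinearMap.rTensor_tmul, convL_apply, tensor_comul_tmul,
    LinearMap.comp_apply, dropRight_tmul, map_smul, smul_assoc, sw_sw, sw_tmul,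
    hY.sw_counit_left, sw_tmul_right, ← TensorProduct.smul_tmul']

theorem convR_rTensor (hY : Y.IsCoalgebra) (g : C →ₗ[K] M) (f : C →ₗ[K] K) :
    (X.convR g f).rTensor D = (X.tensor Y).convR (g.rTensor D) (f ∘ₗ Y.dropRight C) := by
  refine TensorProduct.ext' fun x y => ?_
  simp (disch := fun_prop) only [LinearMap.rTensor_tmul, convR_apply, tensor_comul_tmul,
    LinearMap.comp_apply, dropRight_tmul, map_smul, smul_assoc, sw_sw, sw_tmul,
    hY.sw_counit_right, sw_tmul_right, ← TensorProduct.smul_tmul']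

/-- A coalgebra map conjugated by an invertible functional is a coalgebra map. -/
theorem IsCoalgHom.conj {D : Type*} [AddCommGroup D] [Module K D] {Y : CoalgData K D}
    (hX : X.IsCoalgebra) {w w' : C →ₗ[K] K} (hw : X.IsConvInverse w w')
    {f : C →ₗ[K] D} (hf : IsCoalgHom X Y f) :
    IsCoalgHom X Y (X.convL w (X.convR f w')) := by
  -- The cancellation `w' * w = ε` in the middle of a Sweedler sum. Read backwards, it supplies the
  -- pair of factors that separates the two conjugated copies of `f`.
  have key {F : C → D ⊗[K] D} (hF : Lin K F) (b : C) :
      sw (X.comul b) (fun c d => sw (X.comul d) fun p q => w' c • w p • F q) = F b := by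
    have h := congrArg F (LinearMap.congr_fun
      (congrArg (fun f => X.convL f (LinearMap.id (M := C))) hw.2) b)
    let φ : C →ₗ[K] D ⊗[K] D := ⟨⟨F, hF.add⟩, hF.smul⟩
    change φ _ = φ _ at h
    change _ = φ b
    rw [hX.counit_convL, ← hX.convL_convL] at h
    simp (disch := fun_prop) only [convL_apply, LinearMap.id_apply, map_sw, map_smul, smul_sw] at h
    exact h
  refine .of_apply (fun x => ?_) fun x => ?_
  · simp (disch := fun_prop) only [convL_apply, convR_apply, map_sw, map_smul, hf.comul_apply,
      sw_sw, sw_tmul, sw_tmul_right, tmul_sw, smul_sw, hX.sw_coassoc]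
    conv_rhs => enter [2, a, b]; simp only [sw_comm _ (X.comul a)]
    simp (disch := fun_prop) only [hX.sw_coassoc, ← TensorProduct.smul_tmul',
      TensorProduct.tmul_smul]
    conv_rhs => enter [2, a, b, 2, c, d]; simp only [sw_comm _ (X.comul c)]
    simp (disch := fun_prop) only [hX.sw_coassoc]
    refine sw_congr fun a b => sw_congr fun c d => ?_
    rw [← key (F := fun q => sw (X.comul q) fun p q => w a • w' q • f c ⊗ₜ[K] f p) (by fun_prop) d]
    refine sw_congr fun p q => sw_congr fun r s => ?_
    simp only [smul_sw, smul_smul]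
    refine sw_congr fun t u => ?_
    congr 1
    ring
  · have h : Y.counit ∘ₗ X.convL w (X.convR f w') = X.counit := by
      rw [comp_convL, comp_convR, hf.counit, convR_eq_convL, hX.counit_convL, hw.1]
    exact LinearMap.congr_fun h x

end Twisting

/-! ### Face maps of tensor powers and the pentagon for coboundaries. -/

section GaugeTwist

/-- Functionals living on different tensor factors commute: both products are `x ⊗ y ↦ f x * g y`.
The pentagon needs no other commutation. -/
theorem convL_drop_comm {K C D : Type*} [Field K] [AddCommGroup C] [Module K C] [AddCommGroup D]
    [Module K D] {X : CoalgData K C} {Y : CoalgData K D} (hX : X.IsCoalgebra) (hY : Y.IsCoalgebra)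
    (f : C →ₗ[K] K) (g : D →ₗ[K] K) :
    (X.tensor Y).convL (g ∘ₗ X.dropLeft D) (f ∘ₗ Y.dropRight C) =
      (X.tensor Y).convL (f ∘ₗ Y.dropRight C) (g ∘ₗ X.dropLeft D) := by
  refine TensorProduct.ext' fun x y => ?_
  simp (disch := fun_prop) only [convL_apply, tensor_comul_tmul, LinearMap.comp_apply,
    dropLeft_tmul, dropRight_tmul, map_smul, sw_sw, sw_tmul, smul_assoc, smul_comm _ (Y.counit _),
    ← smul_sw, hX.sw_counit_left, hY.sw_counit_left, hX.sw_counit_right, hY.sw_counit_right]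
  simp only [smul_comm (f _) (X.counit _)]
  rw [hX.sw_counit_right (by fun_prop), smul_eq_mul, smul_eq_mul, mul_comm]

variable {K : Type*} [Field K] {D : Type*} [AddCommGroup D] [Module K D]

namespace MulCoalgData

variable (E : MulCoalgData K D)

/-- The coalgebra `D ⊗ D`. -/
abbrev X₂ : CoalgData K (D ⊗[K] D) := E.tensor E.toCoalgData

/-- The coalgebra `D ⊗ D ⊗ D`. -/
abbrev X₃ : CoalgData K (D ⊗[K] D ⊗[K] D) := E.X₂.tensor E.toCoalgData

/-- The coalgebra `D ⊗ D ⊗ D ⊗ D`. -/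
abbrev X₄ : CoalgData K (D ⊗[K] D ⊗[K] D ⊗[K] D) := E.X₃.tensor E.toCoalgData

/-- `x ⊗ y ⊗ z ↦ ε(x) y ⊗ z`. -/
def drop₁ : D ⊗[K] D ⊗[K] D →ₗ[K] D ⊗[K] D :=
  E.dropLeft (D ⊗[K] D) ∘ₗ (TensorProduct.assoc K D D D).toLinearMap

/-- `x ⊗ y ⊗ z ↦ x ⊗ y ε(z)`. -/
def drop₃ : D ⊗[K] D ⊗[K] D →ₗ[K] D ⊗[K] D := E.dropRight (D ⊗[K] D)

/-- `x ⊗ y ⊗ z ↦ x ⊗ y z`. -/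
def mul₂₃ : D ⊗[K] D ⊗[K] D →ₗ[K] D ⊗[K] D :=
  E.mul.lTensor D ∘ₗ (TensorProduct.assoc K D D D).toLinearMap

/-- `x ⊗ y ⊗ z ↦ x y ⊗ z`. -/
def mul₁₂ : D ⊗[K] D ⊗[K] D →ₗ[K] D ⊗[K] D := E.mul.rTensor D

/-- `x ⊗ y ⊗ z ⊗ t ↦ ε(x) y ⊗ z ⊗ t`. -/
def tail₄ : D ⊗[K] D ⊗[K] D ⊗[K] D →ₗ[K] D ⊗[K] D ⊗[K] D :=
  E.dropLeft (D ⊗[K] D ⊗[K] D) ∘ₗ (TensorProduct.assoc K D (D ⊗[K] D) D).toLinearMap ∘ₗ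
    (TensorProduct.assoc K D D D).toLinearMap.rTensor D

/-- `x ⊗ y ⊗ z ⊗ t ↦ x ⊗ y ⊗ z ε(t)`. -/
def init₄ : D ⊗[K] D ⊗[K] D ⊗[K] D →ₗ[K] D ⊗[K] D ⊗[K] D := E.dropRight (D ⊗[K] D ⊗[K] D)

/-- `x ⊗ y ⊗ z ⊗ t ↦ x ⊗ y ⊗ z t`. -/
def mulLast₄ : D ⊗[K] D ⊗[K] D ⊗[K] D →ₗ[K] D ⊗[K] D ⊗[K] D :=
  E.mul.lTensor (D ⊗[K] D) ∘ₗ (TensorProduct.assoc K (D ⊗[K] D) D D).toLinearMap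

/-- `x ⊗ y ⊗ z ⊗ t ↦ x y ⊗ z ⊗ t`. -/
def mulFirst₄ : D ⊗[K] D ⊗[K] D ⊗[K] D →ₗ[K] D ⊗[K] D ⊗[K] D := (E.mul.rTensor D).rTensor D

/-- `x ⊗ y ⊗ z ⊗ t ↦ x ⊗ y z ⊗ t`. -/
def mulMid₄ : D ⊗[K] D ⊗[K] D ⊗[K] D →ₗ[K] D ⊗[K] D ⊗[K] D :=
  (E.mul.lTensor D ∘ₗ (TensorProduct.assoc K D D D).toLinearMap).rTensor D

/-- `x ⊗ y ⊗ z ⊗ t ↦ ε(x) ε(y) z ⊗ t`. -/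
def last₄ : D ⊗[K] D ⊗[K] D ⊗[K] D →ₗ[K] D ⊗[K] D :=
  E.X₂.dropLeft (D ⊗[K] D) ∘ₗ (TensorProduct.assoc K (D ⊗[K] D) D D).toLinearMap

variable {E}

theorem coboundary₂_eq (w : D ⊗[K] D →ₗ[K] K) :
    E.coboundary₂ w = E.X₃.convL (w ∘ₗ E.drop₁) (E.X₃.convL (w ∘ₗ E.mul₂₃)
      (E.X₃.convL (E.X₂.convInv w ∘ₗ E.mul₁₂) (E.X₂.convInv w ∘ₗ E.drop₃))) := by
  rw [coboundary₂, funcTensor_counit_left, funcTensor_counit_right]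
  rfl

namespace IsUnitalMulCoalgebra

variable (hE : E.IsUnitalMulCoalgebra)
include hE

theorem isCoalgebra₂ : E.X₂.IsCoalgebra := tensor_isCoalgebra hE.isCoalgebra hE.isCoalgebra

theorem isCoalgebra₃ : E.X₃.IsCoalgebra := tensor_isCoalgebra hE.isCoalgebra₂ hE.isCoalgebra

theorem isCoalgebra₄ : E.X₄.IsCoalgebra := tensor_isCoalgebra hE.isCoalgebra₃ hE.isCoalgebra

theorem drop₁_hom : IsCoalgHom E.X₃ E.X₂ E.drop₁ :=
  (IsCoalgHom.dropLeft hE.isCoalgebra E.X₂).comp .assoc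

theorem drop₃_hom : IsCoalgHom E.X₃ E.X₂ E.drop₃ := IsCoalgHom.dropRight hE.isCoalgebra E.X₂

theorem mul₂₃_hom : IsCoalgHom E.X₃ E.X₂ E.mul₂₃ :=
  (hE.mul_hom.lTensor E.toCoalgData).comp .assoc

theorem mul₁₂_hom : IsCoalgHom E.X₃ E.X₂ E.mul₁₂ := hE.mul_hom.rTensor E.toCoalgData

theorem tail₄_hom : IsCoalgHom E.X₄ E.X₃ E.tail₄ :=
  (IsCoalgHom.dropLeft hE.isCoalgebra E.X₃).comp (IsCoalgHom.assoc.comp (IsCoalgHom.assoc.rTensor _))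

theorem init₄_hom : IsCoalgHom E.X₄ E.X₃ E.init₄ := IsCoalgHom.dropRight hE.isCoalgebra E.X₃

theorem mulLast₄_hom : IsCoalgHom E.X₄ E.X₃ E.mulLast₄ := (hE.mul_hom.lTensor E.X₂).comp .assoc

theorem mulFirst₄_hom : IsCoalgHom E.X₄ E.X₃ E.mulFirst₄ :=
  (hE.mul_hom.rTensor E.toCoalgData).rTensor E.toCoalgData

theorem mulMid₄_hom : IsCoalgHom E.X₄ E.X₃ E.mulMid₄ := hE.mul₂₃_hom.rTensor E.toCoalgData

theorem last₄_hom : IsCoalgHom E.X₄ E.X₂ E.last₄ :=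
  (IsCoalgHom.dropLeft hE.isCoalgebra₂ E.X₂).comp .assoc

theorem counit_mul (x y : D) : E.counit (E.mul (x ⊗ₜ y)) = E.counit x * E.counit y :=
  LinearMap.congr_fun hE.mul_hom.counit (x ⊗ₜ y)

end IsUnitalMulCoalgebra

theorem IsBialgebra.mul_mul (hE : E.IsBialgebra) (x y z : D) :
    E.mul (E.mul (x ⊗ₜ y) ⊗ₜ z) = E.mul (x ⊗ₜ E.mul (y ⊗ₜ z)) :=
  LinearMap.congr_fun hE.mul_assoc (x ⊗ₜ y ⊗ₜ z)

variable {w w' : D ⊗[K] D →ₗ[K] K}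

/-- The unit of the convolution monoid of `D ⊗ D ⊗ D ⊗ D` obtained by pulling back `w`. -/
def pullUnit (hE : E.IsUnitalMulCoalgebra) (hw : E.X₂.IsConvInverse w w')
    {φ : D ⊗[K] D ⊗[K] D ⊗[K] D →ₗ[K] D ⊗[K] D} (hφ : IsCoalgHom E.X₄ E.X₂ φ) :
    (ConvDual E.X₄ hE.isCoalgebra₄)ˣ := (hw.comp hφ).unit hE.isCoalgebra₄

theorem pullUnit_congr (hE : E.IsUnitalMulCoalgebra) (hw : E.X₂.IsConvInverse w w')
    {φ ψ : D ⊗[K] D ⊗[K] D ⊗[K] D →ₗ[K] D ⊗[K] D} (hφ : IsCoalgHom E.X₄ E.X₂ φ)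
    (hψ : IsCoalgHom E.X₄ E.X₂ ψ) (h : ∀ x y z t, φ (x ⊗ₜ y ⊗ₜ z ⊗ₜ t) = ψ (x ⊗ₜ y ⊗ₜ z ⊗ₜ t)) :
    pullUnit hE hw hφ = pullUnit hE hw hψ := by
  have : φ = ψ := TensorProduct.ext_fourfold h
  subst this
  rfl

/-- The coboundary pulled back to `D ⊗ D ⊗ D ⊗ D`, as a unit of the convolution monoid. -/
def pullCob (hE : E.IsUnitalMulCoalgebra) (hw : E.X₂.IsConvInverse w w')
    {θ : D ⊗[K] D ⊗[K] D ⊗[K] D →ₗ[K] D ⊗[K] D ⊗[K] D} (hθ : IsCoalgHom E.X₄ E.X₃ θ) :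
    (ConvDual E.X₄ hE.isCoalgebra₄)ˣ :=
  pullUnit hE hw (hE.drop₁_hom.comp hθ) * (pullUnit hE hw (hE.mul₂₃_hom.comp hθ) *
    ((pullUnit hE hw (hE.mul₁₂_hom.comp hθ))⁻¹ * (pullUnit hE hw (hE.drop₃_hom.comp hθ))⁻¹))

theorem pullCob_val (hE : E.IsUnitalMulCoalgebra) (hw : E.X₂.IsConvInverse w w')
    {θ : D ⊗[K] D ⊗[K] D ⊗[K] D →ₗ[K] D ⊗[K] D ⊗[K] D} (hθ : IsCoalgHom E.X₄ E.X₃ θ) :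
    E.coboundary₂ w ∘ₗ θ = (pullCob hE hw hθ).val.val := by
  rw [coboundary₂_eq, hw.convInv_eq hE.isCoalgebra₂, hθ.convL_comp, hθ.convL_comp, hθ.convL_comp]
  rfl

/-- The pentagon identity for coboundaries. -/
theorem pullCob_pentagon (hE : E.IsBialgebra) (hw : E.X₂.IsConvInverse w w') :
    let h := hE.toIsUnitalMulCoalgebra
    let u := pullUnit h hw h.last₄_hom
    let v := pullUnit h hw (h.drop₃_hom.comp h.init₄_hom)
    let y := pullUnit h hw (h.drop₁_hom.comp h.init₄_hom)
    (u * pullCob h hw h.mulLast₄_hom * u⁻¹) * (v * pullCob h hw h.mulFirst₄_hom * v⁻¹) =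
      pullCob h hw h.tail₄_hom * ((y * pullCob h hw h.mulMid₄_hom * y⁻¹) *
        pullCob h hw h.init₄_hom) := by
  intro h u v y
  -- The equations `e₁` to `e₁₁` are the simplicial identities between composites of the face maps
  -- `drop` and `mul`. Associativity of the product enters only in `e₆` and `e₇`.
  have e₁ : pullUnit h hw (h.drop₃_hom.comp h.mulLast₄_hom) = v := pullUnit_congr _ _ _ _
    fun x y z t => by
      simp [drop₃, mulLast₄, init₄, dropRight_tmul, h.counit_mul, smul_smul, mul_comm]
  have e₂ : pullUnit h hw (h.drop₁_hom.comp h.mulFirst₄_hom) = u := pullUnit_congr _ _ _ _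
    fun x y z t => by
      simp [drop₁, mulFirst₄, last₄, dropLeft_tmul, h.counit_mul, tensor_counit_tmul]
  have e₃ : pullUnit h hw (h.mul₂₃_hom.comp h.mulFirst₄_hom) =
      pullUnit h hw (h.mul₁₂_hom.comp h.mulLast₄_hom) := pullUnit_congr _ _ _ _
    fun x y z t => by
      simp [mul₂₃, mul₁₂, mulFirst₄, mulLast₄]
  have e₄ : pullUnit h hw (h.drop₃_hom.comp h.mulFirst₄_hom) =
      pullUnit h hw (h.mul₁₂_hom.comp h.init₄_hom) := pullUnit_congr _ _ _ _
    fun x y z t => by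
      simp [drop₃, mul₁₂, mulFirst₄, init₄, dropRight_tmul, ← TensorProduct.smul_tmul']
  have e₅ : pullUnit h hw (h.drop₁_hom.comp h.mulMid₄_hom) =
      pullUnit h hw (h.mul₁₂_hom.comp h.tail₄_hom) := pullUnit_congr _ _ _ _
    fun x y z t => by
      simp [drop₁, mul₁₂, mulMid₄, tail₄, dropLeft_tmul, ← TensorProduct.smul_tmul']
  have e₆ : pullUnit h hw (h.mul₂₃_hom.comp h.mulMid₄_hom) =
      pullUnit h hw (h.mul₂₃_hom.comp h.mulLast₄_hom) := pullUnit_congr _ _ _ _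
    fun x y z t => by
      simp [mul₂₃, mulMid₄, mulLast₄, hE.mul_mul]
  have e₇ : pullUnit h hw (h.mul₁₂_hom.comp h.mulMid₄_hom) =
      pullUnit h hw (h.mul₁₂_hom.comp h.mulFirst₄_hom) := pullUnit_congr _ _ _ _
    fun x y z t => by
      simp [mul₁₂, mulMid₄, mulFirst₄, hE.mul_mul]
  have e₈ : pullUnit h hw (h.drop₃_hom.comp h.mulMid₄_hom) =
      pullUnit h hw (h.mul₂₃_hom.comp h.init₄_hom) := pullUnit_congr _ _ _ _
    fun x y z t => by
      simp [drop₃, mul₂₃, mulMid₄, init₄, dropRight_tmul]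
  have e₉ : pullUnit h hw (h.drop₁_hom.comp h.tail₄_hom) = u := pullUnit_congr _ _ _ _
    fun x y z t => by
      simp [drop₁, tail₄, last₄, dropLeft_tmul, tensor_counit_tmul, smul_smul]
  have e₁₀ : pullUnit h hw (h.mul₂₃_hom.comp h.tail₄_hom) =
      pullUnit h hw (h.drop₁_hom.comp h.mulLast₄_hom) := pullUnit_congr _ _ _ _
    fun x y z t => by
      simp [mul₂₃, tail₄, drop₁, mulLast₄, dropLeft_tmul]
  have e₁₁ : pullUnit h hw (h.drop₃_hom.comp h.tail₄_hom) = y := pullUnit_congr _ _ _ _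
    fun x y z t => by
      simp [drop₃, tail₄, drop₁, init₄, dropLeft_tmul, dropRight_tmul, smul_smul, mul_comm]
  have comm : u * v = v * u := by
    have e : v = pullUnit h hw ((IsCoalgHom.dropRight h.isCoalgebra₂ E.X₂).comp
        (IsCoalgHom.assoc (X := E.X₂) (Y := E.toCoalgData) (Z := E.toCoalgData))) :=
      pullUnit_congr _ _ _ _ fun x y z t => by
        simp [drop₃, init₄, dropRight_tmul, tensor_counit_tmul, smul_smul, mul_comm]
    refine Units.ext (congrArg ConvDual.mk ?_)
    rw [e]
    change E.X₄.convL (w ∘ₗ E.X₂.dropLeft _ ∘ₗ _) (w ∘ₗ E.X₂.dropRight _ ∘ₗ _) =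
      E.X₄.convL (w ∘ₗ E.X₂.dropRight _ ∘ₗ _) (w ∘ₗ E.X₂.dropLeft _ ∘ₗ _)
    simp only [← LinearMap.comp_assoc]
    rw [← IsCoalgHom.assoc.convL_comp, ← IsCoalgHom.assoc.convL_comp,
      convL_drop_comm h.isCoalgebra₂ h.isCoalgebra₂]
  -- The conjugations by `u` and `v` meet in the commutator of two functionals on disjoint legs.
  -- Once it disappears, adjacent factors cancel in pairs.
  have cancel (g) : v⁻¹ * (u⁻¹ * (v * (u * g))) = g := by
    rw [← mul_assoc v u, ← comm]
    group
  have e₁₂ : pullUnit h hw (h.drop₁_hom.comp h.init₄_hom) = y := rfl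
  have e₁₃ : pullUnit h hw (h.drop₃_hom.comp h.init₄_hom) = v := rfl
  simp only [pullCob, e₁, e₂, e₃, e₄, e₅, e₆, e₇, e₈, e₉, e₁₀, e₁₁, e₁₂, e₁₃]
  simp only [mul_assoc, cancel, inv_mul_cancel_left, mul_inv_cancel, mul_one]

end MulCoalgData
end GaugeTwist

/-! ### Twisting a bialgebra by a gauge transformation. -/

section TwistTheorem

variable {K : Type*} [Field K] {D : Type*} [AddCommGroup D] [Module K D]

namespace MulCoalgData

variable {E : MulCoalgData K D} {w w' : D ⊗[K] D →ₗ[K] K}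

theorem twist_reassoc (hE : E.IsUnitalMulCoalgebra) :
    (E.withTrivialReassoc.twist w).reassoc = E.coboundary₂ w := by
  have h : (E.withTrivialReassoc.twist w).reassoc =
      E.X₃.convL (funcTensor E.counit w ∘ₗ (TensorProduct.assoc K D D D).toLinearMap)
        (E.X₃.convL (w ∘ₗ E.mul.lTensor D ∘ₗ (TensorProduct.assoc K D D D).toLinearMap)
          (E.X₃.convL E.X₃.counit
            (E.X₃.convL (E.X₂.convInv w ∘ₗ E.mul.rTensor D)
              (funcTensor (E.X₂.convInv w) E.counit)))) := rfl
  rw [h, hE.isCoalgebra₃.counit_convL]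
  rfl

/-- The twisted multiplication. -/
abbrev mulTwist (E : MulCoalgData K D) (w w' : D ⊗[K] D →ₗ[K] K) : D ⊗[K] D →ₗ[K] D :=
  E.X₂.convL w (E.X₂.convR E.mul w')

/-- Insertion of the grouplike unit is a coalgebra map that pulls `w` back to `ε`. Uniqueness of
inverses then forces `w'` to pull back to `ε` as well. -/
theorem isConvInverse_unital_left (hE : E.IsUnitalMulCoalgebra) (hw : E.X₂.IsConvInverse w w')
    (h : ∀ x, w (E.one ⊗ₜ x) = E.counit x) (x : D) : w' (E.one ⊗ₜ x) = E.counit x := by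
  have hi := IsCoalgHom.mk_left hE.comul_one hE.counit_one E.toCoalgData
  have e : w ∘ₗ TensorProduct.mk K D D E.one = E.counit := LinearMap.ext h
  have := hw.comp hi
  rw [e] at this
  exact LinearMap.congr_fun (this.unique hE.isCoalgebra
    ⟨hE.isCoalgebra.counit_convL _, hE.isCoalgebra.counit_convL _⟩) x

theorem isConvInverse_unital_right (hE : E.IsUnitalMulCoalgebra) (hw : E.X₂.IsConvInverse w w')
    (h : ∀ x, w (x ⊗ₜ E.one) = E.counit x) (x : D) : w' (x ⊗ₜ E.one) = E.counit x := by
  have hi := IsCoalgHom.mk_right hE.comul_one hE.counit_one E.toCoalgData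
  have e : w ∘ₗ (TensorProduct.mk K D D).flip E.one = E.counit := LinearMap.ext h
  have := hw.comp hi
  rw [e] at this
  exact LinearMap.congr_fun (this.unique hE.isCoalgebra
    ⟨hE.isCoalgebra.counit_convL _, hE.isCoalgebra.counit_convL _⟩) x

/-- A convolution conjugate restricted along a coalgebra map on which the conjugating functional is
trivial. -/
theorem _root_.IsCoalgHom.conj_comp {B M : Type*} [AddCommGroup B] [Module K B] [AddCommGroup M]
    [Module K M] {C : Type*} [AddCommGroup C] [Module K C] {X : CoalgData K C} {Y : CoalgData K B}
    (hY : Y.IsCoalgebra) {i : B →ₗ[K] C} (hi : IsCoalgHom Y X i)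
    {w w' : C →ₗ[K] K} (h : w ∘ₗ i = Y.counit) (h' : w' ∘ₗ i = Y.counit) (f : C →ₗ[K] M) :
    X.convL w (X.convR f w') ∘ₗ i = f ∘ₗ i := by
  rw [hi.convL_comp, hi.convR_comp, h, h', hY.counit_convL, hY.convR_counit]

theorem mulTwist_isUnital (hE : E.IsUnitalMulCoalgebra) (hg : E.IsGaugeTransformation w) :
    (E.withTrivialReassoc.twist w).IsUnitalMulCoalgebra where
  isCoalgebra := hE.isCoalgebra
  mul_hom := hE.mul_hom.conj hE.isCoalgebra₂ hg.invertible.isConvInverse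
  comul_one := hE.comul_one
  counit_one := hE.counit_one
  one_mul x := by
    have h := (IsCoalgHom.mk_left hE.comul_one hE.counit_one E.toCoalgData).conj_comp hE.isCoalgebra
      (LinearMap.ext hg.unital_left)
      (LinearMap.ext (isConvInverse_unital_left hE hg.invertible.isConvInverse hg.unital_left)) E.mul
    exact (LinearMap.congr_fun h x).trans (hE.one_mul x)
  mul_one x := by
    have h := (IsCoalgHom.mk_right hE.comul_one hE.counit_one E.toCoalgData).conj_comp
      hE.isCoalgebra (LinearMap.ext hg.unital_right) (LinearMap.ext
        (isConvInverse_unital_right hE hg.invertible.isConvInverse hg.unital_right)) E.mul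
    exact (LinearMap.congr_fun h x).trans (hE.mul_one x)

theorem coboundary₂_comp (hE : E.IsUnitalMulCoalgebra) (hw : E.X₂.IsConvInverse w w')
    {B : Type*} [AddCommGroup B] [Module K B] {Y : CoalgData K B}
    {i : B →ₗ[K] D ⊗[K] D ⊗[K] D} (hi : IsCoalgHom Y E.X₃ i) :
    E.coboundary₂ w ∘ₗ i = Y.convL (w ∘ₗ E.drop₁ ∘ₗ i) (Y.convL (w ∘ₗ E.mul₂₃ ∘ₗ i)
      (Y.convL (w' ∘ₗ E.mul₁₂ ∘ₗ i) (w' ∘ₗ E.drop₃ ∘ₗ i))) := by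
  rw [coboundary₂_eq, hw.convInv_eq hE.isCoalgebra₂, hi.convL_comp, hi.convL_comp, hi.convL_comp]
  rfl

/-- A unit in any one slot makes two of the four factors of the coboundary trivial and leaves `w *
w⁻¹`. The three positions of the unit differ only in which two factors survive. -/
theorem coboundary₂_unital_left (hE : E.IsUnitalMulCoalgebra) (hg : E.IsGaugeTransformation w)
    (x y : D) : E.coboundary₂ w (E.one ⊗ₜ x ⊗ₜ y) = E.counit x * E.counit y := by
  have hw := hg.invertible.isConvInverse
  have h₂ := hE.isCoalgebra₂
  have hl := isConvInverse_unital_left hE hw hg.unital_left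
  let i : D ⊗[K] D →ₗ[K] D ⊗[K] D ⊗[K] D := (TensorProduct.mk K D D E.one).rTensor D
  have hi : IsCoalgHom E.X₂ E.X₃ i :=
    (IsCoalgHom.mk_left hE.comul_one hE.counit_one _).rTensor _
  have e₁ : w ∘ₗ E.drop₁ ∘ₗ i = w := TensorProduct.ext' fun x y => by
    simp [i, drop₁, dropLeft_tmul, hE.counit_one]
  have e₂ : w ∘ₗ E.mul₂₃ ∘ₗ i = E.X₂.counit := TensorProduct.ext' fun x y => by
    simp [i, mul₂₃, hg.unital_left, tensor_counit_tmul, hE.counit_mul]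
  have e₃ : E.X₂.convInv w ∘ₗ E.mul₁₂ ∘ₗ i = E.X₂.convInv w := TensorProduct.ext' fun x y => by
    simp [i, mul₁₂, hE.one_mul]
  have e₄ : E.X₂.convInv w ∘ₗ E.drop₃ ∘ₗ i = E.X₂.counit := TensorProduct.ext' fun x y => by
    simp [i, drop₃, dropRight_tmul, hl, tensor_counit_tmul, mul_comm]
  have h := coboundary₂_comp hE hw hi
  rw [e₁, e₂, e₃, e₄, h₂.counit_convL, ← convR_eq_convL _ E.X₂.counit, h₂.convR_counit, hw.1] at h
  exact LinearMap.congr_fun h (x ⊗ₜ y)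

theorem coboundary₂_unital_mid (hE : E.IsUnitalMulCoalgebra) (hg : E.IsGaugeTransformation w)
    (x y : D) : E.coboundary₂ w (x ⊗ₜ E.one ⊗ₜ y) = E.counit x * E.counit y := by
  have hw := hg.invertible.isConvInverse
  have h₂ := hE.isCoalgebra₂
  have hr := isConvInverse_unital_right hE hw hg.unital_right
  let i : D ⊗[K] D →ₗ[K] D ⊗[K] D ⊗[K] D := ((TensorProduct.mk K D D).flip E.one).rTensor D
  have hi : IsCoalgHom E.X₂ E.X₃ i :=
    (IsCoalgHom.mk_right hE.comul_one hE.counit_one _).rTensor _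
  have e₁ : w ∘ₗ E.drop₁ ∘ₗ i = E.X₂.counit := TensorProduct.ext' fun x y => by
    simp [i, drop₁, dropLeft_tmul, hg.unital_left, tensor_counit_tmul]
  have e₂ : w ∘ₗ E.mul₂₃ ∘ₗ i = w := TensorProduct.ext' fun x y => by
    simp [i, mul₂₃, hE.one_mul]
  have e₃ : E.X₂.convInv w ∘ₗ E.mul₁₂ ∘ₗ i = E.X₂.convInv w := TensorProduct.ext' fun x y => by
    simp [i, mul₁₂, hE.mul_one]
  have e₄ : E.X₂.convInv w ∘ₗ E.drop₃ ∘ₗ i = E.X₂.counit := TensorProduct.ext' fun x y => by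
    simp [i, drop₃, dropRight_tmul, hr, tensor_counit_tmul, mul_comm]
  have h := coboundary₂_comp hE hw hi
  rw [e₁, e₂, e₃, e₄, h₂.counit_convL, ← convR_eq_convL _ E.X₂.counit, h₂.convR_counit, hw.1] at h
  exact LinearMap.congr_fun h (x ⊗ₜ y)

theorem coboundary₂_unital_right (hE : E.IsUnitalMulCoalgebra) (hg : E.IsGaugeTransformation w)
    (x y : D) : E.coboundary₂ w (x ⊗ₜ y ⊗ₜ E.one) = E.counit x * E.counit y := by
  have hw := hg.invertible.isConvInverse
  have h₂ := hE.isCoalgebra₂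
  have hr := isConvInverse_unital_right hE hw hg.unital_right
  let i : D ⊗[K] D →ₗ[K] D ⊗[K] D ⊗[K] D := (TensorProduct.mk K (D ⊗[K] D) D).flip E.one
  have hi : IsCoalgHom E.X₂ E.X₃ i := IsCoalgHom.mk_right hE.comul_one hE.counit_one _
  have e₁ : w ∘ₗ E.drop₁ ∘ₗ i = E.X₂.counit := TensorProduct.ext' fun x y => by
    simp [i, drop₁, dropLeft_tmul, hg.unital_right, tensor_counit_tmul]
  have e₂ : w ∘ₗ E.mul₂₃ ∘ₗ i = w := TensorProduct.ext' fun x y => by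
    simp [i, mul₂₃, hE.mul_one]
  have e₃ : E.X₂.convInv w ∘ₗ E.mul₁₂ ∘ₗ i = E.X₂.counit := TensorProduct.ext' fun x y => by
    simp [i, mul₁₂, hr, hE.counit_mul, tensor_counit_tmul]
  have e₄ : E.X₂.convInv w ∘ₗ E.drop₃ ∘ₗ i = E.X₂.convInv w := TensorProduct.ext' fun x y => by
    simp [i, drop₃, dropRight_tmul, hE.counit_one]
  have h := coboundary₂_comp hE hw hi
  rw [e₁, e₂, e₃, e₄, h₂.counit_convL, h₂.counit_convL, hw.1] at h
  exact LinearMap.congr_fun h (x ⊗ₜ y)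

theorem coboundary₂_isConvInvertible (hE : E.IsUnitalMulCoalgebra)
    (hw : E.X₂.IsConvInvertible w) : E.X₃.IsConvInvertible (E.coboundary₂ w) := by
  have hw := hw.isConvInverse
  have h₃ := hE.isCoalgebra₃
  rw [coboundary₂_eq]
  exact ⟨_, (hw.comp hE.drop₁_hom).mul h₃ <| (hw.comp hE.mul₂₃_hom).mul h₃ <|
    (hw.symm.comp hE.mul₁₂_hom).mul h₃ (hw.symm.comp hE.drop₃_hom)⟩

end MulCoalgData

/-- The two-sided action `a * F * b` of the convolution monoid on linear maps. -/
def ConvDual.sandwich {C M : Type*} [AddCommGroup C] [Module K C] [AddCommGroup M] [Module K M]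
    {X : CoalgData K C} {hX : X.IsCoalgebra} (a b : ConvDual X hX) (F : C →ₗ[K] M) : C →ₗ[K] M :=
  X.convL a.val (X.convR F b.val)

namespace ConvDual

variable {C M N : Type*} [AddCommGroup C] [Module K C] [AddCommGroup M] [Module K M]
  [AddCommGroup N] [Module K N] {X : CoalgData K C} {hX : X.IsCoalgebra}

theorem convL_sandwich (c a b : ConvDual X hX) (F : C →ₗ[K] M) :
    X.convL c.val (sandwich a b F) = sandwich (c * a) b F :=
  hX.convL_convL _ _ _

theorem convR_sandwich (a b c : ConvDual X hX) (F : C →ₗ[K] M) :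
    X.convR (sandwich a b F) c.val = sandwich a (b * c) F := by
  rw [sandwich, ← hX.convL_convR, hX.convR_convR]
  rfl

theorem sandwich_sandwich (a b c d : ConvDual X hX) (F : C →ₗ[K] M) :
    sandwich a b (sandwich c d F) = sandwich (a * c) (d * b) F := by
  rw [← convL_sandwich, ← convR_sandwich]
  rfl

theorem comp_sandwich (ψ : M →ₗ[K] N) (a b : ConvDual X hX) (F : C →ₗ[K] M) :
    ψ ∘ₗ sandwich a b F = sandwich a b (ψ ∘ₗ F) := by
  rw [sandwich, comp_convL, comp_convR]
  rfl

theorem functional_comp_sandwich (ψ : M →ₗ[K] K) (a b : ConvDual X hX) (F : C →ₗ[K] M) :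
    ψ ∘ₗ sandwich a b F = sandwich a b (ψ ∘ₗ F) := by
  rw [sandwich, comp_convL, comp_convR]
  rfl

theorem sandwich_eq_mul (a b f : ConvDual X hX) : sandwich a b f.val = (a * f * b).val := by
  rw [sandwich, convR_eq_convL, hX.convL_convL]
  rfl

end ConvDual

namespace MulCoalgData

variable {E : MulCoalgData K D} {w w' : D ⊗[K] D →ₗ[K] K}

/-- By associativity both iterated twisted products are sandwiches of the same map `E.mul ∘ₗ
E.mul₁₂`. What remains is a cancellation between the units `a`, `b`, `c`, `d`, the pullbacks of `w`
along the four face maps. -/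
theorem twist_quasi_assoc (hE : E.IsBialgebra) (hw : E.X₂.IsConvInverse w w') :
    E.X₃.convR (E.mulTwist w w' ∘ₗ (E.mulTwist w w').lTensor D ∘ₗ
      (TensorProduct.assoc K D D D).toLinearMap) (E.coboundary₂ w) =
    E.X₃.convL (E.coboundary₂ w) (E.mulTwist w w' ∘ₗ (E.mulTwist w w').rTensor D) := by
  have h := hE.toIsUnitalMulCoalgebra
  have h₁ := hE.isCoalgebra
  let a := (hw.comp h.drop₁_hom).unit h.isCoalgebra₃
  let b := (hw.comp h.mul₂₃_hom).unit h.isCoalgebra₃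
  let c := (hw.comp h.mul₁₂_hom).unit h.isCoalgebra₃
  let d := (hw.comp h.drop₃_hom).unit h.isCoalgebra₃
  have hcob : E.coboundary₂ w = (a * (b * (c⁻¹ * d⁻¹))).val.val := by
    rw [coboundary₂_eq, hw.convInv_eq h.isCoalgebra₂]
    rfl
  have hm : E.mul ∘ₗ E.mul₂₃ = E.mul ∘ₗ E.mul₁₂ := hE.mul_assoc.symm
  have h₂₃ : E.mulTwist w w' ∘ₗ E.mul₂₃ = ConvDual.sandwich b.val b⁻¹.val (E.mul ∘ₗ E.mul₁₂) := by
    rw [← hm, mulTwist, h.mul₂₃_hom.convL_comp, h.mul₂₃_hom.convR_comp]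
    rfl
  have h₁₂ : E.mulTwist w w' ∘ₗ E.mul₁₂ = ConvDual.sandwich c.val c⁻¹.val (E.mul ∘ₗ E.mul₁₂) := by
    rw [mulTwist, h.mul₁₂_hom.convL_comp, h.mul₁₂_hom.convR_comp]
    rfl
  have hl : (E.mulTwist w w').lTensor D ∘ₗ (TensorProduct.assoc K D D D).toLinearMap =
      ConvDual.sandwich a.val a⁻¹.val E.mul₂₃ := by
    rw [mulTwist, convL_lTensor h₁, convR_lTensor h₁, IsCoalgHom.assoc.convL_comp,
      IsCoalgHom.assoc.convR_comp]
    rfl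
  have hr : (E.mulTwist w w').rTensor D = ConvDual.sandwich d.val d⁻¹.val E.mul₁₂ := by
    rw [mulTwist, convL_rTensor h₁, convR_rTensor h₁]
    rfl
  rw [hl, hr, ConvDual.comp_sandwich, ConvDual.comp_sandwich, h₂₃, h₁₂,
    ConvDual.sandwich_sandwich, ConvDual.sandwich_sandwich, hcob, ConvDual.convR_sandwich,
    ConvDual.convL_sandwich]
  simp only [← Units.val_mul, mul_assoc, inv_mul_cancel_left, inv_mul_cancel, mul_one]

/-- Putting the twisted product in a slot of `α` conjugates the corresponding pullback of `α` by the
pullback of `w` to the two legs being multiplied. These are the conjugations by `u`, `v`, `y` in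
`pullCob_pentagon`. -/
theorem twist_cocycle (hE : E.IsBialgebra) (hw : E.X₂.IsConvInverse w w') :
    let m := E.mulTwist w w'
    let α := E.coboundary₂ w
    E.X₄.convL (α ∘ₗ m.lTensor (D ⊗[K] D) ∘ₗ (TensorProduct.assoc K (D ⊗[K] D) D D).toLinearMap)
        (α ∘ₗ (m.rTensor D).rTensor D) =
      E.X₄.convL
        (funcTensor E.counit α ∘ₗ (TensorProduct.assoc K D (D ⊗[K] D) D).toLinearMap ∘ₗ
          (TensorProduct.assoc K D D D).toLinearMap.rTensor D)
        (E.X₄.convL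
          (α ∘ₗ (m.lTensor D ∘ₗ (TensorProduct.assoc K D D D).toLinearMap).rTensor D)
          (funcTensor α E.counit)) := by
  intro m α
  have h := hE.toIsUnitalMulCoalgebra
  have h₁ := hE.isCoalgebra
  let u := pullUnit h hw h.last₄_hom
  let v := pullUnit h hw (h.drop₃_hom.comp h.init₄_hom)
  let y := pullUnit h hw (h.drop₁_hom.comp h.init₄_hom)
  have hl : m.lTensor (D ⊗[K] D) ∘ₗ (TensorProduct.assoc K (D ⊗[K] D) D D).toLinearMap =
      ConvDual.sandwich u.val u⁻¹.val E.mulLast₄ := by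
    simp only [m]
    rw [mulTwist, convL_lTensor h.isCoalgebra₂, convR_lTensor h.isCoalgebra₂,
      IsCoalgHom.assoc.convL_comp, IsCoalgHom.assoc.convR_comp]
    rfl
  have hr : (m.rTensor D).rTensor D = ConvDual.sandwich v.val v⁻¹.val E.mulFirst₄ := by
    simp only [m]
    rw [mulTwist, convL_rTensor h₁, convR_rTensor h₁, convL_rTensor h₁, convR_rTensor h₁]
    rfl
  have hm : (m.lTensor D ∘ₗ (TensorProduct.assoc K D D D).toLinearMap).rTensor D =
      ConvDual.sandwich y.val y⁻¹.val E.mulMid₄ := by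
    simp only [m]
    rw [mulTwist, convL_lTensor h₁, convR_lTensor h₁, IsCoalgHom.assoc.convL_comp,
      IsCoalgHom.assoc.convR_comp, convL_rTensor h₁, convR_rTensor h₁]
    rfl
  have ht : funcTensor E.counit α ∘ₗ (TensorProduct.assoc K D (D ⊗[K] D) D).toLinearMap ∘ₗ
      (TensorProduct.assoc K D D D).toLinearMap.rTensor D = α ∘ₗ E.tail₄ := by
    rw [funcTensor_counit_left]
    rfl
  have hi : funcTensor α E.counit = α ∘ₗ E.init₄ := funcTensor_counit_right _
  have hs := ConvDual.functional_comp_sandwich (X := E.X₄) (hX := h.isCoalgebra₄)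
    (M := D ⊗[K] D ⊗[K] D) α
  rw [hl, hr, hm, ht, hi, hs, hs, hs,
    pullCob_val h hw h.mulLast₄_hom, pullCob_val h hw h.mulFirst₄_hom,
    pullCob_val h hw h.tail₄_hom, pullCob_val h hw h.mulMid₄_hom, pullCob_val h hw h.init₄_hom,
    ConvDual.sandwich_eq_mul, ConvDual.sandwich_eq_mul, ConvDual.sandwich_eq_mul]
  exact congrArg (fun x => x.val.val) (pullCob_pentagon hE hw)

theorem twist_reassocLaws (hE : E.IsBialgebra) (hg : E.IsGaugeTransformation w) :
    ReassocLaws E.counit E.X₃ E.X₄ (E.mulTwist w (E.X₂.convInv w)) E.one (E.coboundary₂ w) where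
  one_mul := (mulTwist_isUnital hE.toIsUnitalMulCoalgebra hg).one_mul
  mul_one := (mulTwist_isUnital hE.toIsUnitalMulCoalgebra hg).mul_one
  invertible := coboundary₂_isConvInvertible hE.toIsUnitalMulCoalgebra hg.invertible
  cocycle := twist_cocycle hE hg.invertible.isConvInverse
  unital_left := coboundary₂_unital_left hE.toIsUnitalMulCoalgebra hg
  unital_mid := coboundary₂_unital_mid hE.toIsUnitalMulCoalgebra hg
  unital_right := coboundary₂_unital_right hE.toIsUnitalMulCoalgebra hg
  quasi_assoc := twist_quasi_assoc hE hg.invertible.isConvInverse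

/-- The twist of a bialgebra by a gauge transformation is a dual quasi-bialgebra. -/
theorem twist_isDualQuasiBialgebra (hE : E.IsBialgebra) (hg : E.IsGaugeTransformation w) :
    (E.withTrivialReassoc.twist w).IsDualQuasiBialgebra where
  toIsUnitalMulCoalgebra := mulTwist_isUnital hE.toIsUnitalMulCoalgebra hg
  laws := by
    have h₁ : (E.withTrivialReassoc.twist w).toCoalgData = E.toCoalgData := rfl
    have h₂ : (E.withTrivialReassoc.twist w).mul = E.mulTwist w (E.X₂.convInv w) := rfl
    have h₃ : (E.withTrivialReassoc.twist w).one = E.one := rfl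
    rw [twist_reassoc hE.toIsUnitalMulCoalgebra, h₁, h₂, h₃]
    exact twist_reassocLaws hE hg

end MulCoalgData
end TwistTheorem

/-! ### From Yetter-Drinfeld coalgebras to antipode-free braided coalgebras. -/

section YetterDrinfeldCoalgebras

variable {K : Type*} [Field K]
variable {M V W H : Type*} [AddCommMonoid M] [Module K M] [AddCommGroup V] [Module K V]
  [AddCommGroup W] [Module K W] [Ring H] [HopfAlgebra K H]

theorem hopf_sw_antipode_left {F : H → M} (hF : Lin K F) (h : H) :
    sw (Coalgebra.comul (R := K) h) (fun a b => F (HopfAlgebra.antipode K a * b)) =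
      Coalgebra.counit (R := K) h • F 1 := by
  have e := congrArg F (LinearMap.congr_fun (HopfAlgebra.mul_antipode_rTensor_comul (R := K) (A := H)) h)
  let φ : H →ₗ[K] M := ⟨⟨F, hF.add⟩, hF.smul⟩
  change φ _ = φ _ at e
  change sw _ (fun a b => φ _) = _ • φ 1
  simpa (disch := fun_prop) only [LinearMap.comp_apply, rTensor_eq_sw, mul'_eq_sw, sw_sw, sw_tmul,
    map_sw, Algebra.linearMap_apply, Algebra.algebraMap_eq_smul_one, map_smul] using e

theorem YDData.actT_tmul (X : YDData K H V) (h : H) (v : V) : X.actT (h ⊗ₜ v) = X.act h v := by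
  simp [YDData.actT]

theorem YDData.tensor_act_tmul (X : YDData K H V) (Y : YDData K H W) (h : H) (v : V) (w : W) :
    (X.tensor Y).act h (v ⊗ₜ w) = sw (Coalgebra.comul (R := K) h) fun h₁ h₂ =>
      X.act h₁ v ⊗ₜ Y.act h₂ w := by
  have e : (X.tensor Y).act h = Module.endTensorEndAlgHom (R := K) (S := K) (A := K) (M := V) (N := W)
    (TensorProduct.map X.act.toLinearMap Y.act.toLinearMap (Coalgebra.comul (R := K) h)) := rfl
  rw [e, map_eq_sw, algHom_sw_apply]
  rfl

theorem YDData.tensor_actT (X : YDData K H V) (Y : YDData K H W) :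
    (X.tensor Y).actT = diagAct X.actT Y.actT := by
  refine TensorProduct.ext <| LinearMap.ext fun h => TensorProduct.ext' fun v w => ?_
  change (X.tensor Y).actT (h ⊗ₜ (v ⊗ₜ w)) = diagAct X.actT Y.actT (h ⊗ₜ (v ⊗ₜ w))
  simp only [actT_tmul, tensor_act_tmul, diagAct_tmul]

theorem YDData.actDiag_eq (X : YDData K H V) :
    X.actDiag = diagAct X.actT (LinearMap.mul' K H) := rfl

theorem YDData.ydAct_apply (X : YDData K H V) (h : H) (t : H ⊗[K] V) :
    X.ydAct h t = sw (Coalgebra.comul (R := K) h) fun a b => sw (Coalgebra.comul (R := K) b) fun c d =>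
      sw t fun k x => (a * (k * HopfAlgebra.antipode K d)) ⊗ₜ X.act c x := by
  have e₁ (f g : Module.End K (H ⊗[K] V)) : LinearMap.mul' K _ (f ⊗ₜ[K] g) t = f (g t) := rfl
  have e₂ (s : Module.End K (H ⊗[K] V) ⊗[K] Module.End K (H ⊗[K] V)) :
      LinearMap.mul' K _ s t = sw s fun f g => f (g t) := by
    conv_lhs => rw [← sw_self s, map_sw]
    simp [sw]
  have e₃ (s : Module.End K (H ⊗[K] V) ⊗[K] Module.End K (H ⊗[K] V)) :
      LinearMap.mul' K _ s = sw s fun f g => f * g := by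
    conv_lhs => rw [← sw_self s, map_sw]
    simp
  have e₄ (a : H) (u : H ⊗[K] V) : LinearMap.rTensorHom V (LinearMap.mul K H a) u =
      sw u fun k x => (a * k) ⊗ₜ x := rTensor_eq_sw _ _
  have e₅ (a : H) (u : H ⊗[K] V) : LinearMap.rTensorHom V ((LinearMap.mul K H).flip a) u =
      sw u fun k x => (k * a) ⊗ₜ x := rTensor_eq_sw _ _
  have e₆ (a : H) (u : H ⊗[K] V) : LinearMap.lTensorHom H (X.act a) u =
      sw u fun k x => k ⊗ₜ X.act a x := lTensor_eq_sw _ _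
  have e₇ (s : H ⊗[K] H) (G : H → H → Module.End K (H ⊗[K] V)) (u : H ⊗[K] V) :
    (sw s G) u = sw s fun a b => G a b u := by simp [sw]
  simp (disch := fun_prop) only [ydAct, LinearMap.comp_apply, map_eq_sw, e₂, sw_sw, sw_tmul]
  simp (disch := fun_prop) only [e₃, sw_sw, sw_tmul, e₇, Module.End.mul_apply, e₄, e₅, map_sw,
    AlgHom.toLinearMap_apply, e₆]

namespace YDCoalgData.IsYDCoalgebra

variable {X : YDCoalgData K H V}

theorem isModuleCoalgebra (hX : X.IsYDCoalgebra) : IsModuleCoalgebra X.toCoalgData X.actT where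
  isCoalgebra := hX.isCoalgebra
  one_act w := by simp [YDData.actT_tmul]
  mul_act g h w := by simp [YDData.actT_tmul]
  comul_act h w := by
    rw [YDData.actT_tmul, hX.comul_hom.linear]
    have e : ∀ t : V ⊗[K] V, (X.toYDData.tensor X.toYDData).act h t =
        sw t fun a b => (X.toYDData.tensor X.toYDData).act h (a ⊗ₜ b) := fun t => by
      rw [← map_sw, sw_self]
    refine (e _).trans ?_
    simp only [YDData.tensor_act_tmul, YDData.actT_tmul]
    rw [sw_comm]
  counit_act h w := by
    rw [YDData.actT_tmul, hX.counit_hom.linear]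
    rfl

theorem isComoduleCoalgebra (hX : X.IsYDCoalgebra) : IsComoduleCoalgebra X.toCoalgData X.coact where
  isCoalgebra := hX.isCoalgebra
  coassoc v := by
    have := LinearMap.congr_fun hX.isYDModule.coact_coassoc v
    simp only [← tmul_sw, sw_self, ← lTensor_eq_sw]
    simpa (disch := fun_prop) only [LinearMap.comp_apply, LinearEquiv.coe_coe, rTensor_eq_sw,
      assoc_eq_sw, sw_sw, sw_tmul] using this
  counit v := by
    have := LinearMap.congr_fun hX.isYDModule.coact_counit v
    simpa (disch := fun_prop) only [LinearMap.comp_apply, LinearEquiv.coe_coe, rTensor_eq_sw,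
      lid_eq_sw, sw_sw, sw_tmul, LinearMap.id_apply] using this
  comul_colinear v := by
    have h := LinearMap.congr_fun hX.comul_hom.colinear v
    have e : ∀ t : V ⊗[K] V, diagCoact X.coact X.coact t = sw t fun a b => sw (X.coact a) fun g c =>
        sw (X.coact b) fun h d => (g * h) ⊗ₜ[K] (c ⊗ₜ[K] d) := fun t => by
      simp only [← diagCoact_tmul, ← map_sw, sw_self]
    rw [← e, ← lTensor_eq_sw]
    exact h.symm
  counit_colinear v := by
    have h := congrArg (TensorProduct.rid K H) (LinearMap.congr_fun hX.counit_hom.colinear v)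
    have e : (unitObject K H).coact (X.counit v) = 1 ⊗ₜ[K] X.counit v := rfl
    rw [LinearMap.comp_apply, e] at h
    simpa (disch := fun_prop) only [LinearMap.comp_apply, rTensor_eq_sw, lTensor_eq_sw,
      rid_eq_sw, sw_sw, sw_tmul, LinearMap.id_apply] using h.symm

theorem isBraidedCoalgebra (hX : X.IsYDCoalgebra) :
    IsBraidedCoalgebra X.toCoalgData X.actT X.coact where
  mod := hX.isModuleCoalgebra
  comod := hX.isComoduleCoalgebra
  yetterDrinfeld h v := by
    simp (disch := fun_prop) only [YDData.actT_tmul, hX.isYDModule.coact_act, YDData.ydAct_apply,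
      sw_sw, sw_tmul, hopf_sw_coassoc, mul_assoc]
    simp only [sw_comm _ (X.coact v)]
    refine sw_congr fun k x => sw_congr fun a r => ?_
    -- The antipode in the coaction of `h v` now meets the next leg of `h`, and the two collapse to
    -- a counit.
    have := fun c : H => hopf_sw_antipode_left (K := K)
      (F := fun y => (a * (k * y)) ⊗ₜ[K] X.act c x) (by fun_prop)
    simp only [this, mul_one]
    rw [hopf_sw_counit_right (by fun_prop)]

end YDCoalgData.IsYDCoalgebra

end YetterDrinfeldCoalgebras

/-! ### Projections of the smash coproduct and the product defined by a cocycle. -/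

section SmashProducts

variable {K : Type*} [Field K]
variable {C M V W U H : Type*} [AddCommGroup C] [Module K C] [AddCommMonoid M] [Module K M]
  [AddCommGroup V] [Module K V]
  [AddCommGroup W] [Module K W] [AddCommGroup U] [Module K U] [Ring H] [HopfAlgebra K H]

/-- The smash coproduct coalgebra of a comodule coalgebra by `H`. -/
abbrev smashCoalg (X : CoalgData K V) (ρ : V →ₗ[K] H ⊗[K] V) : CoalgData K (V ⊗[K] H) :=
  X.cross ρ (hopfCoalg K H) (LinearMap.mul' K H)

theorem smash_comul_tmul (X : CoalgData K V) (ρ : V →ₗ[K] H ⊗[K] V) (v : V) (h : H) :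
    (smashCoalg X ρ).comul (v ⊗ₜ h) = sw (X.comul v) fun a b =>
      sw (Coalgebra.comul (R := K) h) fun h₁ h₂ => sw (ρ b) fun g c =>
        (a ⊗ₜ (g * h₁)) ⊗ₜ (c ⊗ₜ h₂) := by
  rw [cross_comul_tmul]
  rfl

theorem smash_counit_tmul (X : CoalgData K V) (ρ : V →ₗ[K] H ⊗[K] V) (v : V) (h : H) :
    (smashCoalg X ρ).counit (v ⊗ₜ h) = X.counit v • Coalgebra.counit (R := K) h := rfl

theorem smash_isCoalgebra {X : CoalgData K V} {ρ : V →ₗ[K] H ⊗[K] V}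
    (hX : IsComoduleCoalgebra X ρ) : (smashCoalg X ρ).IsCoalgebra :=
  cross_isCoalgebra hX hopf_isModuleCoalgebra

variable (K V H) in
/-- The projection `v # h ↦ ε(h) v`. -/
def smashFst : V ⊗[K] H →ₗ[K] V := (hopfCoalg K H).dropRight V

variable (H) in
/-- The projection `v # h ↦ ε(v) h`. -/
def smashSnd (X : CoalgData K V) : V ⊗[K] H →ₗ[K] H := X.dropLeft H

theorem smashFst_tmul (v : V) (h : H) :
    smashFst K V H (v ⊗ₜ h) = Coalgebra.counit (R := K) h • v := dropRight_tmul _ _ _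

theorem smashSnd_tmul (X : CoalgData K V) (v : V) (h : H) :
    smashSnd H X (v ⊗ₜ h) = X.counit v • h := dropLeft_tmul _ _ _

theorem smash_recover {X : CoalgData K V} {ρ : V →ₗ[K] H ⊗[K] V}
    (hX : IsComoduleCoalgebra X ρ) :
    TensorProduct.map (smashFst K V H) (smashSnd H X) ∘ₗ (smashCoalg X ρ).comul =
      LinearMap.id := by
  refine TensorProduct.ext' fun v h => ?_
  simp (disch := fun_prop) only [LinearMap.comp_apply, smash_comul_tmul, map_eq_sw, sw_sw, sw_tmul,
    smashFst_tmul, smashSnd_tmul, Bialgebra.counit_mul, LinearMap.id_apply,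
    ← TensorProduct.smul_tmul', TensorProduct.tmul_smul, mul_smul, smul_comm (X.counit _),
    hX.sw_counit]
  simp (disch := fun_prop) only [smul_comm _ (X.counit _), ← smul_sw, hX.sw_counit]
  simp (disch := fun_prop) only [smul_sw, smul_comm (X.counit _), hopf_sw_counit_left]
  simp (disch := fun_prop) only [← smul_sw, hopf_sw_counit_left, hX.isCoalgebra.sw_counit_right]

/-- By `smash_recover` an element is rebuilt from its coproduct by projecting the two legs to `V`
and `H`. A coalgebra map carries this reconstruction back to its source, so its two components
determine it. -/
theorem smash_hom_ext {X : CoalgData K V} {ρ : V →ₗ[K] H ⊗[K] V}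
    (hX : IsComoduleCoalgebra X ρ) {Y : CoalgData K C} {f g : C →ₗ[K] V ⊗[K] H}
    (hf : IsCoalgHom Y (smashCoalg X ρ) f) (hg : IsCoalgHom Y (smashCoalg X ρ) g)
    (h₁ : smashFst K V H ∘ₗ f = smashFst K V H ∘ₗ g) (h₂ : smashSnd H X ∘ₗ f = smashSnd H X ∘ₗ g) :
    f = g := by
  rw [← LinearMap.id_comp f, ← LinearMap.id_comp g, ← smash_recover hX, LinearMap.comp_assoc,
    hf.comul, LinearMap.comp_assoc, hg.comul, ← LinearMap.comp_assoc, ← TensorProduct.map_comp, h₁,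
    h₂, TensorProduct.map_comp, LinearMap.comp_assoc]

theorem smashFst_isCoalgHom {X : CoalgData K V} {ρ : V →ₗ[K] H ⊗[K] V}
    (hX : IsComoduleCoalgebra X ρ) : IsCoalgHom (smashCoalg X ρ) X (smashFst K V H) where
  comul := by
    refine TensorProduct.ext' fun v h => ?_
    simp (disch := fun_prop) only [LinearMap.comp_apply, smash_comul_tmul, map_eq_sw, sw_sw, sw_tmul,
      smashFst_tmul, Bialgebra.counit_mul, map_smul,
      ← TensorProduct.smul_tmul', TensorProduct.tmul_smul, mul_smul, hX.sw_counit]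
    simp (disch := fun_prop) only [smul_comm (Coalgebra.counit (R := K) (A := H) _)
        (Coalgebra.counit (R := K) (A := H) _),
      ← smul_sw, hX.sw_counit]
    simp (disch := fun_prop) only [hopf_sw_counit_left, ← smul_sw, sw_self]
  counit := by
    refine TensorProduct.ext' fun v h => ?_
    simp only [LinearMap.comp_apply, smashFst_tmul, map_smul, smash_counit_tmul, smul_eq_mul,
      mul_comm]

namespace YDMulCoalgData

variable {X : YDMulCoalgData K H V} {ξ : V ⊗[K] V →ₗ[K] H}

/-- `z # h ↦ m(z⁽¹⁾) # ξ(z⁽²⁾) h`. -/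
def smashMul (X : YDMulCoalgData K H V) (ξ : V ⊗[K] V →ₗ[K] H) :
    (V ⊗[K] V) ⊗[K] H →ₗ[K] V ⊗[K] H :=
  (LinearMap.mul' K H).lTensor V ∘ₗ (TensorProduct.assoc K V H H).toLinearMap ∘ₗ
    (X.mulCocycle ξ).rTensor H

theorem mulCocycle_apply (z : V ⊗[K] V) :
    X.mulCocycle ξ z = sw (X.sq.comul z) fun a b => X.mul a ⊗ₜ ξ b := map_eq_sw _ _ _

theorem smashMul_tmul (z : V ⊗[K] V) (h : H) :
    X.smashMul ξ (z ⊗ₜ h) = sw (X.sq.comul z) fun a b => X.mul a ⊗ₜ (ξ b * h) := by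
  simp (disch := fun_prop) only [smashMul, LinearMap.comp_apply, LinearEquiv.coe_coe, lTensor_eq_sw,
    rTensor_eq_sw, assoc_eq_sw, sw_sw, sw_tmul, mulCocycle_apply, LinearMap.mul'_apply]

theorem smash_mul_eq : (X.smash ξ).mul = X.smashMul ξ ∘ₗ slide X.actDiag := rfl

namespace IsPreBialgebra

variable (hX : X.IsPreBialgebra)
include hX

theorem isBraidedCoalgebra : IsBraidedCoalgebra X.toCoalgData X.actT X.coact :=
  hX.isYDCoalgebra.isBraidedCoalgebra

theorem sq_isBraidedCoalgebra : IsBraidedCoalgebra X.sq.toCoalgData X.sq.actT X.sq.coact := by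
  have e : X.sq.actT = diagAct X.actT X.actT := YDData.tensor_actT _ _
  rw [e]
  exact cross_isBraidedCoalgebra hX.isBraidedCoalgebra hX.isBraidedCoalgebra

theorem cube_isBraidedCoalgebra :
    IsBraidedCoalgebra X.cube.toCoalgData X.cube.actT X.cube.coact := by
  have e : X.cube.actT = diagAct X.sq.actT X.actT := YDData.tensor_actT _ _
  rw [e]
  exact cross_isBraidedCoalgebra hX.sq_isBraidedCoalgebra hX.isBraidedCoalgebra

theorem sw_mul_comul {F : V → V → M} (h₁ : ∀ b, Lin K fun a => F a b)
    (h₂ : ∀ a, Lin K fun b => F a b) (z : V ⊗[K] V) :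
    sw (X.comul (X.mul z)) F = sw (X.sq.comul z) fun a b => F (X.mul a) (X.mul b) := by
  rw [hX.mul_coalgHom.comul_apply, sw_sw h₁ h₂]
  simp only [sw_tmul h₁ h₂]

theorem counit_mul (z : V ⊗[K] V) : X.counit (X.mul z) = X.sq.counit z :=
  hX.mul_coalgHom.counit_apply z

theorem comul_one : X.comul X.one = X.one ⊗ₜ X.one := by
  have h := hX.unit_coalgHom.comul_apply (1 : K)
  have e : (YDCoalgData.unitObject K H).comul (1 : K) = 1 ⊗ₜ 1 := rfl
  have e' : X.unitMap 1 = X.one := by simp [unitMap]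
  rw [e, sw_tmul (by fun_prop) (by fun_prop), e'] at h
  exact h

theorem counit_one : X.counit X.one = 1 := by
  have h := hX.unit_coalgHom.counit_apply (1 : K)
  have e' : X.unitMap 1 = X.one := by simp [unitMap]
  rw [e'] at h
  exact h

theorem act_one (h : H) : X.actT (h ⊗ₜ X.one) = Coalgebra.counit (R := K) h • X.one := by
  have e := hX.unit_hom.linear h (1 : K)
  have e' (c : K) : X.unitMap c = c • X.one := by simp [unitMap]
  have e₁ : (YDCoalgData.unitObject K H).act h (1 : K) = Coalgebra.counit (R := K) h * 1 := rfl
  rw [e', e', e₁, one_smul, _root_.mul_one] at e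
  rw [YDData.actT_tmul, e]

theorem coact_one : X.coact X.one = 1 ⊗ₜ X.one := by
  have h := LinearMap.congr_fun hX.unit_hom.colinear (1 : K)
  have e' (c : K) : X.unitMap c = c • X.one := by simp [unitMap]
  have e₁ : (YDCoalgData.unitObject K H).coact (1 : K) = (1 : H) ⊗ₜ[K] (1 : K) := rfl
  rw [LinearMap.comp_apply, e', LinearMap.comp_apply, e₁, one_smul, LinearMap.lTensor_tmul, e',
    one_smul] at h
  exact h

theorem mul_act (h : H) (z : V ⊗[K] V) :
    X.mul (X.sq.actT (h ⊗ₜ z)) = X.actT (h ⊗ₜ X.mul z) := by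
  rw [YDData.actT_tmul, YDData.actT_tmul, hX.mul_linear]

end IsPreBialgebra

theorem adLeft_apply (h x : H) : adLeft K H h x = sw (Coalgebra.comul (R := K) h) fun a b =>
    a * x * HopfAlgebra.antipode K b := by
  have e (s : Module.End K H ⊗[K] Module.End K H) :
      LinearMap.mul' K _ s x = sw s fun f g => f (g x) := by
    conv_lhs => rw [← sw_self s, map_sw]
    simp [sw]
  simp (disch := fun_prop) only [adLeft, LinearMap.comp_apply, map_eq_sw, e, sw_sw, sw_tmul]
  simp [mul_assoc]

namespace IsCocycle

variable (hX : X.IsPreBialgebra) (hξ : X.IsCocycle ξ)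
include hξ

/-- Linearity of `ξ` for the adjoint action in antipode-free form: in `h₁ ξ(z) S(h₂) h₃` the last
two legs cancel. -/
theorem sw_linear {F : H → M} (hF : Lin K F) (h : H) (z : V ⊗[K] V) :
    sw (Coalgebra.comul (R := K) h) (fun h₁ h₂ => F (ξ (X.sq.actT (h₁ ⊗ₜ z)) * h₂)) =
      F (h * ξ z) := by
  have e (G : H → H → H) (t : H ⊗[K] H) : F (sw t G) = sw t fun a b => F (G a b) := by
    let φ : H →ₗ[K] M := ⟨⟨F, hF.add⟩, hF.smul⟩
    exact map_sw φ t G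
  simp (disch := fun_prop) only [YDData.actT_tmul, hξ.linear, adLeft_apply, sw_mul, e,
    hopf_sw_coassoc, _root_.mul_assoc]
  have (a : H) := hopf_sw_antipode_left (K := K) (F := fun y => F (a * (ξ z * y))) (by fun_prop)
  simp (disch := fun_prop) only [this, hopf_sw_counit_right, _root_.mul_one]

theorem sw_comul {F : H → H → M} (h₁ : ∀ b, Lin K fun a => F a b)
    (h₂ : ∀ a, Lin K fun b => F a b) (z : V ⊗[K] V) :
    sw (Coalgebra.comul (R := K) (ξ z)) F = sw (X.sq.comul z) fun a b =>
      sw (X.sq.coact b) fun g c => F (ξ a * g) (ξ c) := by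
  have h := congrArg (fun t => sw t F) (LinearMap.congr_fun hξ.comul z)
  simpa (disch := fun_prop) only [LinearMap.comp_apply, LinearEquiv.coe_coe, map_eq_sw,
    assoc_symm_eq_sw, sw_sw, sw_tmul, LinearMap.mul'_apply] using h

theorem counit_apply (z : V ⊗[K] V) : Coalgebra.counit (R := K) (ξ z) = X.sq.counit z :=
  LinearMap.congr_fun hξ.counit z

theorem sw_mul_coact {F : H → V → M} (h₁ : ∀ b, Lin K fun a => F a b)
    (h₂ : ∀ a, Lin K fun b => F a b) (z : V ⊗[K] V) :
    sw (X.sq.comul z) (fun a b => sw (X.coact (X.mul a)) fun g c => F (g * ξ b) c) =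
      sw (X.sq.comul z) fun a b => sw (X.sq.coact b) fun g c => F (ξ a * g) (X.mul c) := by
  have h := congrArg (fun t => sw t F) (LinearMap.congr_fun hξ.mul_coact z)
  simpa (disch := fun_prop) only [LinearMap.comp_apply, LinearEquiv.coe_coe, map_eq_sw,
    assoc_symm_eq_sw, sw_sw, sw_tmul, LinearMap.mul'_apply, mulCocycle_apply, map_sw,
    crossing_tmul] using h

theorem mul_mul (r s t : V) : X.mul (r ⊗ₜ X.mul (s ⊗ₜ t)) = sw (X.sq.comul (r ⊗ₜ s)) fun a b =>
    X.mul (X.mul a ⊗ₜ X.actT (ξ b ⊗ₜ t)) := by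
  have h := LinearMap.congr_fun hξ.mul_assoc (r ⊗ₜ s ⊗ₜ t)
  simpa (disch := fun_prop) only [LinearMap.comp_apply, LinearEquiv.coe_coe, map_eq_sw,
    assoc_eq_sw, rTensor_eq_sw, lTensor_eq_sw, sw_sw, sw_tmul, map_sw, sw_tmul_right] using h

theorem cocycle_apply (r s t : V) :
    sw (X.sq.comul (s ⊗ₜ t)) (fun a b => ξ (r ⊗ₜ X.mul a) * ξ b) =
    sw (X.sq.comul (r ⊗ₜ s)) fun a b => sw (Coalgebra.comul (R := K) (ξ b)) fun g h =>
      ξ (X.mul a ⊗ₜ X.actT (g ⊗ₜ t)) * h := by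
  have h := LinearMap.congr_fun hξ.cocycle (r ⊗ₜ s ⊗ₜ t)
  simpa (disch := fun_prop) only [LinearMap.comp_apply, LinearEquiv.coe_coe, map_eq_sw,
    assoc_eq_sw, assoc_symm_eq_sw, rTensor_eq_sw, lTensor_eq_sw, sw_sw, sw_tmul, map_sw,
    sw_tmul_right, tmul_sw, mulCocycle_apply, LinearMap.mul'_apply, crossing_tmul] using h

include hX

/-- The formula for `Δξ` makes `ξ` split correctly, and the axiom `mul_coact` repairs the failure of
`m` to be colinear. Neither factor of the product would suffice alone. -/
theorem smashMul_isCoalgHom : IsCoalgHom (smashCoalg X.sq.toCoalgData X.sq.coact)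
    (smashCoalg X.toCoalgData X.coact) (X.smashMul ξ) where
  comul := by
    have hq := hX.sq_isBraidedCoalgebra
    refine TensorProduct.ext' fun z h => ?_
    simp (disch := fun_prop) only [LinearMap.comp_apply, smashMul_tmul, map_eq_sw, sw_sw, sw_tmul,
      smash_comul_tmul, map_sw, tmul_sw, sw_tmul_right, hX.sw_mul_comul, hopf_comul_mul,
      hξ.sw_comul, hq.comod.sw_comul]
    simp only [sw_comm _ (Coalgebra.comul (R := K) h)]
    refine sw_congr fun h₁ h₂ => ?_
    conv_rhs => enter [2, a, b]; simp only [sw_comm _ (X.sq.comul a)]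
    simp (disch := fun_prop) only [hq.comod.isCoalgebra.sw_coassoc]
    refine sw_congr fun a r => ?_
    conv_lhs => simp (disch := fun_prop) only [← hq.comod.isCoalgebra.sw_coassoc]
    -- The regrouping puts `m(s⁽¹⁾)₋₁` next to `ξ(s⁽²⁾)`, so that `sw_mul_coact` can exchange them
    -- for `ξ(s⁽¹⁾) s⁽²⁾₋₁`.
    trans sw (X.sq.comul r) fun s b => sw (X.sq.coact b) fun k y => sw (X.sq.comul s) fun p q =>
      sw (X.sq.coact q) fun g c =>
        (X.mul a ⊗ₜ[K] (ξ p * g * (k * h₁))) ⊗ₜ[K] (X.mul c ⊗ₜ[K] (ξ y * h₂))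
    · refine sw_congr fun s b => ?_
      rw [sw_comm]
      refine sw_congr fun k y => ?_
      have := hξ.sw_mul_coact (F := fun u c =>
        (X.mul a ⊗ₜ[K] (u * (k * h₁))) ⊗ₜ[K] (c ⊗ₜ[K] (ξ y * h₂))) (by fun_prop) (by fun_prop) s
      simpa only [_root_.mul_assoc] using this
    · conv_lhs => enter [2, s, b]; simp only [sw_comm _ (X.sq.comul s)]
      simp (disch := fun_prop) only [hq.comod.isCoalgebra.sw_coassoc, _root_.mul_assoc]
      refine sw_congr fun p r' => sw_congr fun s t => ?_
      rw [sw_comm]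
  counit := by
    have hq := hX.sq_isBraidedCoalgebra
    refine TensorProduct.ext' fun z h => ?_
    simp (disch := fun_prop) only [LinearMap.comp_apply, smashMul_tmul, map_sw, smash_counit_tmul,
      hX.counit_mul, Bialgebra.counit_mul, hξ.counit_apply, smul_eq_mul, _root_.mul_assoc]
    simpa only [smul_eq_mul] using
      hq.comod.isCoalgebra.sw_counit_left
      (F := fun b => X.sq.counit b * Coalgebra.counit (R := K) h) (by fun_prop) z

end IsCocycle

end YDMulCoalgData
end SmashProducts

/-! ### The bialgebra `R #_ξ H`. -/

section SmashBialgebra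

variable {K : Type*} [Field K]
variable {M V H : Type*} [AddCommMonoid M] [Module K M]
  [AddCommGroup V] [Module K V] [Ring H] [HopfAlgebra K H]

namespace YDMulCoalgData

variable {X : YDMulCoalgData K H V} {ξ : V ⊗[K] V →ₗ[K] H}

theorem sq_act_tmul (h : H) (v w : V) : X.sq.actT (h ⊗ₜ (v ⊗ₜ w)) =
    sw (Coalgebra.comul (R := K) h) fun h₁ h₂ => X.actT (h₁ ⊗ₜ v) ⊗ₜ X.actT (h₂ ⊗ₜ w) := by
  have e : X.sq.actT = diagAct X.actT X.actT := YDData.tensor_actT _ _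
  rw [e, diagAct_tmul]

theorem sq_comul_tmul (v w : V) : X.sq.comul (v ⊗ₜ w) =
    sw (X.comul v) fun v₁ v₂ => sw (X.comul w) fun w₁ w₂ =>
      sw (X.coact v₂) fun h a => (v₁ ⊗ₜ X.actT (h ⊗ₜ w₁)) ⊗ₜ (a ⊗ₜ w₂) :=
  cross_comul_tmul _ _ _ _ _ _

theorem smash_mul_tmul (r s : V) (h l : H) : (X.smash ξ).mul ((r ⊗ₜ h) ⊗ₜ (s ⊗ₜ l)) =
    sw (Coalgebra.comul (R := K) h) fun h₁ h₂ => sw (X.sq.comul (r ⊗ₜ X.actT (h₁ ⊗ₜ s))) fun a b =>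
      X.mul a ⊗ₜ (ξ b * (h₂ * l)) := by
  simp (disch := fun_prop) only [smash_mul_eq, LinearMap.comp_apply, YDData.actDiag_eq, slide_tmul,
    diagAct_tmul, sw_sw, sw_tmul, map_sw, smashMul_tmul, LinearMap.mul'_apply]

namespace IsCocycle

variable (hX : X.IsPreBialgebra) (hξ : X.IsCocycle ξ)
include hξ hX

theorem smash_mul_hom : IsCoalgHom ((X.smash ξ).tensor (X.smash ξ).toCoalgData)
    (X.smash ξ).toCoalgData (X.smash ξ).mul :=
  (smashMul_isCoalgHom hX hξ).comp
    (slide_diagAct_isCoalgHom hX.isBraidedCoalgebra.comod hX.isBraidedCoalgebra)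

theorem smashFst_smashMul (z : V ⊗[K] V) (h : H) :
    smashFst K V H (X.smashMul ξ (z ⊗ₜ h)) = Coalgebra.counit (R := K) h • X.mul z := by
  have hq := hX.sq_isBraidedCoalgebra
  simp (disch := fun_prop) only [smashMul_tmul, map_sw, smashFst_tmul, Bialgebra.counit_mul,
    hξ.counit_apply, mul_smul, hq.comod.isCoalgebra.sw_counit_right]

theorem smashSnd_smashMul (z : V ⊗[K] V) (h : H) :
    smashSnd H X.toCoalgData (X.smashMul ξ (z ⊗ₜ h)) = ξ z * h := by
  have hq := hX.sq_isBraidedCoalgebra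
  simp (disch := fun_prop) only [smashMul_tmul, map_sw, smashSnd_tmul, hX.counit_mul,
    hq.comod.isCoalgebra.sw_counit_left]

theorem smashFst_mul (r : V) (h : H) (y : V ⊗[K] H) :
    smashFst K V H ((X.smash ξ).mul ((r ⊗ₜ h) ⊗ₜ y)) =
      X.mul (r ⊗ₜ X.actT (h ⊗ₜ smashFst K V H y)) := by
  induction y with
  | zero => simp
  | add x y hx hy => simp only [TensorProduct.tmul_add, map_add, hx, hy]
  | tmul s l =>
    simp (disch := fun_prop) only [smash_mul_eq, LinearMap.comp_apply, YDData.actDiag_eq,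
      slide_tmul, diagAct_tmul, sw_sw, sw_tmul, map_sw, LinearMap.mul'_apply,
      smashFst_smashMul hX hξ, smashFst_tmul, Bialgebra.counit_mul, mul_smul,
      hopf_sw_counit_right, TensorProduct.tmul_smul, map_smul]

theorem smashSnd_mul (r s : V) (h l : H) :
    smashSnd H X.toCoalgData ((X.smash ξ).mul ((r ⊗ₜ h) ⊗ₜ (s ⊗ₜ l))) =
      sw (Coalgebra.comul (R := K) h) fun h₁ h₂ => ξ (r ⊗ₜ X.actT (h₁ ⊗ₜ s)) * (h₂ * l) := by
  simp (disch := fun_prop) only [smash_mul_eq, LinearMap.comp_apply, YDData.actDiag_eq,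
      slide_tmul, diagAct_tmul, sw_sw, sw_tmul, map_sw, LinearMap.mul'_apply,
      smashSnd_smashMul hX hξ]

theorem smash_isUnitalMulCoalgebra : (X.smash ξ).IsUnitalMulCoalgebra where
  isCoalgebra := smash_isCoalgebra hX.isBraidedCoalgebra.comod
  mul_hom := smash_mul_hom hX hξ
  comul_one := by
    have e : (X.smash ξ).comul (X.smash ξ).one =
      (smashCoalg X.toCoalgData X.coact).comul (X.one ⊗ₜ 1) := rfl
    rw [e]
    simp (disch := fun_prop) only [smash_comul_tmul, hX.comul_one, sw_tmul, hopf_comul_one,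
      hX.coact_one, _root_.mul_one]
    rfl
  counit_one := by
    have e : (X.smash ξ).counit (X.smash ξ).one =
      (smashCoalg X.toCoalgData X.coact).counit (X.one ⊗ₜ 1) := rfl
    rw [e, smash_counit_tmul, hX.counit_one, Bialgebra.counit_one, one_smul]
  one_mul x := by
    have e : (X.smash ξ).one = X.one ⊗ₜ 1 := rfl
    rw [e]
    induction x with
    | zero => simp
    | add x y hx hy => rw [TensorProduct.tmul_add, map_add, hx, hy]
    | tmul s l =>
      simp (disch := fun_prop) only [smash_mul_tmul, hopf_comul_one, sw_tmul,
        hX.isBraidedCoalgebra.mod.one_act, sq_comul_tmul, hX.comul_one, hX.coact_one, sw_sw,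
        hX.one_mul, hξ.unital_left, _root_.one_mul, smul_mul_assoc, TensorProduct.tmul_smul,
        hX.isBraidedCoalgebra.comod.isCoalgebra.sw_counit_right]
  mul_one x := by
    have e : (X.smash ξ).one = X.one ⊗ₜ 1 := rfl
    rw [e]
    induction x with
    | zero => simp
    | add x y hx hy => rw [TensorProduct.add_tmul, map_add, hx, hy]
    | tmul s l =>
      simp (disch := fun_prop) only [smash_mul_tmul, hX.act_one, TensorProduct.tmul_smul, map_smul,
        sw_smul, hopf_sw_counit_left, sw_tmul,
        hX.isBraidedCoalgebra.mod.one_act, sq_comul_tmul, hX.comul_one, hX.coact_one, sw_sw,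
        hX.mul_one, hξ.unital_right, _root_.one_mul, _root_.mul_one, smul_mul_assoc,
        ← TensorProduct.smul_tmul',
        hX.isBraidedCoalgebra.comod.sw_counit,
        hX.isBraidedCoalgebra.comod.isCoalgebra.sw_counit_right]

/-- Both bracketings are coalgebra maps into a smash coproduct, so `smash_hom_ext` reduces
associativity to components. The `V`-component is the associativity of `m` up to `ξ`, the
`H`-component the cocycle identity for `ξ`. -/
theorem smash_isBialgebra : (X.smash ξ).IsBialgebra where
  toIsUnitalMulCoalgebra := smash_isUnitalMulCoalgebra hX hξ
  mul_assoc := by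
    have hu := smash_isUnitalMulCoalgebra hX hξ
    have hb := hX.isBraidedCoalgebra
    have hq := hX.sq_isBraidedCoalgebra
    refine smash_hom_ext hb.comod (hu.mul_hom.comp hu.mul₁₂_hom) (hu.mul_hom.comp hu.mul₂₃_hom) ?_ ?_
    · refine TensorProduct.ext_threefold fun x y w => ?_
      simp only [LinearMap.comp_apply, MulCoalgData.mul₁₂, MulCoalgData.mul₂₃, LinearMap.rTensor_tmul,
        LinearMap.lTensor_tmul, LinearEquiv.coe_coe, TensorProduct.assoc_tmul]
      induction x with
      | zero => simp
      | add x y hx hy => simp only [TensorProduct.add_tmul, map_add, hx, hy]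
      | tmul r h =>
        induction y with
        | zero => simp
        | add x y hx hy => simp only [TensorProduct.add_tmul, TensorProduct.tmul_add, map_add, hx, hy]
        | tmul s l =>
          rw [smashFst_mul hX hξ, smashFst_mul hX hξ, ← hX.mul_act, smash_mul_tmul]
          simp (disch := fun_prop) only [sw_tmul_right, map_sw, smashFst_mul hX hξ, hb.mod.mul_act,
            sq_act_tmul, tmul_sw, hξ.mul_mul]
    · refine TensorProduct.ext_threefold fun x y w => ?_
      simp only [LinearMap.comp_apply, MulCoalgData.mul₁₂, MulCoalgData.mul₂₃, LinearMap.rTensor_tmul,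
        LinearMap.lTensor_tmul, LinearEquiv.coe_coe, TensorProduct.assoc_tmul]
      induction x with
      | zero => simp
      | add x y hx hy => simp only [TensorProduct.add_tmul, map_add, hx, hy]
      | tmul r h =>
        induction y with
        | zero => simp
        | add x y hx hy => simp only [TensorProduct.add_tmul, TensorProduct.tmul_add, map_add, hx, hy]
        | tmul s l =>
          induction w with
          | zero => simp
          | add x y hx hy => simp only [TensorProduct.tmul_add, map_add, hx, hy]
          | tmul t k =>
            rw [smash_mul_tmul, smash_mul_tmul]
            simp (disch := fun_prop) only [sw_tmul_right, tmul_sw, map_sw, smashSnd_mul hX hξ,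
              hopf_comul_mul, sw_sw, sw_tmul]
            -- The cocycle identity is used at the three elements `r`, `h₁ s` and `h₂ l₁ t`.
            trans sw (Coalgebra.comul (R := K) l) fun l₁ l₂ => sw (Coalgebra.comul (R := K) h)
              fun h₁ u => sw (Coalgebra.comul (R := K) u) fun c d =>
                (sw (X.sq.comul (X.actT (h₁ ⊗ₜ s) ⊗ₜ X.actT ((c * l₁) ⊗ₜ t))) fun a b =>
                  ξ (r ⊗ₜ X.mul a) * ξ b) * (d * (l₂ * k))
            · simp (disch := fun_prop) only [hξ.cocycle_apply, sw_mul, hb.mod.mul_act,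
                sw_comm _ (Coalgebra.comul (R := K) l)]
              refine sw_congr fun l₁ l₂ => sw_congr fun h₁ u => ?_
              simp only [sw_comm _ (Coalgebra.comul (R := K) u), _root_.mul_assoc]
            · refine sw_congr fun l₁ l₂ => ?_
              simp only [hb.mod.mul_act]
              simp (disch := fun_prop) only [← hopf_sw_coassoc, sw_mul]
              -- Together `h₁ s ⊗ h₂ l₁ t` is a diagonal action on `s ⊗ l₁ t`. It can therefore be
              -- moved through the braided coproduct and then through `m` and `ξ`.
              trans sw (Coalgebra.comul (R := K) h) fun v d =>
                sw (X.sq.comul (X.sq.actT (v ⊗ₜ (s ⊗ₜ X.actT (l₁ ⊗ₜ t))))) fun a b =>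
                  ξ (r ⊗ₜ X.mul a) * ξ b * (d * (l₂ * k))
              · simp (disch := fun_prop) only [sq_act_tmul, map_sw, sw_sw]
              · simp (disch := fun_prop) only [hq.mod.comul_act, sw_sw, sw_tmul, hX.mul_act,
                  hopf_sw_coassoc, sw_comm (Coalgebra.comul (R := K) _) (X.sq.comul _)]
                refine sw_congr fun a b => sw_congr fun h₁ u => ?_
                have := hξ.sw_linear (F := fun y => ξ (r ⊗ₜ X.actT (h₁ ⊗ₜ X.mul a)) *
                  (y * (l₂ * k))) (by fun_prop) u b
                simpa only [_root_.mul_assoc] using this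

end IsCocycle

end YDMulCoalgData
end SmashBialgebra

/-! ### Connected coalgebras: the filtration by translations and convolution invertibility. -/

section ConnectedCoalgebras

variable {K : Type*} [Field K] {C V W : Type*} [AddCommGroup C] [Module K C]
  [AddCommGroup V] [Module K V] [AddCommGroup W] [Module K W]

theorem tensor_eq_zero_of_functionals (t : V ⊗[K] W)
    (h : ∀ f : W →ₗ[K] K, sw t (fun a b => f b • a) = 0) : t = 0 := by
  classical
  let b := Module.Basis.ofVectorSpace K W
  refine (TensorProduct.equivFinsuppOfBasisRight b).injective (Finsupp.ext fun i => ?_)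
  rw [map_zero, Finsupp.zero_apply, ← h (b.coord i)]
  have e : (Finsupp.lapply i ∘ₗ (TensorProduct.equivFinsuppOfBasisRight b).toLinearMap) t =
      sw t fun a c => b.coord i c • a := by
    conv_lhs => rw [← sw_self t, map_sw]
    simp [TensorProduct.equivFinsuppOfBasisRight_apply_tmul_apply]
  exact e

/-- A linear projection onto `P` fixes every slice of `t`. Hence `t` and its projected image have
the same slices and agree. -/
theorem mem_range_rTensor_of_functionals (P : Submodule K V) (t : V ⊗[K] W)
    (h : ∀ f : W →ₗ[K] K, sw t (fun a b => f b • a) ∈ P) :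
    t ∈ LinearMap.range (P.subtype.rTensor W) := by
  obtain ⟨π, hπ⟩ := LinearMap.exists_leftInverse_of_injective P.subtype P.ker_subtype
  refine ⟨π.rTensor W t, sub_eq_zero.1 (tensor_eq_zero_of_functionals _ fun f => ?_)⟩
  have e : ∀ x ∈ P, ((π x : P) : V) = x := fun x hx =>
    congrArg Subtype.val (LinearMap.congr_fun hπ ⟨x, hx⟩)
  have e₁ := e _ (h f)
  rw [map_sw] at e₁
  have e₂ : ∀ t s : V ⊗[K] W, sw (t - s) (fun a b => f b • a) =
      sw t (fun a b => f b • a) - sw s (fun a b => f b • a) := fun t s => by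
    have e₃ : ∀ t : V ⊗[K] W, sw t (fun a b => f b • a) =
        ((TensorProduct.rid K V).toLinearMap ∘ₗ f.lTensor V) t := fun t => by
      simp (disch := fun_prop) only [LinearMap.comp_apply, LinearEquiv.coe_coe, lTensor_eq_sw,
        rid_eq_sw, sw_sw, sw_tmul]
    rw [e₃, e₃, e₃, map_sub]
  rw [e₂, sub_eq_zero]
  conv_rhs => rw [← e₁]
  simp (disch := fun_prop) only [rTensor_eq_sw, sw_sw, sw_tmul, map_sw]
  simp [sw]

/-- A simple submodule embeds in the cyclic module of any nonzero element of the sum of its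
images. -/
theorem Submodule.exists_injective_of_mem_iSup_map {B N ι : Type*} [Ring B] [AddCommGroup N]
    [Module B N] (S : Submodule B N) [IsSimpleModule B S] (φ : ι → N →ₗ[B] N) {e : N}
    (he : e ∈ ⨆ i, S.map (φ i)) (he0 : e ≠ 0) :
    ∃ q : S →ₗ[B] N, Function.Injective q ∧ ∀ x, q x ∈ Submodule.span B {e} := by
  set E : Submodule B N := ⨆ i, S.map (φ i) with hE
  have hss : IsSemisimpleModule B E := by
    have := isSemisimpleModule_biSup_of_isSemisimpleModule_submodule (R := B)
      (s := (Set.univ : Set ι)) (p := fun i => S.map (φ i)) fun i _ => by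
        have : IsSemisimpleModule B (LinearMap.range (φ i ∘ₗ S.subtype)) := .range _
        rwa [LinearMap.range_comp, Submodule.range_subtype] at this
    rwa [iSup_univ] at this
  let z : E := ⟨e, he⟩
  obtain ⟨L', hL'⟩ := ComplementedLattice.exists_isCompl (Submodule.span B {z})
  let p := (Submodule.span B {z}).projectionOnto L' hL'
  have hpz : p z = ⟨z, Submodule.mem_span_singleton_self z⟩ :=
    Submodule.projectionOnto_apply_left hL' ⟨z, Submodule.mem_span_singleton_self z⟩
  let ψ (i : ι) : S →ₗ[B] E := (φ i ∘ₗ S.subtype).codRestrict E fun x =>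
    (le_iSup (fun i => S.map (φ i)) i) ⟨x, x.2, rfl⟩
  -- If the projection `p` killed the image of `S` under every `φ i`, it would kill their sum `E`,
  -- yet it fixes the nonzero element `z`. A nonzero map out of the simple module `S` is injective.
  have hex : ∃ i, p ∘ₗ ψ i ≠ 0 := by
    by_contra! hcon
    have hle : E ≤ (LinearMap.ker p).map E.subtype := by
      refine iSup_le fun i => ?_
      rintro _ ⟨x, hx, rfl⟩
      exact ⟨ψ i ⟨x, hx⟩, LinearMap.congr_fun (hcon i) ⟨x, hx⟩, rfl⟩
    obtain ⟨y, hy, hye⟩ := hle he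
    have hyz : y = z := Subtype.ext hye
    rw [hyz] at hy
    have h0 : p z = 0 := hy
    rw [hpz] at h0
    exact he0 (congrArg (fun t => ((t : Submodule.span B {z}) : E).1) h0)
  obtain ⟨i, hi⟩ := hex
  refine ⟨E.subtype ∘ₗ (Submodule.span B {z}).subtype ∘ₗ p ∘ₗ ψ i, ?_, fun x => ?_⟩
  · exact E.subtype_injective.comp ((Submodule.subtype_injective _).comp
      ((p ∘ₗ ψ i).injective_of_ne_zero hi))
  · have h1 : (Submodule.span B {z}).map E.subtype = Submodule.span B {e} := by
      rw [Submodule.map_span, Set.image_singleton]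
      rfl
    rw [← h1]
    exact ⟨_, (p (ψ i x)).2, rfl⟩

/-- Take `Q` maximal among the proper submodules of `P`. A map that kills `Q` but not `P` then has
kernel exactly `Q` on `P`, and its image is the simple quotient `P/Q`. -/
theorem Submodule.exists_lt_forall_isSimpleModule_map {B N : Type*} [Ring B] [Algebra K B]
    [AddCommGroup N] [Module K N] [Module B N] [IsScalarTower K B N] (P : Submodule B N)
    (hP : P ≠ ⊥) [FiniteDimensional K (P.restrictScalars K)] :
    ∃ Q < P, ∀ c : N →ₗ[B] N, Q ≤ LinearMap.ker c → ¬ P ≤ LinearMap.ker c →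
      IsSimpleModule B (P.map c) ∧ P ⊓ LinearMap.ker c ≤ Q := by
  have : Nontrivial P := (Submodule.nontrivial_iff_ne_bot).2 hP
  have hfin : Module.Finite K P := inferInstanceAs (Module.Finite K (P.restrictScalars K))
  have : IsNoetherian B P := isNoetherian_of_tower K inferInstance
  obtain ⟨Q, hQ⟩ := IsCoatomic.exists_coatom (Submodule B P)
  refine ⟨Q.map P.subtype, lt_of_le_of_ne (P.map_subtype_le Q) fun h => ?_, fun c h₁ h₂ => ?_⟩
  · refine hQ.1 (Submodule.map_injective_of_injective P.subtype_injective ?_)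
    rw [h, Submodule.map_top, Submodule.range_subtype]
  have hQc : Q ≤ LinearMap.ker (c ∘ₗ P.subtype) := by
    rw [LinearMap.ker_comp]
    exact Submodule.map_le_iff_le_comap.1 h₁
  have hker : LinearMap.ker (c ∘ₗ P.subtype) = Q := (hQ.le_iff.1 hQc).resolve_left fun h =>
    h₂ fun x hx => by
      have : (⟨x, hx⟩ : P) ∈ LinearMap.ker (c ∘ₗ P.subtype) := h ▸ Submodule.mem_top
      exact this
  constructor
  · have : IsSimpleModule B (P ⧸ LinearMap.ker (c ∘ₗ P.subtype)) :=
      isSimpleModule_iff_isCoatom.2 (by rwa [hker])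
    have h := IsSimpleModule.congr (c ∘ₗ P.subtype).quotKerEquivRange.symm
    rwa [LinearMap.range_comp, Submodule.range_subtype] at h
  · rintro x ⟨hx, hxc⟩
    refine ⟨⟨x, hx⟩, ?_, rfl⟩
    rw [← hker]
    exact hxc

namespace CoalgData

variable (X : CoalgData K C)

/-- `x ↦ x₁ f(x₂)`. -/
def hitL (f : C →ₗ[K] K) : Module.End K C := X.convR LinearMap.id f

/-- `x ↦ g(x₁) x₂`. -/
def hitR (g : C →ₗ[K] K) : Module.End K C := X.convL g LinearMap.id

variable {X}

theorem hitL_apply (f : C →ₗ[K] K) (x : C) : X.hitL f x = sw (X.comul x) fun a b => f b • a :=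
  convR_apply _ _ _

theorem hitR_apply (g : C →ₗ[K] K) (x : C) : X.hitR g x = sw (X.comul x) fun a b => g a • b :=
  convL_apply _ _ _

namespace IsCoalgebra

variable (hX : X.IsCoalgebra)
include hX

theorem hitL_counit : X.hitL X.counit = LinearMap.id := hX.convR_counit _

theorem hitR_counit : X.hitR X.counit = LinearMap.id := hX.counit_convL _

theorem hitL_hitL (f g : C →ₗ[K] K) : X.hitL f ∘ₗ X.hitL g = X.hitL (X.convL f g) := by
  change X.hitL f ∘ₗ X.convR LinearMap.id g = _
  rw [comp_convR, LinearMap.comp_id]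
  exact hX.convR_convR _ _ _

theorem hitR_hitR (f g : C →ₗ[K] K) : X.hitR f ∘ₗ X.hitR g = X.hitR (X.convL g f) := by
  change X.hitR f ∘ₗ X.convL g LinearMap.id = _
  rw [comp_convL, LinearMap.comp_id]
  exact hX.convL_convL _ _ _

theorem hitL_hitR (f g : C →ₗ[K] K) : X.hitL f ∘ₗ X.hitR g = X.hitR g ∘ₗ X.hitL f := by
  rw [hitR, comp_convL, LinearMap.comp_id, hitL, comp_convR, LinearMap.comp_id, hX.convL_convR]

end IsCoalgebra

/-- Stability under both translation actions. -/
def IsBistable (X : CoalgData K C) (P : Submodule K C) : Prop :=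
  ∀ x ∈ P, ∀ f, X.hitL f x ∈ P ∧ X.hitR f x ∈ P

/-- Slicing on each side places `Δx` in `P ⊗ C` and in `C ⊗ P`. Applying a projection onto `P` to
both legs leaves it fixed, hence it lies in `P ⊗ P`. -/
theorem IsBistable.isSubcoalgebra {P : Submodule K C} (h : X.IsBistable P) :
    X.IsSubcoalgebra P := by
  intro x hx
  obtain ⟨t, ht⟩ := mem_range_rTensor_of_functionals P (X.comul x) fun f => by
    rw [← hitL_apply]; exact (h x hx f).1
  obtain ⟨s, hs⟩ := mem_range_rTensor_of_functionals P (TensorProduct.comm K C C (X.comul x))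
    fun f => by
      simp (disch := fun_prop) only [comm_eq_sw, sw_sw, sw_tmul]
      rw [← hitR_apply]; exact (h x hx f).2
  obtain ⟨π, hπ⟩ := LinearMap.exists_leftInverse_of_injective P.subtype P.ker_subtype
  have e : P.subtype ∘ₗ π ∘ₗ P.subtype = P.subtype := by rw [hπ, LinearMap.comp_id]
  have e₁ : (P.subtype ∘ₗ π).rTensor C (X.comul x) = X.comul x := by
    rw [← ht, ← LinearMap.comp_apply, ← LinearMap.rTensor_comp, LinearMap.comp_assoc, e]
  have e₂ : (P.subtype ∘ₗ π).lTensor C (X.comul x) = X.comul x := by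
    apply (TensorProduct.comm K C C).injective
    have e₃ : TensorProduct.comm K C C ((P.subtype ∘ₗ π).lTensor C (X.comul x)) =
        (P.subtype ∘ₗ π).rTensor C (TensorProduct.comm K C C (X.comul x)) := by
      simp (disch := fun_prop) only [comm_eq_sw, lTensor_eq_sw, rTensor_eq_sw, sw_sw, sw_tmul]
    rw [e₃, ← hs, ← LinearMap.comp_apply, ← LinearMap.rTensor_comp, LinearMap.comp_assoc, e]
  refine ⟨TensorProduct.map π π (X.comul x), ?_⟩
  rw [← LinearMap.comp_apply, ← TensorProduct.map_comp]
  conv_rhs => rw [← e₁, ← e₂]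
  rw [← LinearMap.comp_apply (LinearMap.rTensor C _), LinearMap.rTensor_comp_lTensor]

theorem IsSubcoalgebra.isBistable {P : Submodule K C} (h : X.IsSubcoalgebra P) :
    X.IsBistable P := by
  intro x hx f
  obtain ⟨t, ht⟩ := h x hx
  rw [hitL_apply, hitR_apply, ← ht]
  simp (disch := fun_prop) only [map_eq_sw, sw_sw, sw_tmul]
  exact ⟨Submodule.sum_mem _ fun p _ => P.smul_mem _ p.1.2,
    Submodule.sum_mem _ fun p _ => P.smul_mem _ p.2.2⟩

/-- The subcoalgebra generated by an element. -/
def bispan (X : CoalgData K C) (x : C) : Submodule K C :=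
  Submodule.span K {y | ∃ f g, y = X.hitR g (X.hitL f x)}

theorem IsCoalgebra.mem_bispan (hX : X.IsCoalgebra) (x : C) : x ∈ X.bispan x :=
  Submodule.subset_span ⟨X.counit, X.counit, by rw [hX.hitL_counit, hX.hitR_counit]; rfl⟩

theorem IsCoalgebra.bispan_isBistable (hX : X.IsCoalgebra) (x : C) :
    X.IsBistable (X.bispan x) := by
  intro y hy h
  induction hy using Submodule.span_induction with
  | zero => simp
  | add y z _ _ hy hz =>
    rw [map_add, map_add]
    exact ⟨Submodule.add_mem _ hy.1 hz.1, Submodule.add_mem _ hy.2 hz.2⟩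
  | smul c y _ hy =>
    rw [map_smul, map_smul]
    exact ⟨Submodule.smul_mem _ c hy.1, Submodule.smul_mem _ c hy.2⟩
  | mem y hy =>
    obtain ⟨f, g, rfl⟩ := hy
    refine ⟨Submodule.subset_span ⟨X.convL h f, g, ?_⟩, Submodule.subset_span ⟨f, X.convL g h, ?_⟩⟩
    · rw [← hX.hitL_hitL, LinearMap.comp_apply, ← LinearMap.comp_apply, hX.hitL_hitR]
      rfl
    · rw [← hX.hitR_hitR]
      rfl

theorem bispan_le {P : Submodule K C} (hP : X.IsBistable P) {x : C} (hx : x ∈ P) :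
    X.bispan x ≤ P := by
  refine Submodule.span_le.2 ?_
  rintro _ ⟨f, g, rfl⟩
  exact (hP _ (hP _ hx f).1 g).2

/-- The finiteness theorem for coalgebras: all two-sided translates of `x` lie in the span of the
finitely many middle legs of the iterated coproduct of `x`. -/
instance bispan_finite (x : C) : FiniteDimensional K (X.bispan x) := by
  classical
  let s : Finset C := (tensorRep (X.comul x)).image Prod.fst
  let t : Finset C := s.biUnion fun a => (tensorRep (X.comul a)).image Prod.snd
  have : X.bispan x ≤ Submodule.span K (t : Set C) := by
    refine Submodule.span_le.2 ?_
    rintro _ ⟨f, g, rfl⟩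
    rw [hitL_apply, map_sw]
    refine Submodule.sum_mem _ fun p hp => ?_
    simp only [map_smul, hitR_apply]
    refine Submodule.smul_mem _ _ (Submodule.sum_mem _ fun q hq => Submodule.smul_mem _ _ ?_)
    exact Submodule.subset_span (Finset.mem_biUnion.2
      ⟨p.1, Finset.mem_image_of_mem _ hp, Finset.mem_image_of_mem _ hq⟩)
  exact Submodule.finiteDimensional_of_le this

variable {e : C}

/-- A nonzero subcoalgebra of a connected coalgebra contains the distinguished grouplike. -/
theorem IsBistable.one_mem (hX : X.IsCoalgebra) (hc : X.coradical = Submodule.span K {e})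
    {P : Submodule K C} (hP : X.IsBistable P) (h : P ≠ ⊥) : e ∈ P := by
  obtain ⟨x, hx, hx0⟩ := P.exists_mem_ne_zero_of_ne_bot h
  -- A nonzero subcoalgebra of least dimension inside `P` is simple. It therefore lies in the
  -- coradical, a line, and contains `e`.
  let S : Set ℕ := {n | ∃ Q ≤ P, X.IsBistable Q ∧ Q ≠ ⊥ ∧ FiniteDimensional K Q ∧
    Module.finrank K Q = n}
  have hS : S.Nonempty := ⟨_, X.bispan x, bispan_le hP hx, hX.bispan_isBistable x,
    (Submodule.ne_bot_iff _).2 ⟨x, hX.mem_bispan x, hx0⟩, bispan_finite x, rfl⟩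
  obtain ⟨Q, hQP, hQ, hQ0, hfin, hn⟩ := Nat.sInf_mem hS
  have hs : X.IsSimpleSubcoalgebra Q := ⟨hQ.isSubcoalgebra, hQ0, fun Q' h' hle => by
    by_contra! hne
    have hlt := Submodule.finrank_lt_finrank_of_lt (lt_of_le_of_ne hle hne.2)
    have := Nat.sInf_le (s := S) ⟨Q', hle.trans hQP, h'.isBistable, hne.1,
      Submodule.finiteDimensional_of_le hle, rfl⟩
    omega⟩
  have hle : Q ≤ Submodule.span K {e} := hc ▸ le_sSup hs
  obtain ⟨y, hy, hy0⟩ := Q.exists_mem_ne_zero_of_ne_bot hQ0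
  obtain ⟨c, rfl⟩ := Submodule.mem_span_singleton.1 (hle hy)
  have hc0 : c ≠ 0 := fun h => hy0 (by rw [h, zero_smul])
  exact hQP (by simpa [smul_smul, inv_mul_cancel₀ hc0] using Q.smul_mem c⁻¹ hy)

/-- The subalgebra of `End C` generated by the translations `x ↦ x₁ f(x₂)`. -/
def hitAlg (X : CoalgData K C) : Subalgebra K (Module.End K C) :=
  Algebra.adjoin K (Set.range X.hitL)

/-- A translation as an element of the algebra generated by all of them. -/
def hitElt (X : CoalgData K C) (f : C →ₗ[K] K) : X.hitAlg :=
  ⟨X.hitL f, Algebra.subset_adjoin ⟨f, rfl⟩⟩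

theorem hitElt_smul (f : C →ₗ[K] K) (x : C) : X.hitElt f • x = X.hitL f x := rfl

theorem IsCoalgebra.hitR_comm (hX : X.IsCoalgebra) (g : C →ₗ[K] K) (b : X.hitAlg) (x : C) :
    X.hitR g (b • x) = b • X.hitR g x := by
  obtain ⟨b, hb⟩ := b
  change (X.hitR g * b) x = (b * X.hitR g) x
  congr 1
  induction hb using Algebra.adjoin_induction with
  | mem y hy =>
    obtain ⟨f, rfl⟩ := hy
    exact (hX.hitL_hitR f g).symm
  | algebraMap r => exact (Algebra.commutes r _).symm
  | add y z _ _ hy hz => rw [mul_add, add_mul, hy, hz]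
  | mul y z _ _ hy hz => rw [← mul_assoc, hy, mul_assoc, hz, mul_assoc]

/-- `x ↦ g(x₁) x₂` as a linear map over the translations from the other side. -/
def IsCoalgebra.hitRLin (hX : X.IsCoalgebra) (g : C →ₗ[K] K) : C →ₗ[X.hitAlg] C where
  toFun := X.hitR g
  map_add' := map_add _
  map_smul' := hX.hitR_comm g

/-- Since `e` is grouplike, its cyclic module is the line `K e`, on which translation by `f` is
multiplication by `f e`. -/
theorem hitElt_smul_smul (he : X.comul e = e ⊗ₜ e) (b : X.hitAlg) : ∃ c : K, b • e = c • e := by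
  obtain ⟨b, hb⟩ := b
  change ∃ c : K, b e = c • e
  induction hb using Algebra.adjoin_induction with
  | mem y hy =>
    obtain ⟨f, rfl⟩ := hy
    exact ⟨f e, by rw [hitL_apply, he, sw_tmul (by fun_prop) (by fun_prop)]⟩
  | algebraMap r => exact ⟨r, rfl⟩
  | add y z _ _ hy hz =>
    obtain ⟨c, hc⟩ := hy
    obtain ⟨d, hd⟩ := hz
    exact ⟨c + d, by rw [LinearMap.add_apply, hc, hd, add_smul]⟩
  | mul y z _ _ hy hz =>
    obtain ⟨c, hc⟩ := hy
    obtain ⟨d, hd⟩ := hz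
    exact ⟨d * c, by rw [Module.End.mul_apply, hd, map_smul, hc, smul_smul]⟩

/-- In a connected coalgebra, functionals vanishing at the grouplike kill simple comodules. -/
theorem IsCoalgebra.hitL_eq_zero_of_simple (hX : X.IsCoalgebra)
    (hc : X.coradical = Submodule.span K {e}) (he : X.comul e = e ⊗ₜ e) (he0 : e ≠ 0)
    (S : Submodule X.hitAlg C) [IsSimpleModule X.hitAlg S] (f : C →ₗ[K] K) (hf : f e = 0)
    (x : C) (hx : x ∈ S) : X.hitL f x = 0 := by
  -- The sum of the images of `S` under the commuting translations is a nonzero subcoalgebra, so it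
  -- contains `e`. Being a sum of images of a simple module it is also semisimple, hence `S` embeds
  -- in the cyclic module of `e`.
  let E : Submodule X.hitAlg C := ⨆ g, S.map (hX.hitRLin g)
  have hSE : S ≤ E := by
    refine le_trans ?_ (le_iSup (fun g => S.map (hX.hitRLin g)) X.counit)
    intro y hy
    refine ⟨y, hy, ?_⟩
    change X.hitR X.counit y = y
    rw [hX.hitR_counit]
    rfl
  have hE : X.IsBistable (E.restrictScalars K) := by
    intro y hy g
    refine ⟨E.smul_mem (X.hitElt g) hy, ?_⟩
    have : E ≤ E.comap (hX.hitRLin g) := by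
      refine iSup_le fun h => ?_
      rintro _ ⟨z, hz, rfl⟩
      refine le_iSup (fun g => S.map (hX.hitRLin g)) (X.convL h g) ⟨z, hz, ?_⟩
      change X.hitR _ z = X.hitR g (X.hitR h z)
      rw [← hX.hitR_hitR]
      rfl
    exact this hy
  have h0 : E.restrictScalars K ≠ ⊥ := by
    have := IsSimpleModule.nontrivial X.hitAlg S
    obtain ⟨y, hy⟩ := exists_ne (0 : S)
    exact (Submodule.ne_bot_iff _).2 ⟨y, hSE y.2, fun h => hy (Subtype.ext h)⟩
  obtain ⟨q, hq, hqe⟩ := S.exists_injective_of_mem_iSup_map _ (hE.one_mem hX hc h0) he0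
  have h1 : X.hitElt f • (⟨x, hx⟩ : S) = 0 := by
    apply hq
    obtain ⟨b, hb⟩ := Submodule.mem_span_singleton.1 (hqe ⟨x, hx⟩)
    obtain ⟨c, hc⟩ := hitElt_smul_smul he b
    rw [map_smul, map_zero, ← hb, hc, hitElt_smul, map_smul, hitL_apply, he,
      sw_tmul (by fun_prop) (by fun_prop), hf, zero_smul, smul_zero]
  exact congrArg Subtype.val h1

/-- The filtration of the coalgebra by iterated translations by functionals vanishing at `e`. -/
def hitFilt (X : CoalgData K C) (e : C) : ℕ → Submodule K C
  | 0 => ⊥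
  | n + 1 => ⨅ f : {f : C →ₗ[K] K // f e = 0}, (hitFilt X e n).comap (X.hitL f)

theorem mem_hitFilt_succ {n : ℕ} {x : C} :
    x ∈ X.hitFilt e (n + 1) ↔ ∀ f : C →ₗ[K] K, f e = 0 → X.hitL f x ∈ X.hitFilt e n := by
  simp [hitFilt]

/-- Induction on dimension: translation by `f` with `f e = 0` annihilates the simple top of `P`, so
it maps `P` into a maximal proper submodule `Q`. To apply the result on simple submodules of `C`,
the quotient `P/Q` is realised inside `C` as the image of `P` under a translation from the other
side. -/
theorem IsCoalgebra.exists_le_hitFilt (hX : X.IsCoalgebra)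
    (hc : X.coradical = Submodule.span K {e}) (he : X.comul e = e ⊗ₜ e) (he0 : e ≠ 0) (n : ℕ) :
    ∀ (P : Submodule X.hitAlg C) [FiniteDimensional K (P.restrictScalars K)],
      Module.finrank K (P.restrictScalars K) = n → ∃ k, P.restrictScalars K ≤ X.hitFilt e k := by
  induction n using Nat.strong_induction_on with
  | _ n ih =>
    intro P hfin hn
    by_cases hP : P = ⊥
    · exact ⟨0, by subst hP; intro x hx; exact hx⟩
    obtain ⟨Q, hQP, hQ⟩ := P.exists_lt_forall_isSimpleModule_map (K := K) hP
    have hQP' : Q.restrictScalars K < P.restrictScalars K := hQP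
    have : FiniteDimensional K (Q.restrictScalars K) := Submodule.finiteDimensional_of_le hQP'.le
    obtain ⟨k, hk⟩ := ih _ (hn ▸ Submodule.finrank_lt_finrank_of_lt hQP') Q rfl
    obtain ⟨y, hyP, hyQ⟩ := SetLike.exists_of_lt hQP'
    obtain ⟨φ, hφy, hφ⟩ := Submodule.exists_le_ker_of_notMem hyQ
    -- For every `f` the value `f (X.hitR φ q)` equals `φ (X.hitL f q)`, which vanishes because `Q`
    -- is stable and `φ` kills `Q`.
    have hQc : Q ≤ LinearMap.ker (hX.hitRLin φ) := by
      intro q hq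
      have h1 : ∀ f : C →ₗ[K] K, f (X.hitR φ q) = 0 := fun f => by
        have h2 : X.hitL f q ∈ Q := Q.smul_mem (X.hitElt f) hq
        have h3 : φ (X.hitL f q) = 0 := hφ h2
        rw [hitL_apply, map_sw] at h3
        rw [hitR_apply, map_sw]
        simpa only [map_smul, smul_eq_mul, mul_comm] using h3
      exact (Module.forall_dual_apply_eq_zero_iff K _).1 h1
    -- The counit of `X.hitR φ y` is `φ y`, which is nonzero.
    have hcy : ¬ P ≤ LinearMap.ker (hX.hitRLin φ) := fun h => by
      have h1 : X.hitR φ y = 0 := h hyP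
      have h2 := congrArg X.counit h1
      rw [hitR_apply, map_sw, map_zero] at h2
      have h3 := hX.sw_counit_right (F := fun a => φ a) (by fun_prop) y
      simp only [map_smul, smul_eq_mul, mul_comm] at h2 h3
      exact hφy (h3.symm.trans h2)
    obtain ⟨hsimple, hle⟩ := hQ _ hQc hcy
    refine ⟨k + 1, fun x hx => mem_hitFilt_succ.2 fun f hf => hk (hle ⟨P.smul_mem (X.hitElt f) hx, ?_⟩)⟩
    have h1 := hX.hitL_eq_zero_of_simple hc he he0 (P.map (hX.hitRLin φ)) f hf
       (hX.hitRLin φ x) ⟨x, hx, rfl⟩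
    exact (hX.hitR_comm φ (X.hitElt f) x).trans h1

theorem IsCoalgebra.exists_mem_hitFilt (hX : X.IsCoalgebra)
    (hc : X.coradical = Submodule.span K {e}) (he : X.comul e = e ⊗ₜ e) (he0 : e ≠ 0) (x : C) :
    ∃ k, x ∈ X.hitFilt e k := by
  let P : Submodule X.hitAlg C :=
    { X.bispan x with
      smul_mem' := by
        rintro ⟨b, hb⟩ y hy
        change b y ∈ X.bispan x
        change y ∈ X.bispan x at hy
        induction hb using Algebra.adjoin_induction generalizing y with
        | mem z hz =>
          obtain ⟨f, rfl⟩ := hz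
          exact (hX.bispan_isBistable x y hy f).1
        | algebraMap r => exact Submodule.smul_mem _ r hy
        | add z w _ _ hz hw => exact Submodule.add_mem _ (hz hy) (hw hy)
        | mul z w _ _ hz hw => exact hz (hw hy) }
  have : FiniteDimensional K (P.restrictScalars K) := bispan_finite (X := X) x
  obtain ⟨k, hk⟩ := hX.exists_le_hitFilt hc he he0 _ P rfl
  exact ⟨k, hk (hX.mem_bispan x)⟩

/-- A functional is convolution invertible if its difference with the counit acts locally
nilpotently. -/
theorem IsCoalgebra.isConvInvertible_of_locally_nilpotent (hX : X.IsCoalgebra) (f : C →ₗ[K] K)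
    (h : ∀ x, ∃ n : ℕ, (X.hitL (X.counit - f) ^ n) x = 0) : X.IsConvInvertible f := by
  set N := X.hitL (X.counit - f) with hN
  have hf : X.hitL f = 1 - N := by
    ext x
    have h1 : X.hitL X.counit x = x := by rw [hX.hitL_counit]; rfl
    have h2 : N x = X.hitL X.counit x - X.hitL f x := by
      rw [hN, hitL_apply, hitL_apply, hitL_apply]
      simp [sw, sub_smul]
    rw [LinearMap.sub_apply, h2, h1, Module.End.one_apply, sub_sub_cancel]
  have hinj : Function.Injective (X.hitL f) := by
    rw [← LinearMap.ker_eq_bot, LinearMap.ker_eq_bot']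
    intro x hx
    rw [hf, LinearMap.sub_apply, Module.End.one_apply, sub_eq_zero] at hx
    obtain ⟨n, hn⟩ := h x
    have : ∀ n : ℕ, (N ^ n) x = x := fun n => by
      induction n with
      | zero => rfl
      | succ n ih => rw [pow_succ, Module.End.mul_apply, ← hx, ih]
    rw [← this n, hn]
  have hsurj : Function.Surjective (X.hitL f) := fun x => by
    obtain ⟨n, hn⟩ := h x
    refine ⟨(∑ i ∈ Finset.range n, N ^ i) x, ?_⟩
    rw [hf, ← Module.End.mul_apply, mul_neg_geom_sum, LinearMap.sub_apply, hn, sub_zero]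
    rfl
  -- Convolution of functionals becomes composition of their translations. So the functional to try
  -- is the counit applied to the inverse operator, which on each element is a finite geometric
  -- series in `N`.
  let L := LinearEquiv.ofBijective (X.hitL f) ⟨hinj, hsurj⟩
  let f' : C →ₗ[K] K := X.counit ∘ₗ L.symm.toLinearMap
  have hcomp (a b : C →ₗ[K] K) : X.convL a b = a ∘ₗ X.hitL b := by
    rw [hitL, comp_convR, LinearMap.comp_id, convR_eq_convL]
  have h₂ : X.convL f' f = X.counit := by
    rw [hcomp]
    ext x
    exact congrArg X.counit (L.symm_apply_apply x)
  -- The identity `f' * f = ε` makes translation by `f'` a left inverse of a bijection, hence a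
  -- two-sided inverse. This yields `f * f' = ε`.
  have h₁ : X.hitL f' ∘ₗ X.hitL f = LinearMap.id := by
    rw [hX.hitL_hitL, h₂, hX.hitL_counit]
  have h₃ : X.hitL f ∘ₗ X.hitL f' = LinearMap.id := by
    ext x
    obtain ⟨y, rfl⟩ := hsurj x
    exact congrArg (X.hitL f) (LinearMap.congr_fun h₁ y)
  refine ⟨f', ?_, h₂⟩
  rw [← hX.counit_convL (X.convL f f'), hcomp, ← hX.hitL_hitL, h₃, LinearMap.comp_id]

end CoalgData
end ConnectedCoalgebras

/-! ### Invertibility of functionals on the braided square of a connected pre-bialgebra. -/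

section GaugeInvertible

variable {K : Type*} [Field K]
variable {M V H : Type*} [AddCommMonoid M] [Module K M]
  [AddCommGroup V] [Module K V] [Ring H] [HopfAlgebra K H]

theorem lin_toLinearMap {W : Type*} [AddCommMonoid W] [Module K W] {F : V → W} (hF : Lin K F) :
    ∃ φ : V →ₗ[K] W, ∀ x, φ x = F x := ⟨⟨⟨F, hF.add⟩, hF.smul⟩, fun _ => rfl⟩

namespace YDMulCoalgData

variable {X : YDMulCoalgData K H V} {ξ : V ⊗[K] V →ₗ[K] H}

theorem IsPreBialgebra.one_ne_zero (hX : X.IsPreBialgebra) : X.one ≠ 0 := fun h => by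
  have := hX.counit_one
  rw [h, map_zero] at this
  exact zero_ne_one this

/-- Translation by `g` sends `r ⊗ s` to the sum of `r⁽¹⁾ ⊗ G(r⁽²⁾)` for a linear `G` depending on
`s`, and `G` vanishes at `1` because the coaction of `1` is trivial. Each slice is thus a translate
of `r` by a functional vanishing at `1`. -/
theorem IsPreBialgebra.hitL_mem (hX : X.IsPreBialgebra) (g : V ⊗[K] V →ₗ[K] K)
    (hg : ∀ s, g (X.one ⊗ₜ s) = 0) (k : ℕ) (z : V ⊗[K] V)
    (hz : z ∈ LinearMap.range ((X.hitFilt X.one (k + 1)).subtype.rTensor V)) :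
    X.sq.hitL g z ∈ LinearMap.range ((X.hitFilt X.one k).subtype.rTensor V) := by
  obtain ⟨t, rfl⟩ := hz
  induction t with
  | zero => rw [map_zero, map_zero]; exact Submodule.zero_mem _
  | add t u ht hu => rw [map_add, map_add]; exact Submodule.add_mem _ ht hu
  | tmul r s =>
    obtain ⟨r, hr⟩ := r
    obtain ⟨G, hG⟩ := lin_toLinearMap (K := K) (F := fun b : V => sw (X.comul s) fun s₁ s₂ =>
      sw (X.coact b) fun h c => g (c ⊗ₜ s₂) • X.actT (h ⊗ₜ s₁)) (by fun_prop)
    have e : X.sq.hitL g (r ⊗ₜ s) = sw (X.comul r) fun a b => a ⊗ₜ[K] G b := by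
      simp (disch := fun_prop) only [CoalgData.hitL_apply, sq_comul_tmul, sw_sw, sw_tmul, hG,
        tmul_sw, TensorProduct.tmul_smul]
    refine mem_range_rTensor_of_functionals _ _ fun φ => ?_
    rw [LinearMap.rTensor_tmul, Submodule.subtype_apply, e]
    simp (disch := fun_prop) only [sw_sw, sw_tmul]
    have h := CoalgData.mem_hitFilt_succ.1 hr (φ ∘ₗ G) (by
      rw [LinearMap.comp_apply, hG, hX.coact_one]
      simp (disch := fun_prop) only [sw_tmul, hg, zero_smul, sw_fun_zero, map_zero])
    rw [CoalgData.hitL_apply] at h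
    exact h

/-- Filtering only the first tensor factor is enough. Translation by `ε - f` lowers that filtration
by one step, and the filtration starts at zero, so the translation is locally nilpotent. -/
theorem IsPreBialgebra.sq_isConvInvertible (hX : X.IsPreBialgebra) (hc : X.IsConnected)
    (f : V ⊗[K] V →ₗ[K] K) (hf : ∀ s, f (X.one ⊗ₜ s) = X.counit s) :
    X.sq.IsConvInvertible f := by
  have hq := hX.sq_isBraidedCoalgebra.comod.isCoalgebra
  refine hq.isConvInvertible_of_locally_nilpotent f ?_
  set g := X.sq.counit - f
  have hg : ∀ s, g (X.one ⊗ₜ s) = 0 := fun s => by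
    have e : X.sq.counit (X.one ⊗ₜ s) = X.counit X.one * X.counit s := rfl
    rw [LinearMap.sub_apply, hf, e, hX.counit_one, _root_.one_mul, sub_self]
  have key : ∀ k : ℕ, ∀ z ∈ LinearMap.range ((X.hitFilt X.one k).subtype.rTensor V),
      (X.sq.hitL g ^ k) z = 0 := fun k => by
    induction k with
    | zero =>
      rintro _ ⟨t, rfl⟩
      have : (X.hitFilt X.one 0).subtype = 0 := LinearMap.ext fun x => x.2
      rw [this, LinearMap.rTensor_zero]
      simp
    | succ k ih =>
      intro z hz
      rw [pow_succ, Module.End.mul_apply]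
      exact ih _ (hX.hitL_mem g hg k z hz)
  intro z
  induction z with
  | zero => exact ⟨0, map_zero _⟩
  | add x y hx hy =>
    obtain ⟨m, hm⟩ := hx
    obtain ⟨n, hn⟩ := hy
    refine ⟨m + n, ?_⟩
    rw [map_add, pow_add, Module.End.mul_apply _ _ y, hn, map_zero, add_zero, ← pow_add, add_comm,
      pow_add, Module.End.mul_apply, hm, map_zero]
  | tmul r s =>
    obtain ⟨k, hk⟩ := hX.isBraidedCoalgebra.comod.isCoalgebra.exists_mem_hitFilt hc hX.comul_one
      hX.one_ne_zero r
    exact ⟨k, key k _ ⟨⟨r, hk⟩ ⊗ₜ s, rfl⟩⟩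

end YDMulCoalgData
end GaugeInvertible

/-! ### Invariant functionals and the coalgebra maps from powers of `A` to powers of `R`. -/

section Gauge

variable {K : Type*} [Field K]
variable {M V W U H : Type*} [AddCommMonoid M] [Module K M]
  [AddCommGroup V] [Module K V] [AddCommGroup W] [Module K W] [AddCommGroup U] [Module K U]
  [Ring H] [HopfAlgebra K H]

instance tensor₄AddCommGroup {D : Type*} [AddCommGroup D] [Module K D] :
    AddCommGroup (D ⊗[K] D ⊗[K] D ⊗[K] D) := TensorProduct.addCommGroup

instance tensorTensorAddCommGroup {A B C D : Type*} [AddCommGroup A] [Module K A]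
    [AddCommGroup B] [Module K B] [AddCommGroup C] [Module K C] [AddCommGroup D] [Module K D] :
    AddCommGroup ((A ⊗[K] B) ⊗[K] (C ⊗[K] D)) := TensorProduct.addCommGroup

/-! Invariant functionals on module coalgebras. -/

/-- `f(h w) = ε(h) f(w)`. -/
def IsActInvariant (μ : H ⊗[K] W →ₗ[K] W) (f : W →ₗ[K] K) : Prop :=
  ∀ h w, f (μ (h ⊗ₜ w)) = Coalgebra.counit (R := K) h * f w

namespace IsModuleCoalgebra

variable {Y : CoalgData K W} {μ : H ⊗[K] W →ₗ[K] W}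

theorem act_isCoalgHom (hY : IsModuleCoalgebra Y μ) :
    IsCoalgHom ((hopfCoalg K H).tensor Y) Y μ where
  comul := by
    refine TensorProduct.ext' fun h w => ?_
    simp (disch := fun_prop) only [LinearMap.comp_apply, hY.comul_act, tensor_comul_tmul, map_eq_sw,
      sw_sw, sw_tmul, hopfCoalg_comul]
  counit := by
    refine TensorProduct.ext' fun h w => ?_
    rw [LinearMap.comp_apply, hY.counit_act]
    rfl

theorem isInvariant_iff (f : W →ₗ[K] K) :
    IsActInvariant μ f ↔ f ∘ₗ μ = f ∘ₗ (hopfCoalg K H).dropLeft W := by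
  refine ⟨fun h => TensorProduct.ext' fun g w => ?_, fun h g w => ?_⟩
  · rw [LinearMap.comp_apply, h, LinearMap.comp_apply, dropLeft_tmul, map_smul]
    rfl
  · refine (LinearMap.congr_fun h (g ⊗ₜ w)).trans ?_
    rw [LinearMap.comp_apply, dropLeft_tmul, map_smul]
    rfl

/-- Invariance says that `f` has the same pullback along two coalgebra maps out of `H ⊗ W`, the
action and `h ⊗ w ↦ ε(h)w`. The pullbacks of `f'` are inverse to that common functional, so they
coincide. -/
theorem isInvariant_inverse (hY : IsModuleCoalgebra Y μ) {f f' : W →ₗ[K] K}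
    (h : Y.IsConvInverse f f') (hf : IsActInvariant μ f) : IsActInvariant μ f' := by
  rw [isInvariant_iff] at hf ⊢
  have h₁ := h.comp hY.act_isCoalgHom
  have h₂ := h.comp (IsCoalgHom.dropLeft (hopfCoalg_isCoalgebra K H) Y)
  rw [hf] at h₁
  exact h₁.unique (tensor_isCoalgebra (hopfCoalg_isCoalgebra K H) hY.isCoalgebra) h₂

theorem isInvariant_convL (hY : IsModuleCoalgebra Y μ) {f g : W →ₗ[K] K}
    (hf : IsActInvariant μ f) (hg : IsActInvariant μ g) : IsActInvariant μ (Y.convL f g) := by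
  rw [isInvariant_iff] at hf hg ⊢
  rw [hY.act_isCoalgHom.convL_comp, hf, hg,
    (IsCoalgHom.dropLeft (hopfCoalg_isCoalgebra K H) Y).convL_comp]

theorem convL_act (hY : IsModuleCoalgebra Y μ) {f : W →ₗ[K] K} {ν : H ⊗[K] U →ₗ[K] U}
    {g : W →ₗ[K] U} (hf : IsActInvariant μ f)
    (hg : ∀ h w, g (μ (h ⊗ₜ w)) = ν (h ⊗ₜ g w)) (h : H) (w : W) :
    Y.convL f g (μ (h ⊗ₜ w)) = ν (h ⊗ₜ Y.convL f g w) := by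
  simp (disch := fun_prop) only [convL_apply, hY.comul_act, sw_sw, sw_tmul, hf _ _, hg, tmul_sw,
    map_sw, TensorProduct.tmul_smul, map_smul, mul_smul,
    sw_comm (Coalgebra.comul _) (Y.comul _), hopf_sw_counit_left, smul_comm (Coalgebra.counit _)]
  refine sw_congr fun a b => ?_
  simp (disch := fun_prop) only [smul_comm (f a), hopf_sw_counit_left]

theorem convR_act (hY : IsModuleCoalgebra Y μ) {f : W →ₗ[K] K} {ν : H ⊗[K] U →ₗ[K] U}
    {g : W →ₗ[K] U} (hf : IsActInvariant μ f)
    (hg : ∀ h w, g (μ (h ⊗ₜ w)) = ν (h ⊗ₜ g w)) (h : H) (w : W) :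
    Y.convR g f (μ (h ⊗ₜ w)) = ν (h ⊗ₜ Y.convR g f w) := by
  simp (disch := fun_prop) only [convR_apply, hY.comul_act, sw_sw, sw_tmul, hf _ _, hg, tmul_sw,
    map_sw, TensorProduct.tmul_smul, map_smul, mul_smul,
    sw_comm (Coalgebra.comul _) (Y.comul _), hopf_sw_counit_right]

end IsModuleCoalgebra

theorem IsCoalgHom.eq_of_comp {C D : Type*} [AddCommGroup C] [Module K C] [AddCommGroup D]
    [Module K D] {φ : C →ₗ[K] D} (hφ : Function.Surjective φ) {f g : D →ₗ[K] U}
    (h : f ∘ₗ φ = g ∘ₗ φ) : f = g := by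
  ext x
  obtain ⟨y, rfl⟩ := hφ x
  exact LinearMap.congr_fun h y

/-! The maps from tensor powers of the smash product to tensor powers of the base. -/

namespace YDData

variable (X : YDData K H V)

variable (U) in
/-- `(y # h) ⊗ (s # l) ↦ y ⊗ h s ε(l)`. -/
def slideFst : (U ⊗[K] H) ⊗[K] (V ⊗[K] H) →ₗ[K] U ⊗[K] V :=
  smashFst K (U ⊗[K] V) H ∘ₗ slide X.actDiag

variable {X}

theorem slide_actDiag_tmul (y : U) (s : V) (h l : H) :
    slide X.actDiag ((y ⊗ₜ h) ⊗ₜ (s ⊗ₜ l)) = sw (Coalgebra.comul (R := K) h) fun h₁ h₂ =>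
      (y ⊗ₜ X.actT (h₁ ⊗ₜ s)) ⊗ₜ (h₂ * l) := by
  simp (disch := fun_prop) only [YDData.actDiag_eq, slide_tmul, diagAct_tmul, sw_sw, sw_tmul,
    LinearMap.mul'_apply]

theorem slideFst_tmul (y : U) (h : H) (w : V ⊗[K] H) :
    X.slideFst U ((y ⊗ₜ h) ⊗ₜ w) = y ⊗ₜ X.actT (h ⊗ₜ smashFst K V H w) := by
  induction w with
  | zero => simp
  | add x y hx hy => simp only [TensorProduct.tmul_add, map_add, hx, hy]
  | tmul s l =>
    simp (disch := fun_prop) only [slideFst, LinearMap.comp_apply, slide_actDiag_tmul, map_sw,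
      smashFst_tmul, Bialgebra.counit_mul, mul_smul, hopf_sw_counit_right, map_smul,
      TensorProduct.tmul_smul]

theorem funcTensor_slide_actFirst (α : U ⊗[K] V →ₗ[K] K) :
    funcTensor α Coalgebra.counit ∘ₗ slide X.actFirst = α ∘ₗ X.slideFst U := by
  refine TensorProduct.ext_fourfold' fun y h s l => ?_
  simp (disch := fun_prop) only [LinearMap.comp_apply, slideFst_tmul, slide_tmul, actFirst,
    LinearEquiv.coe_coe, TensorProduct.assoc_symm_tmul, LinearMap.rTensor_tmul, sw_tmul,
    funcTensor_eq_sw, smashFst_tmul, TensorProduct.tmul_smul, map_smul, smul_eq_mul, mul_comm]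

variable (X) in
/-- `(r # h) ⊗ (s # l) ⊗ (t # k) ↦ (r ⊗ h₁ s ⊗ h₂ l₁ t) # h₃ l₂ k`. -/
def slide₃ : (V ⊗[K] H) ⊗[K] (V ⊗[K] H) ⊗[K] (V ⊗[K] H) →ₗ[K] (V ⊗[K] V ⊗[K] V) ⊗[K] H :=
  slide X.actDiag ∘ₗ (slide X.actDiag).rTensor (V ⊗[K] H)

variable (X) in
/-- `(r # h) ⊗ (s # l) ⊗ (t # k) ↦ r ⊗ h₁ s ⊗ h₂ l t ε(k)`. -/
def slideFst₃ : (V ⊗[K] H) ⊗[K] (V ⊗[K] H) ⊗[K] (V ⊗[K] H) →ₗ[K] V ⊗[K] V ⊗[K] V :=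
  X.slideFst (V ⊗[K] V) ∘ₗ (slide X.actDiag).rTensor (V ⊗[K] H)

variable (X) in
/-- `(r # h) ⊗ (s # l) ⊗ (t # k) ⊗ (u # j) ↦ r ⊗ h₁ s ⊗ h₂ l₁ t ⊗ h₃ l₂ k u ε(j)`. -/
def slideFst₄ : (V ⊗[K] H) ⊗[K] (V ⊗[K] H) ⊗[K] (V ⊗[K] H) ⊗[K] (V ⊗[K] H) →ₗ[K]
    V ⊗[K] V ⊗[K] V ⊗[K] V :=
  X.slideFst (V ⊗[K] V ⊗[K] V) ∘ₗ X.slide₃.rTensor (V ⊗[K] H)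

theorem slideFst₃_eq : X.slideFst₃ = smashFst K _ H ∘ₗ X.slide₃ := rfl

/-- As a pullback along what will be a coalgebra map, `℧²` preserves convolution products and
inverses. -/
theorem mho₂_eq (v : V ⊗[K] V →ₗ[K] K) : X.mho₂ v = v ∘ₗ X.slideFst V :=
  funcTensor_slide_actFirst v

theorem mho₃_eq (α : V ⊗[K] V ⊗[K] V →ₗ[K] K) : X.mho₃ α = α ∘ₗ X.slideFst₃ := by
  rw [mho₃, ← LinearMap.comp_assoc, funcTensor_slide_actFirst]
  rfl

theorem smashFst_surjective : Function.Surjective (smashFst K V H) := fun v =>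
  ⟨v ⊗ₜ 1, by rw [smashFst_tmul, Bialgebra.counit_one, one_smul]⟩

/-- Taking the first `H`-component to be `1` already reaches every pure tensor. Surjectivity is what
lets identities on `A` descend to `R`. -/
theorem slide_actDiag_surjective : Function.Surjective (slide (Y := U) X.actDiag) := by
  intro t
  induction t with
  | zero => exact ⟨0, map_zero _⟩
  | add x y hx hy =>
    obtain ⟨a, rfl⟩ := hx
    obtain ⟨b, rfl⟩ := hy
    exact ⟨a + b, map_add _ _ _⟩
  | tmul z l =>
    induction z with
    | zero => exact ⟨0, by rw [map_zero, TensorProduct.zero_tmul]⟩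
    | add x y hx hy =>
      obtain ⟨a, ha⟩ := hx
      obtain ⟨b, hb⟩ := hy
      exact ⟨a + b, by rw [map_add, ha, hb, TensorProduct.add_tmul]⟩
    | tmul y s =>
      refine ⟨(y ⊗ₜ 1) ⊗ₜ (s ⊗ₜ l), ?_⟩
      rw [slide_actDiag_tmul, hopf_comul_one, sw_tmul (by fun_prop) (by fun_prop), actT_tmul,
        map_one, one_mul]
      rfl

theorem slideFst_surjective : Function.Surjective (X.slideFst U) :=
  smashFst_surjective.comp slide_actDiag_surjective

theorem slide₃_surjective : Function.Surjective X.slide₃ :=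
  slide_actDiag_surjective.comp (LinearMap.rTensor_surjective _ slide_actDiag_surjective)

theorem slideFst₃_surjective : Function.Surjective X.slideFst₃ :=
  smashFst_surjective.comp slide₃_surjective

theorem slideFst₄_surjective : Function.Surjective X.slideFst₄ :=
  slideFst_surjective.comp (LinearMap.rTensor_surjective _ slide₃_surjective)

end YDData

namespace YDMulCoalgData

variable {X : YDMulCoalgData K H V} {ξ : V ⊗[K] V →ₗ[K] H}

namespace IsPreBialgebra

variable (hX : X.IsPreBialgebra)
include hX

theorem slide_hom : IsCoalgHom (X.smash ξ).X₂ (smashCoalg X.sq.toCoalgData X.sq.coact)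
    (slide X.actDiag) :=
  slide_diagAct_isCoalgHom hX.isBraidedCoalgebra.comod hX.isBraidedCoalgebra

theorem slideFst_hom : IsCoalgHom (X.smash ξ).X₂ X.sq.toCoalgData (X.slideFst V) :=
  (smashFst_isCoalgHom hX.sq_isBraidedCoalgebra.comod).comp hX.slide_hom

theorem slide₃_hom : IsCoalgHom (X.smash ξ).X₃ (smashCoalg X.cube.toCoalgData X.cube.coact)
    X.slide₃ :=
  (slide_diagAct_isCoalgHom hX.sq_isBraidedCoalgebra.comod hX.isBraidedCoalgebra).comp
    (hX.slide_hom.rTensor _)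

theorem slideFst₃_hom : IsCoalgHom (X.smash ξ).X₃ X.cube.toCoalgData X.slideFst₃ :=
  (smashFst_isCoalgHom hX.cube_isBraidedCoalgebra.comod).comp hX.slide₃_hom

theorem slideFst₄_hom : IsCoalgHom (X.smash ξ).X₄ (X.cube.tensor X.toYDCoalgData).toCoalgData
    X.slideFst₄ :=
  (smashFst_isCoalgHom (cross_isComoduleCoalgebra hX.cube_isBraidedCoalgebra.comod
    hX.isBraidedCoalgebra)).comp
  ((slide_diagAct_isCoalgHom hX.cube_isBraidedCoalgebra.comod hX.isBraidedCoalgebra).comp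
    (hX.slide₃_hom.rTensor _))

end IsPreBialgebra

end YDMulCoalgData

end Gauge

/-! ### The gauge `v = (λξ)⁻¹` and the twisted multiplication. -/

section GaugeOfCocycle

variable {K : Type*} [Field K]
variable {M V W U H : Type*} [AddCommMonoid M] [Module K M]
  [AddCommGroup V] [Module K V] [AddCommGroup W] [Module K W] [AddCommGroup U] [Module K U]
  [Ring H] [HopfAlgebra K H]

/-- Convolution with a functional pulled back from the base of a smash coproduct. -/
theorem smash_convL_rTensor {Z : CoalgData K W} {τ : W →ₗ[K] H ⊗[K] W}
    (hZ : IsComoduleCoalgebra Z τ) (f : W →ₗ[K] K) (g : W →ₗ[K] U) :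
    (smashCoalg Z τ).convL (f ∘ₗ smashFst K W H) (g.rTensor H) = (Z.convL f g).rTensor H := by
  refine TensorProduct.ext' fun z h => ?_
  simp (disch := fun_prop) only [convL_apply, smash_comul_tmul, sw_sw, sw_tmul, LinearMap.comp_apply,
    smashFst_tmul, LinearMap.rTensor_tmul, map_smul, smul_assoc, Bialgebra.counit_mul, mul_smul,
    hZ.sw_counit, hopf_sw_counit_left, sw_tmul_right, smul_comm _ (f _), ← smul_sw,
    ← TensorProduct.smul_tmul']

namespace YDMulCoalgData

variable {X : YDMulCoalgData K H V} {ξ : V ⊗[K] V →ₗ[K] H} {lam : H →ₗ[K] K}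
  {v : V ⊗[K] V →ₗ[K] K}

theorem IsPreBialgebra.insert_left_hom (hX : X.IsPreBialgebra) :
    IsCoalgHom X.toCoalgData X.sq.toCoalgData (TensorProduct.mk K V V X.one) :=
  .of_apply
    (fun s => by
      simp (disch := fun_prop) only [TensorProduct.mk_apply, sq_comul_tmul, hX.comul_one, sw_tmul,
        hX.coact_one, hX.isBraidedCoalgebra.mod.one_act])
    (fun s => by
      have e : X.sq.counit (X.one ⊗ₜ s) = X.counit X.one * X.counit s := rfl
      rw [TensorProduct.mk_apply, e, hX.counit_one, _root_.one_mul])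

theorem IsPreBialgebra.insert_right_hom (hX : X.IsPreBialgebra) :
    IsCoalgHom X.toCoalgData X.sq.toCoalgData ((TensorProduct.mk K V V).flip X.one) :=
  .of_apply
    (fun s => by
      simp (disch := fun_prop) only [LinearMap.flip_apply, TensorProduct.mk_apply, sq_comul_tmul,
        hX.comul_one, sw_tmul, hX.act_one, TensorProduct.tmul_smul, ← TensorProduct.smul_tmul',
        hX.isBraidedCoalgebra.comod.sw_counit])
    (fun s => by
      have e : X.sq.counit (s ⊗ₜ X.one) = X.counit s * X.counit X.one := rfl
      rw [LinearMap.flip_apply, TensorProduct.mk_apply, e, hX.counit_one, _root_.mul_one])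

theorem isConvInverse_one_left (hX : X.IsPreBialgebra) {f : V ⊗[K] V →ₗ[K] K}
    (hv : X.sq.IsConvInverse f v) (hf : ∀ s, f (X.one ⊗ₜ s) = X.counit s) (s : V) :
    v (X.one ⊗ₜ s) = X.counit s := by
  have h := hv.comp hX.insert_left_hom
  have e : f ∘ₗ TensorProduct.mk K V V X.one = X.counit := LinearMap.ext hf
  have hc := hX.isBraidedCoalgebra.comod.isCoalgebra
  rw [e] at h
  exact LinearMap.congr_fun (h.unique hc ⟨hc.counit_convL _, hc.counit_convL _⟩) s

theorem isConvInverse_one_right (hX : X.IsPreBialgebra) {f : V ⊗[K] V →ₗ[K] K}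
    (hv : X.sq.IsConvInverse f v) (hf : ∀ s, f (s ⊗ₜ X.one) = X.counit s) (s : V) :
    v (s ⊗ₜ X.one) = X.counit s := by
  have h := hv.comp hX.insert_right_hom
  have e : f ∘ₗ (TensorProduct.mk K V V).flip X.one = X.counit := LinearMap.ext hf
  have hc := hX.isBraidedCoalgebra.comod.isCoalgebra
  rw [e] at h
  exact LinearMap.congr_fun (h.unique hc ⟨hc.counit_convL _, hc.counit_convL _⟩) s

namespace IsCocycle

variable (hξ : X.IsCocycle ξ) (hlam : IsAdInvariantIntegral lam)
include hξ hlam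

theorem lam_one_left (s : V) : (lam ∘ₗ ξ) (X.one ⊗ₜ s) = X.counit s := by
  rw [LinearMap.comp_apply, hξ.unital_left, map_smul, hlam.map_one, smul_eq_mul, _root_.mul_one]

theorem lam_one_right (s : V) : (lam ∘ₗ ξ) (s ⊗ₜ X.one) = X.counit s := by
  rw [LinearMap.comp_apply, hξ.unital_right, map_smul, hlam.map_one, smul_eq_mul, _root_.mul_one]

/-- Here ad-invariance of the integral enters, since `ξ` is linear for the adjoint action on `H`. -/
theorem lam_isActInvariant : IsActInvariant X.sq.actT (lam ∘ₗ ξ) := fun h z => by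
  rw [LinearMap.comp_apply, YDData.actT_tmul, hξ.linear, hlam.ad_left]
  rfl

/-- `ξ(z⁽¹⁾) z⁽²⁾₋₁ λξ(z⁽²⁾₀) = λξ(z) 1`. -/
theorem sw_integral {F : H → M} (hF : Lin K F) (z : V ⊗[K] V) :
    sw (X.sq.comul z) (fun a b => sw (X.sq.coact b) fun g c => lam (ξ c) • F (ξ a * g)) =
      lam (ξ z) • F 1 := by
  obtain ⟨φ, hφ⟩ := lin_toLinearMap (K := K) hF
  have h := congrArg φ (hlam.left_integral (ξ z))
  rw [lTensor_eq_sw, rid_eq_sw] at h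
  simp (disch := fun_prop) only [sw_sw, sw_tmul, map_sw, map_smul, hξ.sw_comul] at h
  simp only [hφ] at h
  exact h

end IsCocycle

section

variable (hX : X.IsPreBialgebra) (hξ : X.IsCocycle ξ) (hlam : IsAdInvariantIntegral lam)
  (hv : X.sq.IsConvInverse (lam ∘ₗ ξ) v)
include hX hξ hlam hv

theorem gauge_isActInvariant : IsActInvariant X.sq.actT v :=
  hX.sq_isBraidedCoalgebra.mod.isInvariant_inverse hv (hξ.lam_isActInvariant hlam)

theorem gauge_isConvInverse : (X.smash ξ).X₂.IsConvInverse (X.mho₂ v) ((lam ∘ₗ ξ) ∘ₗ X.slideFst V) := by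
  rw [YDData.mho₂_eq]
  exact hv.symm.comp hX.slideFst_hom

theorem gauge_isGaugeTransformation : (X.smash ξ).IsGaugeTransformation (X.mho₂ v) where
  invertible := ⟨_, gauge_isConvInverse hX hξ hlam hv⟩
  unital_left x := by
    have e : (X.smash ξ).one = X.one ⊗ₜ 1 := rfl
    rw [YDData.mho₂_eq, LinearMap.comp_apply, e, YDData.slideFst_tmul,
      hX.isBraidedCoalgebra.mod.one_act,
      isConvInverse_one_left hX hv (hξ.lam_one_left hlam)]
    exact (smashFst_isCoalgHom hX.isBraidedCoalgebra.comod).counit_apply x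
  unital_right x := by
    have e : (X.smash ξ).one = X.one ⊗ₜ 1 := rfl
    rw [YDData.mho₂_eq, e]
    induction x with
    | zero => simp
    | add x y hx hy => rw [TensorProduct.add_tmul, map_add, map_add, hx, hy]
    | tmul r h =>
      rw [LinearMap.comp_apply, YDData.slideFst_tmul, smashFst_tmul, Bialgebra.counit_one, one_smul,
        hX.act_one, TensorProduct.tmul_smul, map_smul,
        isConvInverse_one_right hX hv (hξ.lam_one_right hlam)]
      change Coalgebra.counit (R := K) h * X.counit r = X.counit r * Coalgebra.counit (R := K) h
      rw [mul_comm]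

/-- The factor `λξ` integrates out the `H`-valued cocycle: by `sw_integral` the element `ξ(b⁽¹⁾)
b⁽²⁾₋₁` weighted by `λξ(b⁽²⁾₀)` is a scalar. What is left acts on the first component only. -/
theorem smashMul_convR :
    (smashCoalg X.sq.toCoalgData X.sq.coact).convR (X.smashMul ξ)
      ((lam ∘ₗ ξ) ∘ₗ smashFst K (V ⊗[K] V) H) = (X.sq.convR X.mul (lam ∘ₗ ξ)).rTensor H := by
  have hq := hX.sq_isBraidedCoalgebra
  refine TensorProduct.ext' fun z h => ?_
  simp (disch := fun_prop) only [convR_apply, smash_comul_tmul, sw_sw, sw_tmul, LinearMap.comp_apply,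
    smashFst_tmul, LinearMap.rTensor_tmul, map_smul, smul_assoc, sw_tmul_right, smashMul_tmul,
    smul_sw]
  simp only [sw_comm (Coalgebra.comul _) (X.sq.coact _), sw_comm (Coalgebra.comul _) (X.sq.comul _)]
  simp (disch := fun_prop) only [hopf_sw_counit_right]
  conv_lhs => enter [2, a, b]; simp only [sw_comm _ (X.sq.comul a)]
  simp (disch := fun_prop) only [hq.comod.isCoalgebra.sw_coassoc]
  refine sw_congr fun a b => ?_
  have := hξ.sw_integral hlam (F := fun y => X.mul a ⊗ₜ[K] (y * h)) (by fun_prop) b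
  simpa only [_root_.mul_assoc, _root_.one_mul, TensorProduct.smul_tmul'] using this

/-- The twisted multiplication of `V`. -/
abbrev mulGauge (X : YDMulCoalgData K H V) (ξ : V ⊗[K] V →ₗ[K] H) (lam : H →ₗ[K] K)
    (v : V ⊗[K] V →ₗ[K] K) : V ⊗[K] V →ₗ[K] V := X.sq.convL v (X.sq.convR X.mul (lam ∘ₗ ξ))

theorem mulTwist_eq : (X.smash ξ).mulTwist (X.mho₂ v) ((lam ∘ₗ ξ) ∘ₗ X.slideFst V) =
    (X.mulGauge ξ lam v).rTensor H ∘ₗ slide X.actDiag := by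
  have hq := hX.sq_isBraidedCoalgebra
  have h := hX.slide_hom (ξ := ξ)
  have e : (X.smash ξ).mulTwist (X.mho₂ v) ((lam ∘ₗ ξ) ∘ₗ X.slideFst V) =
      (X.smash ξ).X₂.convL ((v ∘ₗ smashFst K (V ⊗[K] V) H) ∘ₗ slide X.actDiag)
        ((X.smash ξ).X₂.convR (X.smashMul ξ ∘ₗ slide X.actDiag)
          (((lam ∘ₗ ξ) ∘ₗ smashFst K (V ⊗[K] V) H) ∘ₗ slide X.actDiag)) := by
    rw [MulCoalgData.mulTwist, YDData.mho₂_eq]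
    rfl
  rw [e, ← h.convR_comp, ← h.convL_comp, smashMul_convR hX hξ hlam hv,
    smash_convL_rTensor hq.comod]

end

end YDMulCoalgData

end GaugeOfCocycle

/-! ### The reassociator on the braided cube. -/

section Reassociator

variable {K : Type*} [Field K]
variable {V H : Type*} [AddCommGroup V] [Module K V] [Ring H] [HopfAlgebra K H]

namespace YDMulCoalgData

variable {X : YDMulCoalgData K H V} {ξ : V ⊗[K] V →ₗ[K] H} {lam : H →ₗ[K] K}
  {u v : V ⊗[K] V →ₗ[K] K}

theorem cube_act_tmul (h : H) (z : V ⊗[K] V) (t : V) : X.cube.actT (h ⊗ₜ (z ⊗ₜ t)) =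
    sw (Coalgebra.comul (R := K) h) fun h₁ h₂ => X.sq.actT (h₁ ⊗ₜ z) ⊗ₜ X.actT (h₂ ⊗ₜ t) := by
  have e : X.cube.actT = diagAct X.sq.actT X.actT := YDData.tensor_actT _ _
  rw [e, diagAct_tmul]

theorem slideFst₃_tmul (x y w : V ⊗[K] H) : X.slideFst₃ (x ⊗ₜ y ⊗ₜ w) =
    sw (slide X.actDiag (x ⊗ₜ y)) fun z h => z ⊗ₜ X.actT (h ⊗ₜ smashFst K V H w) := by
  rw [YDData.slideFst₃, LinearMap.comp_apply, LinearMap.rTensor_tmul]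
  conv_lhs => rw [← sw_self (slide X.actDiag (x ⊗ₜ y)), sw_tmul_right, map_sw]
  simp only [YDData.slideFst_tmul]

/-- `r ⊗ s ⊗ t ↦ ε(r) u(s ⊗ t)`. -/
def cubeDrop₁ (X : YDMulCoalgData K H V) (u : V ⊗[K] V →ₗ[K] K) : V ⊗[K] V ⊗[K] V →ₗ[K] K :=
  u ∘ₗ X.dropLeft (V ⊗[K] V) ∘ₗ (TensorProduct.assoc K V V V).toLinearMap

/-- `r ⊗ s ⊗ t ↦ u(r ⊗ s) ε(t)`. -/
def cubeDrop₃ (X : YDMulCoalgData K H V) (u : V ⊗[K] V →ₗ[K] K) : V ⊗[K] V ⊗[K] V →ₗ[K] K :=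
  u ∘ₗ X.dropRight (V ⊗[K] V)

/-- `r ⊗ s ⊗ t ↦ u(r ⊗ s t)`. -/
def cubeMul₂₃ (X : YDMulCoalgData K H V) (u : V ⊗[K] V →ₗ[K] K) : V ⊗[K] V ⊗[K] V →ₗ[K] K :=
  u ∘ₗ X.mul.lTensor V ∘ₗ (TensorProduct.assoc K V V V).toLinearMap

/-- `z ⊗ t ↦ u(m(z⁽¹⁾) ⊗ ξ(z⁽²⁾) t)`. -/
def cubeMul₁₂ (X : YDMulCoalgData K H V) (ξ : V ⊗[K] V →ₗ[K] H) (u : V ⊗[K] V →ₗ[K] K) :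
    V ⊗[K] V ⊗[K] V →ₗ[K] K :=
  u ∘ₗ X.mul.rTensor V ∘ₗ X.actT.lTensor (V ⊗[K] V) ∘ₗ
    (TensorProduct.assoc K (V ⊗[K] V) H V).toLinearMap ∘ₗ
      (ξ.lTensor (V ⊗[K] V) ∘ₗ X.sq.comul).rTensor V

theorem cubeDrop₁_tmul (r s t : V) :
    X.cubeDrop₁ u (r ⊗ₜ s ⊗ₜ t) = X.counit r * u (s ⊗ₜ t) := by
  simp [cubeDrop₁, dropLeft_tmul]

theorem cubeDrop₃_tmul (z : V ⊗[K] V) (t : V) :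
    X.cubeDrop₃ u (z ⊗ₜ t) = X.counit t * u z := by
  simp [cubeDrop₃, dropRight_tmul]

theorem cubeMul₂₃_tmul (r s t : V) :
    X.cubeMul₂₃ u (r ⊗ₜ s ⊗ₜ t) = u (r ⊗ₜ X.mul (s ⊗ₜ t)) := by
  simp [cubeMul₂₃]

theorem cubeMul₁₂_tmul (z : V ⊗[K] V) (t : V) :
    X.cubeMul₁₂ ξ u (z ⊗ₜ t) = sw (X.sq.comul z) fun a b =>
      u (X.mul a ⊗ₜ X.actT (ξ b ⊗ₜ t)) := by
  simp (disch := fun_prop) only [cubeMul₁₂, LinearMap.comp_apply, LinearEquiv.coe_coe,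
    rTensor_eq_sw, lTensor_eq_sw, assoc_eq_sw, sw_sw, sw_tmul, map_sw, sw_tmul_right]

section

variable (hX : X.IsPreBialgebra) (hξ : X.IsCocycle ξ) (hu : IsActInvariant X.sq.actT u)
include hX hu

theorem cubeDrop₁_isActInvariant : IsActInvariant X.cube.actT (X.cubeDrop₁ u) := fun h c => by
  induction c with
  | zero => simp
  | add x y hx hy => simp only [TensorProduct.tmul_add, map_add, hx, hy, mul_add]
  | tmul z t =>
    induction z with
    | zero => simp
    | add x y hx hy =>
      simp only [TensorProduct.add_tmul, TensorProduct.tmul_add, map_add, hx, hy, mul_add]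
    | tmul r s =>
      have e : ∀ h, u (sw (Coalgebra.comul (R := K) h) fun h₁ h₂ =>
          X.actT (h₁ ⊗ₜ s) ⊗ₜ X.actT (h₂ ⊗ₜ t)) = Coalgebra.counit (R := K) h * u (s ⊗ₜ t) :=
        fun h => by rw [← sq_act_tmul, hu]
      simp (disch := fun_prop) only [cube_act_tmul, sq_act_tmul, sw_tmul_right, map_sw,
        cubeDrop₁_tmul, hX.isBraidedCoalgebra.mod.counit_act, hopf_sw_coassoc, smul_eq_mul,
        mul_assoc] at e ⊢
      simp (disch := fun_prop) only [← mul_sw, e]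
      have := hopf_sw_counit_left (K := K) (F := fun b : H => X.counit r *
        (Coalgebra.counit (R := K) b * u (s ⊗ₜ t))) (by fun_prop) h
      simp only [smul_eq_mul] at this
      rw [this]
      ring

theorem cubeDrop₃_isActInvariant : IsActInvariant X.cube.actT (X.cubeDrop₃ u) := fun h c => by
  induction c with
  | zero => simp
  | add x y hx hy => simp only [TensorProduct.tmul_add, map_add, hx, hy, mul_add]
  | tmul z t =>
    simp (disch := fun_prop) only [cube_act_tmul, map_sw, cubeDrop₃_tmul, hu _ _,
      hX.isBraidedCoalgebra.mod.counit_act]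
    have := hopf_sw_counit_left (K := K) (F := fun b : H => Coalgebra.counit (R := K) b *
      (X.counit t * u z)) (by fun_prop) h
    rw [← this]
    refine sw_congr fun a b => ?_
    simp only [smul_eq_mul]
    ring

theorem cubeMul₂₃_isActInvariant : IsActInvariant X.cube.actT (X.cubeMul₂₃ u) := fun h c => by
  induction c with
  | zero => simp
  | add x y hx hy => simp only [TensorProduct.tmul_add, map_add, hx, hy, mul_add]
  | tmul z t =>
    induction z with
    | zero => simp
    | add x y hx hy =>
      simp only [TensorProduct.add_tmul, TensorProduct.tmul_add, map_add, hx, hy, mul_add]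
    | tmul r s =>
      rw [cubeMul₂₃_tmul, ← hu]
      simp (disch := fun_prop) only [cube_act_tmul, sq_act_tmul, sw_tmul_right, map_sw,
        cubeMul₂₃_tmul, hopf_sw_coassoc, ← hX.mul_act, tmul_sw]

include hξ

theorem cubeMul₁₂_isActInvariant : IsActInvariant X.cube.actT (X.cubeMul₁₂ ξ u) := fun h c => by
  have hq := hX.sq_isBraidedCoalgebra
  have hb := hX.isBraidedCoalgebra
  induction c with
  | zero => simp
  | add x y hx hy => simp only [TensorProduct.tmul_add, map_add, hx, hy, mul_add]
  | tmul z t =>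
    simp (disch := fun_prop) only [cube_act_tmul, map_sw, cubeMul₁₂_tmul, hq.mod.comul_act,
      sw_sw, sw_tmul, hX.mul_act, mul_sw, ← hu h _, sq_act_tmul, hopf_sw_coassoc,
      sw_comm (Coalgebra.comul _) (X.sq.comul _)]
    refine sw_congr fun a b => sw_congr fun h₁ k => ?_
    have := hξ.sw_linear (F := fun y => u (X.actT (h₁ ⊗ₜ X.mul a) ⊗ₜ X.actT (y ⊗ₜ t)))
      (by fun_prop) k b
    simpa only [hb.mod.mul_act] using this

end

/-- Extensionality on pure tensors of smash products. -/
theorem smash_ext_threefold {N W U : Type*} [AddCommMonoid N] [Module K N] [AddCommGroup W]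
    [Module K W] [AddCommGroup U] [Module K U]
    {f g : (W ⊗[K] H) ⊗[K] (V ⊗[K] H) ⊗[K] U →ₗ[K] N}
    (h : ∀ r h s l w, f ((r ⊗ₜ h) ⊗ₜ (s ⊗ₜ l) ⊗ₜ w) = g ((r ⊗ₜ h) ⊗ₜ (s ⊗ₜ l) ⊗ₜ w)) : f = g := by
  refine TensorProduct.ext ?_
  refine TensorProduct.ext_fourfold' fun r x s l => LinearMap.ext fun w => ?_
  exact h r x s l w

section

variable (hX : X.IsPreBialgebra) (hξ : X.IsCocycle ξ)
include hX

theorem slideFst_drop₃ :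
    (u ∘ₗ X.slideFst V) ∘ₗ (X.smash ξ).drop₃ = X.cubeDrop₃ u ∘ₗ X.slideFst₃ := by
  refine smash_ext_threefold fun r h s l w => ?_
  have e := (smashFst_isCoalgHom hX.isBraidedCoalgebra.comod).counit_apply w
  have e' : (X.smash ξ).drop₃ ((r ⊗ₜ h) ⊗ₜ (s ⊗ₜ l) ⊗ₜ w) =
      X.counit (smashFst K V H w) • ((r ⊗ₜ h) ⊗ₜ (s ⊗ₜ l)) := by
    rw [e]
    exact dropRight_tmul _ _ _
  simp (disch := fun_prop) only [LinearMap.comp_apply, slideFst₃_tmul, YDData.slide_actDiag_tmul,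
    sw_sw, sw_tmul, map_sw, cubeDrop₃_tmul, hX.isBraidedCoalgebra.mod.counit_act,
    Bialgebra.counit_mul, smul_mul_assoc, mul_smul, hopf_sw_counit_right, e', map_smul,
    YDData.slideFst_tmul, smashFst_tmul, TensorProduct.tmul_smul]
  simp only [smul_eq_mul]
  ring

include hξ

theorem slideFst_mul₂₃ :
    (u ∘ₗ X.slideFst V) ∘ₗ (X.smash ξ).mul₂₃ = X.cubeMul₂₃ u ∘ₗ X.slideFst₃ := by
  refine smash_ext_threefold fun r h s l w => ?_
  have e' : (X.smash ξ).mul₂₃ ((r ⊗ₜ h) ⊗ₜ (s ⊗ₜ l) ⊗ₜ w) =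
      (r ⊗ₜ h) ⊗ₜ (X.smash ξ).mul ((s ⊗ₜ l) ⊗ₜ w) := rfl
  simp (disch := fun_prop) only [LinearMap.comp_apply, slideFst₃_tmul, YDData.slide_actDiag_tmul,
    sw_sw, sw_tmul, map_sw, cubeMul₂₃_tmul, e', hX.isBraidedCoalgebra.mod.mul_act,
    YDData.slideFst_tmul, hξ.smashFst_mul hX, ← hX.mul_act, sq_act_tmul, tmul_sw]

theorem slideFst_mul₁₂ :
    (u ∘ₗ X.slideFst V) ∘ₗ (X.smash ξ).mul₁₂ = X.cubeMul₁₂ ξ u ∘ₗ X.slideFst₃ := by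
  refine smash_ext_threefold fun r h s l w => ?_
  have e' : (X.smash ξ).mul₁₂ ((r ⊗ₜ h) ⊗ₜ (s ⊗ₜ l) ⊗ₜ w) =
      (X.smash ξ).mul ((r ⊗ₜ h) ⊗ₜ (s ⊗ₜ l)) ⊗ₜ w := rfl
  simp (disch := fun_prop) only [LinearMap.comp_apply, slideFst₃_tmul, YDData.slide_actDiag_tmul,
    sw_sw, sw_tmul, map_sw, cubeMul₁₂_tmul, e', hX.isBraidedCoalgebra.mod.mul_act,
    YDData.slideFst_tmul, smash_mul_tmul, sw_tmul_right]

end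

section

variable (hX : X.IsPreBialgebra) (hu : IsActInvariant X.sq.actT u)
include hX hu

/-- Among the four faces only this one needs invariance of `u`: the component `h` of the discarded
first factor still acts on the other two. -/
theorem slideFst_drop₁ :
    (u ∘ₗ X.slideFst V) ∘ₗ (X.smash ξ).drop₁ = X.cubeDrop₁ u ∘ₗ X.slideFst₃ := by
  refine smash_ext_threefold fun r h s l w => ?_
  have e' : (X.smash ξ).drop₁ ((r ⊗ₜ h) ⊗ₜ (s ⊗ₜ l) ⊗ₜ w) =
      (X.counit r • Coalgebra.counit (R := K) h) • ((s ⊗ₜ l) ⊗ₜ w) :=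
    dropLeft_tmul (X.smash ξ).toCoalgData (r ⊗ₜ[K] h) ((s ⊗ₜ[K] l) ⊗ₜ[K] w)
  have hi := hu h (s ⊗ₜ X.actT (l ⊗ₜ smashFst K V H w))
  simp (disch := fun_prop) only [sq_act_tmul, map_sw] at hi
  simp (disch := fun_prop) only [LinearMap.comp_apply, slideFst₃_tmul, YDData.slide_actDiag_tmul,
    sw_sw, sw_tmul, map_sw, cubeDrop₁_tmul, e', map_smul, hX.isBraidedCoalgebra.mod.mul_act,
    YDData.slideFst_tmul, ← mul_sw, hi, smul_eq_mul, mul_assoc]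

end

/-- The reassociator of the twisted pre-bialgebra, for a gauge `v` with inverse `f`. -/
def reassocGauge (X : YDMulCoalgData K H V) (ξ : V ⊗[K] V →ₗ[K] H) (v f : V ⊗[K] V →ₗ[K] K) :
    V ⊗[K] V ⊗[K] V →ₗ[K] K :=
  X.cube.convL (X.cubeDrop₁ v) (X.cube.convL (X.cubeMul₂₃ v)
    (X.cube.convL (X.cubeMul₁₂ ξ f) (X.cubeDrop₃ f)))

section

variable (hX : X.IsPreBialgebra) (hξ : X.IsCocycle ξ) (hlam : IsAdInvariantIntegral lam)
  (hv : X.sq.IsConvInverse (lam ∘ₗ ξ) v)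
include hX hξ hlam hv

theorem smash_coboundary₂ : (X.smash ξ).coboundary₂ (X.mho₂ v) =
    X.reassocGauge ξ v (lam ∘ₗ ξ) ∘ₗ X.slideFst₃ := by
  have h := hX.slideFst₃_hom (ξ := ξ)
  have hA := hξ.smash_isUnitalMulCoalgebra hX
  rw [MulCoalgData.coboundary₂_eq, (gauge_isConvInverse hX hξ hlam hv).convInv_eq hA.isCoalgebra₂,
    YDData.mho₂_eq, reassocGauge, h.convL_comp, h.convL_comp, h.convL_comp,
    slideFst_drop₁ hX (gauge_isActInvariant hX hξ hlam hv), slideFst_mul₂₃ hX hξ,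
    slideFst_mul₁₂ hX hξ, slideFst_drop₃ hX]

theorem coboundary₂_eq_reassocGauge : X.coboundary₂ ξ v = X.reassocGauge ξ v (lam ∘ₗ ξ) := by
  refine TensorProduct.ext_threefold fun r s t => ?_
  have hb := hX.isBraidedCoalgebra
  rw [coboundary₂, omega₃, smash_coboundary₂ hX hξ hlam hv]
  simp (disch := fun_prop) only [LinearMap.comp_apply, TensorProduct.map_tmul,
    LinearMap.flip_apply, TensorProduct.mk_apply, slideFst₃_tmul, YDData.slide_actDiag_tmul,
    hopf_comul_one, sw_tmul, smashFst_tmul, Bialgebra.counit_one, one_smul, _root_.mul_one,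
    hb.mod.one_act]

theorem reassocGauge_isActInvariant :
    IsActInvariant X.cube.actT (X.reassocGauge ξ v (lam ∘ₗ ξ)) := by
  have hu := gauge_isActInvariant hX hξ hlam hv
  have hf := hξ.lam_isActInvariant hlam
  have hm := hX.cube_isBraidedCoalgebra.mod
  exact hm.isInvariant_convL (cubeDrop₁_isActInvariant hX hu) <|
    hm.isInvariant_convL (cubeMul₂₃_isActInvariant hX hu) <|
    hm.isInvariant_convL (cubeMul₁₂_isActInvariant hX hξ hf) (cubeDrop₃_isActInvariant hX hf)

/-- Each of the four factors pulls back along `slideFst₃` to a functional on the powers of `A` whose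
inverse is again a pullback. Surjectivity brings these inverse pairs down to the braided cube. -/
theorem reassocGauge_isConvInvertible :
    X.cube.IsConvInvertible (X.reassocGauge ξ v (lam ∘ₗ ξ)) := by
  have hu := gauge_isActInvariant hX hξ hlam hv
  have hf := hξ.lam_isActInvariant hlam
  have h := hX.slideFst₃_hom (ξ := ξ)
  have hA := hξ.smash_isUnitalMulCoalgebra hX
  have hw := hv.symm.comp (hX.slideFst_hom (ξ := ξ))
  have hc := hX.cube_isBraidedCoalgebra.comod.isCoalgebra
  have descend {a b : V ⊗[K] V ⊗[K] V →ₗ[K] K}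
      (hab : (X.smash ξ).X₃.IsConvInverse (a ∘ₗ X.slideFst₃) (b ∘ₗ X.slideFst₃)) :
      X.cube.IsConvInverse a b := by
    constructor
    · refine IsCoalgHom.eq_of_comp (YDData.slideFst₃_surjective (X := X.toYDData)) ?_
      rw [h.convL_comp, hab.1, h.counit]
    · refine IsCoalgHom.eq_of_comp (YDData.slideFst₃_surjective (X := X.toYDData)) ?_
      rw [h.convL_comp, hab.2, h.counit]
  have h₁ := hw.comp hA.drop₁_hom
  have h₂ := hw.comp hA.mul₂₃_hom
  have h₃ := hw.symm.comp hA.mul₁₂_hom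
  have h₄ := hw.symm.comp hA.drop₃_hom
  rw [slideFst_drop₁ hX hu, slideFst_drop₁ hX hf] at h₁
  rw [slideFst_mul₂₃ hX hξ, slideFst_mul₂₃ hX hξ] at h₂
  rw [slideFst_mul₁₂ hX hξ, slideFst_mul₁₂ hX hξ] at h₃
  rw [slideFst_drop₃ hX, slideFst_drop₃ hX] at h₄
  exact ⟨_, (descend h₁).mul hc <| (descend h₂).mul hc <| (descend h₃).mul hc (descend h₄)⟩

end

end YDMulCoalgData
end Reassociator

/-! ### Compatibility of `H`-linear multiplications with `slide`. -/

section Bosonizing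

variable {K : Type*} [Field K]
variable {V Y Y' H : Type*} [AddCommGroup V] [Module K V] [AddCommGroup Y] [Module K Y]
  [AddCommGroup Y'] [Module K Y'] [Ring H] [HopfAlgebra K H]

theorem IsCoalgHom.of_comp {B C D : Type*} [AddCommGroup B] [Module K B] [AddCommGroup C]
    [Module K C] [AddCommGroup D] [Module K D] {X : CoalgData K B} {Z : CoalgData K C}
    {W : CoalgData K D} {φ : B →ₗ[K] C} (hφ : IsCoalgHom X Z φ) (hs : Function.Surjective φ)
    {g : C →ₗ[K] D} (hg : IsCoalgHom X W (g ∘ₗ φ)) : IsCoalgHom Z W g where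
  comul := by
    refine IsCoalgHom.eq_of_comp hs ?_
    rw [LinearMap.comp_assoc, hg.comul, LinearMap.comp_assoc, hφ.comul, TensorProduct.map_comp,
      LinearMap.comp_assoc]
  counit := by
    refine IsCoalgHom.eq_of_comp hs ?_
    rw [LinearMap.comp_assoc, hg.counit, hφ.counit]

theorem smashFst_rTensor (g : Y →ₗ[K] Y') :
    smashFst K Y' H ∘ₗ g.rTensor H = g ∘ₗ smashFst K Y H := by
  refine TensorProduct.ext' fun y h => ?_
  simp only [LinearMap.comp_apply, LinearMap.rTensor_tmul, smashFst_tmul, map_smul]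

namespace YDMulCoalgData

variable {X : YDMulCoalgData K H V} {ξ : V ⊗[K] V →ₗ[K] H} {lam : H →ₗ[K] K}
  {v : V ⊗[K] V →ₗ[K] K}

theorem slide_rTensor (g : Y →ₗ[K] Y') :
    slide X.actDiag ∘ₗ (g.rTensor H).rTensor (V ⊗[K] H) =
      (g.rTensor V).rTensor H ∘ₗ slide X.actDiag := by
  refine TensorProduct.ext_fourfold' fun y h s l => ?_
  simp (disch := fun_prop) only [LinearMap.comp_apply, LinearMap.rTensor_tmul,
    YDData.slide_actDiag_tmul, map_sw]

theorem slideFst_rTensor (g : Y →ₗ[K] Y') :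
    X.slideFst Y' ∘ₗ (g.rTensor H).rTensor (V ⊗[K] H) = g.rTensor V ∘ₗ X.slideFst Y := by
  rw [YDData.slideFst, LinearMap.comp_assoc, slide_rTensor, ← LinearMap.comp_assoc,
    smashFst_rTensor]
  rfl

/-- The point is that `H`-linearity of `n` distributes the action of `h` on a product over its two
arguments. Multiplying the last two smash factors then corresponds to multiplying in the base. -/
theorem slide_lTensor (hX : X.IsPreBialgebra) {n : V ⊗[K] V →ₗ[K] V}
    (hn : ∀ h z, n (X.sq.actT (h ⊗ₜ z)) = X.actT (h ⊗ₜ n z)) :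
    slide X.actDiag ∘ₗ (n.rTensor H ∘ₗ slide X.actDiag).lTensor (Y ⊗[K] H) ∘ₗ
      (TensorProduct.assoc K (Y ⊗[K] H) (V ⊗[K] H) (V ⊗[K] H)).toLinearMap =
    (n.lTensor Y ∘ₗ (TensorProduct.assoc K Y V V).toLinearMap).rTensor H ∘ₗ slide X.actDiag ∘ₗ
      (slide X.actDiag).rTensor (V ⊗[K] H) := by
  have hb := hX.isBraidedCoalgebra
  refine smash_ext_threefold fun y h s l w => ?_
  induction w with
  | zero => simp
  | add a b ha hb => simp only [TensorProduct.tmul_add, map_add, ha, hb]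
  | tmul t k => ?_
  simp (disch := fun_prop) only [LinearMap.comp_apply, LinearMap.rTensor_tmul, LinearMap.lTensor_tmul, LinearEquiv.coe_coe,
    TensorProduct.assoc_tmul, YDData.slide_actDiag_tmul, map_sw, sw_tmul_right, tmul_sw,
    hopf_comul_mul, sw_sw, sw_tmul, ← hn, sq_act_tmul, hb.mod.mul_act, _root_.mul_assoc]
  simp (disch := fun_prop) only [hopf_sw_coassoc]
  rw [sw_comm]
  refine sw_congr fun h₁ h₂ => ?_
  rw [sw_comm]

theorem slideFst_lTensor (hX : X.IsPreBialgebra) {n : V ⊗[K] V →ₗ[K] V}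
    (hn : ∀ h z, n (X.sq.actT (h ⊗ₜ z)) = X.actT (h ⊗ₜ n z)) :
    X.slideFst Y ∘ₗ (n.rTensor H ∘ₗ slide X.actDiag).lTensor (Y ⊗[K] H) ∘ₗ
      (TensorProduct.assoc K (Y ⊗[K] H) (V ⊗[K] H) (V ⊗[K] H)).toLinearMap =
    n.lTensor Y ∘ₗ (TensorProduct.assoc K Y V V).toLinearMap ∘ₗ X.slideFst (Y ⊗[K] V) ∘ₗ
      (slide X.actDiag).rTensor (V ⊗[K] H) := by
  rw [YDData.slideFst, LinearMap.comp_assoc, slide_lTensor hX hn, ← LinearMap.comp_assoc,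
    smashFst_rTensor]
  rfl

section

variable (hX : X.IsPreBialgebra) {n : V ⊗[K] V →ₗ[K] V}
  (hn : ∀ h z, n (X.sq.actT (h ⊗ₜ z)) = X.actT (h ⊗ₜ n z))
include hX

theorem slideFst₃_rTensor : X.slideFst₃ ∘ₗ
      ((n.rTensor H ∘ₗ slide X.actDiag).rTensor (V ⊗[K] H)).rTensor (V ⊗[K] H) =
    (n.rTensor V).rTensor V ∘ₗ X.slideFst₄ := by
  rw [YDData.slideFst₃, LinearMap.comp_assoc, ← LinearMap.rTensor_comp, LinearMap.rTensor_comp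
    (V ⊗[K] H) (n.rTensor H), ← LinearMap.comp_assoc, slide_rTensor, LinearMap.comp_assoc,
    LinearMap.rTensor_comp, ← LinearMap.comp_assoc, slideFst_rTensor]
  rfl

theorem slideFst₄_tmul (r s t : V) (h l k : H) (w : V ⊗[K] H) :
    ((TensorProduct.assoc K V (V ⊗[K] V) V).toLinearMap ∘ₗ
      (TensorProduct.assoc K V V V).toLinearMap.rTensor V)
        (X.slideFst₄ ((r ⊗ₜ h) ⊗ₜ (s ⊗ₜ l) ⊗ₜ (t ⊗ₜ k) ⊗ₜ w)) =
      r ⊗ₜ X.cube.actT (h ⊗ₜ X.slideFst₃ ((s ⊗ₜ l) ⊗ₜ (t ⊗ₜ k) ⊗ₜ w)) := by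
  have hb := hX.isBraidedCoalgebra
  simp (disch := fun_prop) only [YDData.slideFst₄, YDData.slide₃, LinearMap.comp_apply,
    LinearMap.rTensor_tmul, slideFst₃_tmul, YDData.slide_actDiag_tmul, map_sw, sw_tmul_right,
    sw_sw, sw_tmul, YDData.slideFst_tmul,
    cube_act_tmul, sq_act_tmul, tmul_sw, hopf_comul_mul, hb.mod.mul_act, hopf_sw_coassoc]
  rw [sw_comm]
  simp only [LinearEquiv.coe_coe, TensorProduct.assoc_tmul, sw_comm (Coalgebra.comul (R := K) l)]

include hn

theorem slideFst₃_lTensor : X.slideFst₃ ∘ₗ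
      (n.rTensor H ∘ₗ slide X.actDiag).lTensor ((V ⊗[K] H) ⊗[K] (V ⊗[K] H)) ∘ₗ
        (TensorProduct.assoc K ((V ⊗[K] H) ⊗[K] (V ⊗[K] H)) (V ⊗[K] H) (V ⊗[K] H)).toLinearMap =
    n.lTensor (V ⊗[K] V) ∘ₗ (TensorProduct.assoc K (V ⊗[K] V) V V).toLinearMap ∘ₗ
      X.slideFst₄ := by
  have h := congrArg (fun f => f ∘ₗ ((slide (Y := V) X.actDiag).rTensor (V ⊗[K] H)).rTensor
    (V ⊗[K] H)) (slideFst_lTensor (Y := V ⊗[K] V) hX hn)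
  simp only [LinearMap.comp_assoc, ← LinearMap.rTensor_comp] at h
  refine Eq.trans ?_ h
  refine TensorProduct.ext_fourfold fun a b c d => rfl

theorem slideFst₃_mid : X.slideFst₃ ∘ₗ ((n.rTensor H ∘ₗ slide X.actDiag).lTensor (V ⊗[K] H) ∘ₗ
      (TensorProduct.assoc K (V ⊗[K] H) (V ⊗[K] H) (V ⊗[K] H)).toLinearMap).rTensor (V ⊗[K] H) =
    (n.lTensor V ∘ₗ (TensorProduct.assoc K V V V).toLinearMap).rTensor V ∘ₗ X.slideFst₄ := by
  rw [YDData.slideFst₃, LinearMap.comp_assoc, ← LinearMap.rTensor_comp, slide_lTensor hX hn,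
    LinearMap.rTensor_comp, ← LinearMap.comp_assoc, slideFst_rTensor]
  rfl

end

end YDMulCoalgData
end Bosonizing

/-! ### Linearity, colinearity and the laws of `R^v`. -/

section TwistedPreBialgebra

variable {K : Type*} [Field K]
variable {V H : Type*} [AddCommGroup V] [Module K V] [Ring H] [HopfAlgebra K H]

namespace YDMulCoalgData

variable {X : YDMulCoalgData K H V} {ξ : V ⊗[K] V →ₗ[K] H} {lam : H →ₗ[K] K}
  {v : V ⊗[K] V →ₗ[K] K}

variable (hX : X.IsPreBialgebra) (hξ : X.IsCocycle ξ) (hlam : IsAdInvariantIntegral lam)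
  (hv : X.sq.IsConvInverse (lam ∘ₗ ξ) v)
include hX hξ hlam hv

theorem mulGauge_isCoalgHom :
    IsCoalgHom X.sq.toCoalgData X.toCoalgData (X.mulGauge ξ lam v) :=
  hX.mul_coalgHom.conj hX.sq_isBraidedCoalgebra.comod.isCoalgebra hv.symm

theorem mulGauge_act (h : H) (z : V ⊗[K] V) :
    X.mulGauge ξ lam v (X.sq.actT (h ⊗ₜ z)) = X.actT (h ⊗ₜ X.mulGauge ξ lam v z) := by
  have hm := hX.sq_isBraidedCoalgebra.mod
  exact hm.convL_act (gauge_isActInvariant hX hξ hlam hv)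
    (hm.convR_act (hξ.lam_isActInvariant hlam) hX.mul_act) h z

theorem mulGauge_one_left (s : V) : X.mulGauge ξ lam v (X.one ⊗ₜ s) = s := by
  have h := hX.insert_left_hom.conj_comp (w := v) (w' := lam ∘ₗ ξ)
     hX.isBraidedCoalgebra.comod.isCoalgebra
    (LinearMap.ext (isConvInverse_one_left hX hv (hξ.lam_one_left hlam)))
    (LinearMap.ext (hξ.lam_one_left hlam)) X.mul
  exact (LinearMap.congr_fun h s).trans (hX.one_mul s)

theorem mulGauge_one_right (s : V) : X.mulGauge ξ lam v (s ⊗ₜ X.one) = s := by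
  have h := hX.insert_right_hom.conj_comp (w := v) (w' := lam ∘ₗ ξ)
     hX.isBraidedCoalgebra.comod.isCoalgebra
    (LinearMap.ext (isConvInverse_one_right hX hv (hξ.lam_one_right hlam)))
    (LinearMap.ext (hξ.lam_one_right hlam)) X.mul
  exact (LinearMap.congr_fun h s).trans (hX.mul_one s)

/-- Composed with the surjective coalgebra map `slide` this is the twisted product of `A`, a
conjugate of a coalgebra map. It is the source of the colinearity of `m^v`. -/
theorem mulGauge_rTensor_isCoalgHom : IsCoalgHom (smashCoalg X.sq.toCoalgData X.sq.coact)
    (smashCoalg X.toCoalgData X.coact) ((X.mulGauge ξ lam v).rTensor H) := by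
  have hA := hξ.smash_isUnitalMulCoalgebra hX
  refine (hX.slide_hom (ξ := ξ)).of_comp YDData.slide_actDiag_surjective ?_
  rw [← mulTwist_eq hX hξ hlam hv]
  exact hA.mul_hom.conj hA.isCoalgebra₂ (gauge_isConvInverse hX hξ hlam hv)

/-- The smash coproduct of `r#1` contains the coaction of `r`. Projecting its legs to `H` and `V`
recovers that coaction, so a coalgebra map of the form `n ⊗ H` forces `n` to be colinear. -/
theorem mulGauge_colinear :
    X.coact ∘ₗ X.mulGauge ξ lam v = (X.mulGauge ξ lam v).lTensor H ∘ₗ X.sq.coact := by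
  refine LinearMap.ext fun z => ?_
  have hb := hX.isBraidedCoalgebra.comod
  have hq := hX.sq_isBraidedCoalgebra.comod
  have hn := mulGauge_isCoalgHom hX hξ hlam hv
  have h := congrArg (TensorProduct.map (smashSnd H X.toCoalgData) (smashFst K V H))
    ((mulGauge_rTensor_isCoalgHom hX hξ hlam hv).comul_apply (z ⊗ₜ 1))
  rw [LinearMap.rTensor_tmul] at h
  simp (disch := fun_prop) only [smash_comul_tmul, hopf_comul_one, sw_sw, sw_tmul, map_sw,
    TensorProduct.map_tmul, smashSnd_tmul, smashFst_tmul, LinearMap.rTensor_tmul,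
    Bialgebra.counit_one, one_smul, _root_.mul_one, hn.counit_apply, ← TensorProduct.smul_tmul',
    ← smul_sw, sw_self, hb.isCoalgebra.sw_counit_left, hq.isCoalgebra.sw_counit_left] at h
  rw [LinearMap.comp_apply, h, LinearMap.comp_apply, lTensor_eq_sw]

theorem mulTwist_rTensor : (X.smash ξ).mulTwist (X.mho₂ v) ((lam ∘ₗ ξ) ∘ₗ X.slideFst V) ∘ₗ
      ((X.smash ξ).mulTwist (X.mho₂ v) ((lam ∘ₗ ξ) ∘ₗ X.slideFst V)).rTensor (V ⊗[K] H) =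
    (X.mulGauge ξ lam v ∘ₗ (X.mulGauge ξ lam v).rTensor V).rTensor H ∘ₗ X.slide₃ := by
  rw [mulTwist_eq hX hξ hlam hv, LinearMap.rTensor_comp, LinearMap.comp_assoc,
    ← LinearMap.comp_assoc _ _ (slide X.actDiag), slide_rTensor, LinearMap.rTensor_comp]
  rfl

theorem mulTwist_lTensor : (X.smash ξ).mulTwist (X.mho₂ v) ((lam ∘ₗ ξ) ∘ₗ X.slideFst V) ∘ₗ
      ((X.smash ξ).mulTwist (X.mho₂ v) ((lam ∘ₗ ξ) ∘ₗ X.slideFst V)).lTensor (V ⊗[K] H) ∘ₗ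
        (TensorProduct.assoc K (V ⊗[K] H) (V ⊗[K] H) (V ⊗[K] H)).toLinearMap =
    (X.mulGauge ξ lam v ∘ₗ (X.mulGauge ξ lam v).lTensor V ∘ₗ
      (TensorProduct.assoc K V V V).toLinearMap).rTensor H ∘ₗ X.slide₃ := by
  rw [mulTwist_eq hX hξ hlam hv, LinearMap.comp_assoc, slide_lTensor hX
    (mulGauge_act hX hξ hlam hv)]
  conv_rhs => rw [LinearMap.rTensor_comp]
  rfl

/-- Quasi-associativity of the twist, on the smash coproduct of the cube. -/
theorem smash_quasi_assoc :
    (smashCoalg X.cube.toCoalgData X.cube.coact).convR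
      ((X.mulGauge ξ lam v ∘ₗ (X.mulGauge ξ lam v).lTensor V ∘ₗ
        (TensorProduct.assoc K V V V).toLinearMap).rTensor H)
      (X.reassocGauge ξ v (lam ∘ₗ ξ) ∘ₗ smashFst K _ H) =
    (X.cube.convL (X.reassocGauge ξ v (lam ∘ₗ ξ))
      (X.mulGauge ξ lam v ∘ₗ (X.mulGauge ξ lam v).rTensor V)).rTensor H := by
  have h := MulCoalgData.twist_quasi_assoc (hξ.smash_isBialgebra hX)
    (gauge_isConvInverse hX hξ hlam hv)
  have h₃ := hX.slide₃_hom (ξ := ξ)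
  rw [mulTwist_rTensor hX hξ hlam hv, mulTwist_lTensor hX hξ hlam hv,
    smash_coboundary₂ hX hξ hlam hv, YDData.slideFst₃_eq, ← LinearMap.comp_assoc X.slide₃,
    ← h₃.convR_comp, ← h₃.convL_comp] at h
  rw [← smash_convL_rTensor hX.cube_isBraidedCoalgebra.comod]
  refine IsCoalgHom.eq_of_comp (U := V ⊗[K] H) (D := (V ⊗[K] V ⊗[K] V) ⊗[K] H)
    (C := (V ⊗[K] H) ⊗[K] (V ⊗[K] H) ⊗[K] (V ⊗[K] H)) (YDData.slide₃_surjective (X := X.toYDData)) ?_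
  exact h

theorem mulGauge_lTensor_counit : X.counit ∘ₗ X.mulGauge ξ lam v ∘ₗ
    (X.mulGauge ξ lam v).lTensor V ∘ₗ (TensorProduct.assoc K V V V).toLinearMap =
      X.cube.counit := by
  have hn := mulGauge_isCoalgHom hX hξ hlam hv
  refine TensorProduct.ext_threefold fun r s t => ?_
  simp only [LinearMap.comp_apply, LinearEquiv.coe_coe, TensorProduct.assoc_tmul,
    LinearMap.lTensor_tmul, hn.counit_apply]
  have e (a b : V) : X.sq.counit (a ⊗ₜ b) = X.counit a * X.counit b := rfl
  have e' (a b c : V) : X.cube.counit (a ⊗ₜ b ⊗ₜ c) = X.counit a * X.counit b * X.counit c := rfl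
  rw [e, hn.counit_apply, e, e', _root_.mul_assoc]

theorem mulGauge_rTensor_counit : X.counit ∘ₗ X.mulGauge ξ lam v ∘ₗ
    (X.mulGauge ξ lam v).rTensor V = X.cube.counit := by
  have hn := mulGauge_isCoalgHom hX hξ hlam hv
  refine TensorProduct.ext_threefold fun r s t => ?_
  simp only [LinearMap.comp_apply, LinearMap.rTensor_tmul, hn.counit_apply]
  have e (a b : V) : X.sq.counit (a ⊗ₜ b) = X.counit a * X.counit b := rfl
  have e' (a b c : V) : X.cube.counit (a ⊗ₜ b ⊗ₜ c) = X.counit a * X.counit b * X.counit c := rfl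
  rw [e, hn.counit_apply, e, e']

/-- The projection `v#h ↦ ε(v)h` is applied to quasi-associativity at `c#1`. Both iterated products
reduce to counits: one side keeps the coaction of `c` paired with the reassociator, the other only
its value at `c`. -/
theorem sw_reassocGauge (c : V ⊗[K] V ⊗[K] V) :
    sw (X.cube.coact c) (fun g d => X.reassocGauge ξ v (lam ∘ₗ ξ) d • g) =
      X.reassocGauge ξ v (lam ∘ₗ ξ) c • (1 : H) := by
  have hc := hX.cube_isBraidedCoalgebra.comod
  have h := congrArg (smashSnd H X.toCoalgData)
    (LinearMap.congr_fun (smash_quasi_assoc hX hξ hlam hv) (c ⊗ₜ 1))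
  have e₁ (a) := LinearMap.congr_fun (mulGauge_lTensor_counit hX hξ hlam hv) a
  have e₂ := mulGauge_rTensor_counit hX hξ hlam hv
  have e₃ : X.counit ∘ₗ X.cube.convL (X.reassocGauge ξ v (lam ∘ₗ ξ))
      (X.mulGauge ξ lam v ∘ₗ (X.mulGauge ξ lam v).rTensor V) =
      X.reassocGauge ξ v (lam ∘ₗ ξ) := by
    rw [comp_convL, e₂, ← convR_eq_convL, hc.isCoalgebra.convR_counit]
  have e₄ (a) := LinearMap.congr_fun e₃ a
  rw [LinearMap.rTensor_tmul, smashSnd_tmul] at h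
  simp only [LinearMap.comp_apply] at e₁ e₄
  rw [e₄] at h
  simp (disch := fun_prop) only [convR_apply, smash_comul_tmul, hopf_comul_one, sw_sw, sw_tmul,
    map_sw, map_smul, smashSnd_tmul, smashFst_tmul, LinearMap.rTensor_tmul, LinearMap.comp_apply, e₁,
    Bialgebra.counit_one, one_smul, _root_.mul_one, smul_comm _ (X.cube.counit _), ← smul_sw,
    hc.isCoalgebra.sw_counit_left] at h
  exact h

theorem reassocGauge_colinear : (YDCoalgData.unitObject K H).coact ∘ₗ
    X.reassocGauge ξ v (lam ∘ₗ ξ) = (X.reassocGauge ξ v (lam ∘ₗ ξ)).lTensor H ∘ₗ X.cube.coact := by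
  refine LinearMap.ext fun c => ?_
  have h := congrArg (fun y => y ⊗ₜ[K] (1 : K)) (sw_reassocGauge hX hξ hlam hv c)
  have e (k : K) : (YDCoalgData.unitObject K H).coact k = (1 : H) ⊗ₜ[K] k := rfl
  have e' (g : H) (k : K) : g ⊗ₜ[K] k = (k • g) ⊗ₜ[K] (1 : K) := by
    rw [TensorProduct.smul_tmul, smul_eq_mul, _root_.mul_one]
  simp only [sw_tmul_right, ← e'] at h
  rw [LinearMap.comp_apply, LinearMap.comp_apply, lTensor_eq_sw, e, h]

theorem reassocGauge_quasi_assoc :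
    X.cube.convR (X.mulGauge ξ lam v ∘ₗ (X.mulGauge ξ lam v).lTensor V ∘ₗ
        (TensorProduct.assoc K V V V).toLinearMap) (X.reassocGauge ξ v (lam ∘ₗ ξ)) =
      X.cube.convL (X.reassocGauge ξ v (lam ∘ₗ ξ))
        (X.mulGauge ξ lam v ∘ₗ (X.mulGauge ξ lam v).rTensor V) := by
  have hc := hX.cube_isBraidedCoalgebra.comod
  have h := congrArg (fun f => smashFst K V H ∘ₗ f) (smash_quasi_assoc hX hξ hlam hv)
  rw [comp_convR (C := (V ⊗[K] V ⊗[K] V) ⊗[K] H) (M := V ⊗[K] H) (N := V), smashFst_rTensor, smashFst_rTensor, ← (smashFst_isCoalgHom hc).convR_comp] at h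
  exact IsCoalgHom.eq_of_comp (C := (V ⊗[K] V ⊗[K] V) ⊗[K] H) YDData.smashFst_surjective h

/-- Pulled back along the surjective coalgebra map `slideFst₄`, each of the five factors becomes the
corresponding factor of the cocycle identity for the twist of `A`. -/
theorem reassocGauge_cocycle :
    let m := X.mulGauge ξ lam v
    let α := X.reassocGauge ξ v (lam ∘ₗ ξ)
    let Y := X.cube.tensor X.toYDCoalgData
    Y.convL (α ∘ₗ m.lTensor (V ⊗[K] V) ∘ₗ (TensorProduct.assoc K (V ⊗[K] V) V V).toLinearMap)
        (α ∘ₗ (m.rTensor V).rTensor V) =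
      Y.convL
        (funcTensor X.counit α ∘ₗ (TensorProduct.assoc K V (V ⊗[K] V) V).toLinearMap ∘ₗ
          (TensorProduct.assoc K V V V).toLinearMap.rTensor V)
        (Y.convL
          (α ∘ₗ (m.lTensor V ∘ₗ (TensorProduct.assoc K V V V).toLinearMap).rTensor V)
          (funcTensor α X.counit)) := by
  intro m α Y
  have h := MulCoalgData.twist_cocycle (hξ.smash_isBialgebra hX)
    (gauge_isConvInverse hX hξ hlam hv)
  have hn : ∀ h z, m (X.sq.actT (h ⊗ₜ z)) = X.actT (h ⊗ₜ m z) := mulGauge_act hX hξ hlam hv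
  have hα : IsActInvariant X.cube.actT α := reassocGauge_isActInvariant hX hξ hlam hv
  have h₄ : IsCoalgHom (X.smash ξ).X₄ Y.toCoalgData X.slideFst₄ := hX.slideFst₄_hom
  -- In `slideFst₄` the component `g` of the first factor acts diagonally on the other three.
  -- Invariance of `α` replaces this action by `ε(g)`.
  have e₁ : funcTensor (X.smash ξ).counit (α ∘ₗ X.slideFst₃) ∘ₗ
      (TensorProduct.assoc K (V ⊗[K] H) ((V ⊗[K] H) ⊗[K] (V ⊗[K] H)) (V ⊗[K] H)).toLinearMap ∘ₗ
        (TensorProduct.assoc K (V ⊗[K] H) (V ⊗[K] H) (V ⊗[K] H)).toLinearMap.rTensor (V ⊗[K] H) =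
      (funcTensor X.counit α ∘ₗ (TensorProduct.assoc K V (V ⊗[K] V) V).toLinearMap ∘ₗ
          (TensorProduct.assoc K V V V).toLinearMap.rTensor V) ∘ₗ X.slideFst₄ := by
    refine TensorProduct.ext_fourfold fun x y z w => ?_
    induction x with
    | zero => simp
    | add a b ha hb => simp only [TensorProduct.add_tmul, map_add, ha, hb]
    | tmul r g =>
      induction y with
      | zero => simp
      | add a b ha hb => simp only [TensorProduct.add_tmul, TensorProduct.tmul_add, map_add, ha, hb]
      | tmul s l =>
        induction z with
        | zero => simp
        | add a b ha hb =>
          simp only [TensorProduct.add_tmul, TensorProduct.tmul_add, map_add, ha, hb]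
        | tmul t k =>
          rw [LinearMap.comp_apply, LinearMap.comp_apply _ X.slideFst₄,
            LinearMap.comp_apply (funcTensor X.counit α), slideFst₄_tmul hX]
          change (X.counit r * Coalgebra.counit (R := K) g) *
            α (X.slideFst₃ ((s ⊗ₜ l) ⊗ₜ (t ⊗ₜ k) ⊗ₜ w)) = X.counit r * α _
          rw [hα, _root_.mul_assoc]
  have e₂ : funcTensor (α ∘ₗ X.slideFst₃) (X.smash ξ).counit =
      funcTensor α X.counit ∘ₗ X.slideFst₄ := by
    refine TensorProduct.ext' fun c w => ?_
    have e : X.slideFst₄ (c ⊗ₜ w) = sw (X.slide₃ c) fun z h =>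
        z ⊗ₜ X.actT (h ⊗ₜ smashFst K V H w) := by
      rw [YDData.slideFst₄, LinearMap.comp_apply, LinearMap.rTensor_tmul]
      conv_lhs => rw [← sw_self (X.slide₃ c), sw_tmul_right, map_sw]
      simp only [YDData.slideFst_tmul]
    have e' : X.slideFst₃ c = sw (X.slide₃ c) fun z h => Coalgebra.counit (R := K) h • z := by
      rw [YDData.slideFst₃_eq, LinearMap.comp_apply]
      conv_lhs => rw [← sw_self (X.slide₃ c), map_sw]
      simp only [smashFst_tmul]
    have e'' : (X.smash ξ).counit w = X.counit (smashFst K V H w) :=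
      ((smashFst_isCoalgHom hX.isBraidedCoalgebra.comod).counit_apply w).symm
    have e₃ (z : V ⊗[K] V ⊗[K] V) (t : V) :
        funcTensor α X.counit (z ⊗ₜ t) = α z * X.counit t := rfl
    change α (X.slideFst₃ c) * (X.smash ξ).counit w = _
    rw [LinearMap.comp_apply, e, e', e'', map_sw, map_sw, sw_mul]
    refine sw_congr fun z g => ?_
    rw [e₃, hX.isBraidedCoalgebra.mod.counit_act, map_smul, smul_eq_mul, smul_eq_mul]
    ring
  rw [mulTwist_eq hX hξ hlam hv, smash_coboundary₂ hX hξ hlam hv] at h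
  refine IsCoalgHom.eq_of_comp (YDData.slideFst₄_surjective (X := X.toYDData)) ?_
  have f₁ := slideFst₃_lTensor hX hn
  have f₂ := slideFst₃_rTensor hX (n := m)
  have f₃ := slideFst₃_mid hX hn
  simp only [h₄.convL_comp]
  rw [← e₁, ← e₂]
  simp only [LinearMap.comp_assoc, ← f₁, ← f₂, ← f₃]
  exact h

end YDMulCoalgData
end TwistedPreBialgebra

/-! ### Assembling the twist of `R` and the equality with its bosonization. -/

section TwistTheoremOfCocycle

namespace YDMulCoalgData

variable {K : Type*} [Field K]
variable {V H : Type*} [AddCommGroup V] [Module K V] [Ring H] [HopfAlgebra K H]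
variable {X : YDMulCoalgData K H V} {ξ : V ⊗[K] V →ₗ[K] H} {lam : H →ₗ[K] K}
  {v : V ⊗[K] V →ₗ[K] K}

variable (hX : X.IsPreBialgebra) (hξ : X.IsCocycle ξ) (hlam : IsAdInvariantIntegral lam)
  (hv : X.sq.IsConvInverse (lam ∘ₗ ξ) v)
include hX hξ hlam hv

theorem twist_mul : (X.twist ξ v).mul = X.mulGauge ξ lam v := by
  rw [mulGauge, ← hv.symm.convInv_eq hX.sq_isBraidedCoalgebra.comod.isCoalgebra]
  rfl

theorem reassocGauge_reassocLaws : ReassocLaws X.counit X.cube.toCoalgData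
    (X.cube.tensor X.toYDCoalgData).toCoalgData (X.mulGauge ξ lam v) X.one
    (X.reassocGauge ξ v (lam ∘ₗ ξ)) := by
  have hA := hξ.smash_isUnitalMulCoalgebra hX
  have hg := gauge_isGaugeTransformation hX hξ hlam hv
  have e (a : V) : (X.smash ξ).counit (a ⊗ₜ 1) = X.counit a := by
    have : (X.smash ξ).counit (a ⊗ₜ 1) = X.counit a * Coalgebra.counit (R := K) (1 : H) := rfl
    rw [this, Bialgebra.counit_one, _root_.mul_one]
  have hc := coboundary₂_eq_reassocGauge hX hξ hlam hv
  exact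
  { one_mul := mulGauge_one_left hX hξ hlam hv
    mul_one := mulGauge_one_right hX hξ hlam hv
    invertible := reassocGauge_isConvInvertible hX hξ hlam hv
    cocycle := reassocGauge_cocycle hX hξ hlam hv
    unital_left := fun x y => by
      have h := MulCoalgData.coboundary₂_unital_left hA hg (x ⊗ₜ 1) (y ⊗ₜ 1)
      rw [e, e] at h
      rw [← hc]
      exact h
    unital_mid := fun x y => by
      have h := MulCoalgData.coboundary₂_unital_mid hA hg (x ⊗ₜ 1) (y ⊗ₜ 1)
      rw [e, e] at h
      rw [← hc]
      exact h
    unital_right := fun x y => by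
      have h := MulCoalgData.coboundary₂_unital_right hA hg (x ⊗ₜ 1) (y ⊗ₜ 1)
      rw [e, e] at h
      rw [← hc]
      exact h
    quasi_assoc := reassocGauge_quasi_assoc hX hξ hlam hv }

theorem mulGauge_isYDHom : IsYDHom X.sq.toYDData X.toYDData (X.mulGauge ξ lam v) where
  linear h z := by
    have e := mulGauge_act hX hξ hlam hv h z
    rw [YDData.actT_tmul, YDData.actT_tmul] at e
    exact e
  colinear := mulGauge_colinear hX hξ hlam hv

theorem reassocGauge_isYDHom : IsYDHom X.cube.toYDData (YDCoalgData.unitObject K H).toYDData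
    (X.reassocGauge ξ v (lam ∘ₗ ξ)) where
  linear h c := by
    have e := reassocGauge_isActInvariant hX hξ hlam hv h c
    rw [YDData.actT_tmul] at e
    exact e
  colinear := reassocGauge_colinear hX hξ hlam hv

theorem twist_isDualQuasiBialgebra : (X.twist ξ v).IsDualQuasiBialgebra := by
  have hm := twist_mul hX hξ hlam hv
  have hr : (X.twist ξ v).reassoc = X.reassocGauge ξ v (lam ∘ₗ ξ) :=
    coboundary₂_eq_reassocGauge hX hξ hlam hv
  have h₁ := mulGauge_isYDHom hX hξ hlam hv
  have h₂ := mulGauge_isCoalgHom hX hξ hlam hv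
  have h₃ := reassocGauge_isYDHom hX hξ hlam hv
  have h₄ := reassocGauge_reassocLaws hX hξ hlam hv
  exact
  { isYDCoalgebra := hX.isYDCoalgebra
    unit_hom := hX.unit_hom
    unit_coalgHom := hX.unit_coalgHom
    mul_hom := by
      rw [hm]
      exact h₁
    mul_coalgHom := by
      rw [hm]
      exact h₂
    reassoc_hom := by
      rw [hr]
      exact h₃
    laws := by
      rw [hm, hr]
      exact h₄ }

theorem smash_twist_eq_bosonization :
    (X.smash ξ).withTrivialReassoc.twist (X.mho₂ v) = (X.twist ξ v).bosonization := by
  have hA := hξ.smash_isUnitalMulCoalgebra hX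
  have hm : ((X.smash ξ).withTrivialReassoc.twist (X.mho₂ v)).mul =
      (X.twist ξ v).bosonization.mul := by
    have h := mulTwist_eq hX hξ hlam hv
    rw [← (gauge_isConvInverse hX hξ hlam hv).convInv_eq hA.isCoalgebra₂,
      ← twist_mul hX hξ hlam hv] at h
    exact h
  have hr : ((X.smash ξ).withTrivialReassoc.twist (X.mho₂ v)).reassoc =
      (X.twist ξ v).bosonization.reassoc := by
    rw [MulCoalgData.twist_reassoc hA, smash_coboundary₂ hX hξ hlam hv, ← YDData.mho₃_eq,
      ← coboundary₂_eq_reassocGauge hX hξ hlam hv]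
    rfl
  exact DQBData.ext rfl rfl hm rfl hr

end YDMulCoalgData

end TwistTheoremOfCocycle

end

theorem mainTheorem6 {K H R : Type*} [Field K] [CharZero K] [Ring H] [HopfAlgebra K H]
    [AddCommGroup R] [Module K R]
    (lam : H →ₗ[K] K) (hlam : IsAdInvariantIntegral lam)
    (X : YDMulCoalgData K H R) (hX : X.IsPreBialgebra) (hconn : X.IsConnected)
    (ξ : R ⊗[K] R →ₗ[K] H) (hξ : X.IsCocycle ξ) :
    let A : MulCoalgData K (R ⊗[K] H) := X.smash ξ
    let v : R ⊗[K] R →ₗ[K] K := X.gaugeOf lam ξ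
    let vA : (R ⊗[K] H) ⊗[K] (R ⊗[K] H) →ₗ[K] K := X.mho₂ v
    let Rv : YDDQBData K H R := X.twist ξ v
    A.IsBialgebra ∧
      X.sq.IsConvInverse (lam ∘ₗ ξ) v ∧
      A.IsGaugeTransformation vA ∧
      Rv.IsDualQuasiBialgebra ∧
      (A.withTrivialReassoc.twist vA).IsDualQuasiBialgebra ∧
      A.withTrivialReassoc.twist vA = Rv.bosonization := by
  intro A v vA Rv
  -- The functional `convInv` is zero when no inverse exists, so connectedness is needed here for
  -- `v` to be a genuine inverse of `λξ`.
  have hv : X.sq.IsConvInverse (lam ∘ₗ ξ) v :=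
    (hX.sq_isConvInvertible hconn _ (hξ.lam_one_left hlam)).isConvInverse
  have hA : A.IsBialgebra := hξ.smash_isBialgebra hX
  have hg := YDMulCoalgData.gauge_isGaugeTransformation hX hξ hlam hv
  exact ⟨hA, hv, hg, YDMulCoalgData.twist_isDualQuasiBialgebra hX hξ hlam hv,
    MulCoalgData.twist_isDualQuasiBialgebra hA hg,
    YDMulCoalgData.smash_twist_eq_bosonization hX hξ hlam hv⟩
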